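/- Let $\mathbb K$ be a field, $q\in\mathbb K^\ast$, let $\mathcal A$ be an associative unital $\mathbb K$-algebra, and let $m,n$ be nonnegative integers. Let $\mathcal E^{m,n}$ be the set of corteges $(I|J)$: pairs $I\subseteq[m]$, $J\subseteq[n]$ with $|I|=|J|$. Let $Pint$ be the set of pressed double intervals: corteges $(I|J)$ such that $I,J$ are nonempty intervals $\{a,a+1,\dots,b\}$ and $I=[|I|]$ or $J=[|J|]$. For a set $A$ and elements $a,\dots,b\notin A$ write $Aa\ldots b=A\cup\{a,\dots,b\}$. **Minors and QI-functions.** An $m\times n$ matrix $X=(x_{ij})$ over a $\mathbb K$-algebra is a fine $q$-matrix if, for all $i<\ell$ and $j<k$ (in each relation only the indices occurring in it are quantified), $x_{ij}x_{ik}=qx_{ik}x_{ij}$, $x_{ij}x_{\ell j}=qx_{\ell j}x_{ij}$, $x_{ik}x_{\ell j}=x_{\ell j}x_{ik}$ and $x_{ij}x_{\ell k}-x_{\ell k}x_{ij}=(q-q^{-1})x_{ik}x_{\ell j}$. For $I=\{i_1<\dots<i_k\}$ and $J=\{j_1<\dots<j_k\}$ put $\Delta_{X,q}(I|J)=\sum_{\sigma\in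 S_k}(-q)^{\ell(\sigma)}x_{i_1j_{\sigma(1)}}\cdots x_{i_kj_{\sigma(k)}}$, where $\ell(\sigma)$ is the number of inversions of $\sigma$. A universal quadratic identity is a finite formal relation $\sum_r\pm q^{\delta_r}\Delta(I_r|J_r)\Delta(I'_r|J'_r)=0$ with $\delta_r\in\mathbb Z$, in which each of $I_r\cup I_r'$, $I_r\cap I_r'$, $J_r\cup J_r'$, $J_r\cap J_r'$ does not depend on $r$, and which holds for the minors of all fine $q$-matrices of size $m\times n$ over all $\mathbb K$-algebras and for all $q\in\mathbb K^\ast$. A function $f:\mathcal E^{m,n}\to\mathcal A$ is a QI-function if it satisfies (for the given $q$) all relations obtained from universal quadratic identities by replacing $\Delta$ by $f$. **RQI-functions.** A function $f:\mathcal E^{m,n}\to\mathcal A$ is an RQI-function if: - $f(Aj|B)f(Aik|B\ell)=f(Aij|B\ell)f(Ak|B)+f(Ajk|B\ell)f(Ai|B)$ whenever $A\subset[m]$, $B\subset[n]$, $|A|+1=|B|$, $i<j<k$ are in $[m]\setminus A$ and $\ell\in[n]\setminus B$; - $f(A|Bj)f(A\ell|Bik)=f(A\ell|Bij)f(A|Bk)+f(A\ell|Bjk)f(A|Bi)$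 whenever $A\subset[m]$, $B\subset[n]$, $|A|=|B|+1$, $i<j<k$ are in $[n]\setminus B$ and $\ell\in[m]\setminus A$; - $f(Ai|Bj)f(Ak|B\ell)=f(Aik|Bj\ell)f(A|B)+q\,f(Ai|B\ell)f(Ak|Bj)$ whenever $i,k\in[m]$, $j,\ell\in[n]$, $k-i=\ell-j>0$, $A=\{i+1,\dots,k-1\}$ and $B=\{j+1,\dots,\ell-1\}$. **The function $f_0$ and its extension.** Let $f_0:Pint\to\mathcal A^\ast$ take invertible values satisfying the quasi-commutation relations: for $(I|J),(I'|J')\in Pint$ with $|I|\ge|I'|$, $$f_0(I|J)f_0(I'|J')=q^{c}f_0(I'|J')f_0(I|J),\qquad c=\beta+\delta-\alpha-\gamma,$$ where $\alpha$ (resp. $\beta$) is the number of elements of $I'$ less than $\min I$ (resp. greater than $\max I$), and $\gamma$ (resp. $\delta$) is the number of elements of $J'$ less than $\min J$ (resp. greater than $\max J$). For $(i,j)\in[m]\times[n]$ put $k=\min\{i,j\}$ and $\pi(i,j)=([i-k+1..i]\,|\,[j-k+1..j])\in Pint$; put $w(i,j)=f_0(\pi(i,j))$ if $k=1$ and $w(i,j)=f_0(\pi(i-1,j-1))^{-1}f_0(\pi(i,j))$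 otherwise. Let $G$ be the directed graph on the points $(i,j)\neq(0,0)$ with $0\le i\le m$, $0\le j\le n$, with horizontal edges $(i,j-1)\to(i,j)$ and vertical edges $(i,j)\to(i-1,j)$ for $i\in[m]$, $j\in[n]$. The weight of a horizontal edge $(i,j-1)\to(i,j)$ is $w(i,1)$ if $j=1$ and $w(i,j-1)^{-1}w(i,j)$ if $j>1$; the weight of a vertical edge is $1$. The weight of a path is the ordered product of its edge weights. The path matrix $\mathrm{Path}$ has as its $(i,j)$ entry the sum of the weights of all directed paths from $(i,0)$ to $(0,j)$ in $G$. Let $f(I|J)=\Delta_{\mathrm{Path},q}(I|J)$ for all $(I|J)\in\mathcal E^{m,n}$. **Corollary.** Let $\mathcal L_Y$ be the $\mathbb K$-algebra of quantized Laurent polynomials in the indeterminates $y_{I|J}$, $(I|J)\in Pint$: it is generated by the $y_{I|J}$ and their inverses, subject to the same quasi-commutation relations as $f_0$. Let $\mathcal A^{f_0}\subseteq\mathcal A$ be the $\mathbb K$-subalgebra generated by the values of $f_0$ and their inverses. Assume that (i) the values of $f_0$ are algebraically independent, i.e. $y_{I|J}\mapsto f_0(I|J)$ gives an isomorphism of $\mathbb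 K$-algebras $\mathcal L_Y\to\mathcal A^{f_0}$; (ii) every $a\in\mathcal A^{f_0}$ that is a zerodivisor in $\mathcal A$ is a zerodivisor in $\mathcal A^{f_0}$, where $a$ is a zerodivisor in a ring $R$ if $ab=0$ or $ba=0$ for some nonzero $b\in R$. Then every RQI-function $g:\mathcal E^{m,n}\to\mathcal A$ with $g(\emptyset|\emptyset)=1$ that coincides with $f_0$ on $Pint$ is a QI-function, and $g=f$. -/

import Mathlib

universe u v

namespace QuantumMinors

noncomputable section

/-! ### Corteges, intervals, pressed double intervals

Rows `1, …, m` and columns `1, …, n` are indexed by `Fin m` and `Fin n` (shifted by one). -/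

/-- A cortege `(I|J)`: a set of rows and a set of columns of the same size. -/
@[ext]
structure Cortege (m n : ℕ) where
  rows : Finset (Fin m)
  cols : Finset (Fin n)
  card_eq : rows.card = cols.card

/-- The cortege `(∅|∅)`. -/
def Cortege.empty (m n : ℕ) : Cortege m n := ⟨∅, ∅, rfl⟩

/-- A (nonempty) interval `{a, a+1, …, b}`. -/
def IsInterval {n : ℕ} (I : Finset (Fin n)) : Prop :=
  ∃ a b : Fin n, a ≤ b ∧ I = Finset.Icc a b

/-- `I` consists of the first `|I|` indices. -/
def IsInitial {n : ℕ} (I : Finset (Fin n)) : Prop :=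
  ∀ x : Fin n, x ∈ I ↔ (x : ℕ) < I.card

/-- A double interval at least one of whose two sides is initial. -/
def Cortege.IsPressed {m n : ℕ} (c : Cortege m n) : Prop :=
  IsInterval c.rows ∧ IsInterval c.cols ∧ (IsInitial c.rows ∨ IsInitial c.cols)

/-- The set of pressed double intervals. -/
abbrev PInt (m n : ℕ) : Type := {c : Cortege m n // c.IsPressed}

/-- The value `f(I|J)`; the value `0` for `|I| ≠ |J|` is a convention that is not used below. -/
def val {m n : ℕ} {A : Type v} [Ring A] (f : Cortege m n → A)
    (I : Finset (Fin m)) (J : Finset (Fin n)) : A :=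
  if h : I.card = J.card then f ⟨I, J, h⟩ else 0

/-! ### Fine `q`-matrices and quantum minors -/

/-- The power `q ^ d` of the parameter, as an element of the field. -/
def qpow {K : Type u} [Field K] (q : Kˣ) (d : ℤ) : K := ((q ^ d : Kˣ) : K)

/-- Manin's relations for a matrix over a `K`-algebra. -/
structure IsFine {K : Type u} [Field K] (q : Kˣ) {A : Type v} [Ring A] [Algebra K A]
    {m n : ℕ} (X : Matrix (Fin m) (Fin n) A) : Prop where
  row : ∀ (i : Fin m) (j k : Fin n), j < k → X i j * X i k = (q : K) • (X i k * X i j)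
  col : ∀ (i l : Fin m) (j : Fin n), i < l → X i j * X l j = (q : K) • (X l j * X i j)
  anti : ∀ (i l : Fin m) (j k : Fin n), i < l → j < k → X i k * X l j = X l j * X i k
  cross : ∀ (i l : Fin m) (j k : Fin n), i < l → j < k →
    X i j * X l k - X l k * X i j = ((q : K) - (q : K)⁻¹) • (X i k * X l j)

/-- The number of inversions of a permutation. -/
def invCount {k : ℕ} (σ : Equiv.Perm (Fin k)) : ℕ :=
  (Finset.univ.filter fun p : Fin k × Fin k => p.1 < p.2 ∧ σ p.2 < σ p.1).card

/-- The quantum minor `∑_σ (-q)^{ℓ(σ)} x_{i_1 j_{σ(1)}} ⋯ x_{i_k j_{σ(k)}}`, where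
`i_1 < ⋯ < i_k` and `j_1 < ⋯ < j_k` list the rows and the columns. -/
def qMinor {K : Type u} [Field K] (q : Kˣ) {A : Type v} [Ring A] [Algebra K A]
    {m n : ℕ} (X : Matrix (Fin m) (Fin n) A) (c : Cortege m n) : A :=
  ∑ σ : Equiv.Perm (Fin c.rows.card), (-(q : K)) ^ invCount σ •
    (List.ofFn fun d : Fin c.rows.card =>
      X (c.rows.orderEmbOfFin rfl d) (c.cols.orderEmbOfFin c.card_eq.symm (σ d))).prod

/-! ### Universal quadratic identities, QI-functions and RQI-functions -/

/-- A formal term `± q^δ Δ(I|J) Δ(I'|J')`. -/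
structure QITerm (m n : ℕ) where
  sign : ℤˣ
  exponent : ℤ
  fst : Cortege m n
  snd : Cortege m n

/-- The value of the formal sum when `Δ` is replaced by the function `f`. -/
def evalQI {K : Type u} [Field K] (q : Kˣ) {A : Type v} [Ring A] [Algebra K A]
    {m n : ℕ} (f : Cortege m n → A) (Q : List (QITerm m n)) : A :=
  (Q.map fun t => (((t.sign : ℤ) : K) * qpow q t.exponent) • (f t.fst * f t.snd)).sum

/-- Unions and intersections of the row sets, and of the column sets, are the same in all terms. -/
def IsHomogeneous {m n : ℕ} (Q : List (QITerm m n)) : Prop :=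
  ∀ s ∈ Q, ∀ t ∈ Q,
    s.fst.rows ∪ s.snd.rows = t.fst.rows ∪ t.snd.rows ∧
    s.fst.rows ∩ s.snd.rows = t.fst.rows ∩ t.snd.rows ∧
    s.fst.cols ∪ s.snd.cols = t.fst.cols ∪ t.snd.cols ∧
    s.fst.cols ∩ s.snd.cols = t.fst.cols ∩ t.snd.cols

/-- A homogeneous identity that holds for the minors of every fine `q`-matrix over every
`K`-algebra, for every `q ∈ K^*`. -/
def IsUniversal (K : Type u) [Field K] {m n : ℕ} (Q : List (QITerm m n)) : Prop :=
  IsHomogeneous Q ∧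
    ∀ (q : Kˣ) (B : Type v) [Ring B] [Algebra K B] (X : Matrix (Fin m) (Fin n) B),
      IsFine q X → evalQI q (qMinor q X) Q = 0

/-- `f` satisfies all universal quadratic identities. -/
def IsQIFunction {K : Type u} [Field K] (q : Kˣ) {A : Type v} [Ring A] [Algebra K A]
    {m n : ℕ} (f : Cortege m n → A) : Prop :=
  ∀ Q : List (QITerm m n), IsUniversal.{u, v} K Q → evalQI q f Q = 0

/-- `f` satisfies the Plücker-type and co-Plücker-type relations with triples and the
Dodgson-type relations. -/
structure IsRQIFunction {K : Type u} [Field K] (q : Kˣ) {A : Type v} [Ring A] [Algebra K A]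
    {m n : ℕ} (f : Cortege m n → A) : Prop where
  pluecker : ∀ (S : Finset (Fin m)) (T : Finset (Fin n)) (i j k : Fin m) (l : Fin n),
    S.card + 1 = T.card → i < j → j < k → i ∉ S → j ∉ S → k ∉ S → l ∉ T →
    val f (insert j S) T * val f (insert i (insert k S)) (insert l T) =
      val f (insert i (insert j S)) (insert l T) * val f (insert k S) T +
      val f (insert j (insert k S)) (insert l T) * val f (insert i S) T
  copluecker : ∀ (S : Finset (Fin m)) (T : Finset (Fin n)) (l : Fin m) (i j k : Fin n),
    S.card = T.card + 1 → i < j → j < k → i ∉ T → j ∉ T → k ∉ T → l ∉ S →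
    val f S (insert j T) * val f (insert l S) (insert i (insert k T)) =
      val f (insert l S) (insert i (insert j T)) * val f S (insert k T) +
      val f (insert l S) (insert j (insert k T)) * val f S (insert i T)
  dodgson : ∀ (i k : Fin m) (j l : Fin n), i < k → (k : ℕ) + j = l + i →
    val f (insert i (Finset.Ioo i k)) (insert j (Finset.Ioo j l)) *
        val f (insert k (Finset.Ioo i k)) (insert l (Finset.Ioo j l)) =
      val f (insert i (insert k (Finset.Ioo i k))) (insert j (insert l (Finset.Ioo j l))) *
        val f (Finset.Ioo i k) (Finset.Ioo j l) +
      (q : K) • (val f (insert i (Finset.Ioo i k)) (insert l (Finset.Ioo j l)) *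
        val f (insert k (Finset.Ioo i k)) (insert j (Finset.Ioo j l)))

/-! ### Quasi-commutation on pressed double intervals -/

/-- The number of elements of `I'` that precede all of `I`. -/
def numBelow {n : ℕ} (I I' : Finset (Fin n)) : ℕ := (I'.filter fun x => ∀ y ∈ I, x < y).card

/-- The number of elements of `I'` that follow all of `I`. -/
def numAbove {n : ℕ} (I I' : Finset (Fin n)) : ℕ := (I'.filter fun x => ∀ y ∈ I, y < x).card

/-- The exponent `β + δ - α - γ` of the quasi-commutation relation of `(I|J)` and `(I'|J')`,
to be used for `|I| ≥ |I'|`. -/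
def qcExp {m n : ℕ} (c c' : Cortege m n) : ℤ :=
  (numAbove c.rows c'.rows : ℤ) + numAbove c.cols c'.cols
    - numBelow c.rows c'.rows - numBelow c.cols c'.cols

/-- The quasi-commutation relations for invertible elements indexed by `PInt m n`. -/
def QuasiCommutes {K : Type u} [Field K] (q : Kˣ) {A : Type v} [Ring A] [Algebra K A]
    {m n : ℕ} (f₀ : PInt m n → Aˣ) : Prop :=
  ∀ c c' : PInt m n, c'.1.rows.card ≤ c.1.rows.card →
    (f₀ c : A) * (f₀ c' : A) = qpow q (qcExp c.1 c'.1) • ((f₀ c' : A) * (f₀ c : A))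

/-! ### The extended grid, its path matrix, and the extension of `f₀` -/

/-- Vertices `(i, j)`, `0 ≤ i ≤ m`, `0 ≤ j ≤ n`, `(i, j) ≠ (0, 0)`; here `i` is the vertical
coordinate. -/
abbrev GridVertex (m n : ℕ) : Type := {p : Fin (m + 1) × Fin (n + 1) // p ≠ (0, 0)}

/-- The source `r_{i+1} = (i+1, 0)`. -/
def source {m : ℕ} (n : ℕ) (i : Fin m) : GridVertex m n :=
  ⟨(i.succ, 0), fun h => Fin.succ_ne_zero i (congrArg Prod.fst h)⟩

/-- The sink `c_{j+1} = (0, j+1)`. -/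
def sink (m : ℕ) {n : ℕ} (j : Fin n) : GridVertex m n :=
  ⟨(0, j.succ), fun h => Fin.succ_ne_zero j (congrArg Prod.snd h)⟩

/-- Horizontal edges go from `(i, j-1)` to `(i, j)`, `i, j ≥ 1`. -/
def IsHEdge {m n : ℕ} (a b : GridVertex m n) : Prop :=
  a.1.1 = b.1.1 ∧ a.1.1 ≠ 0 ∧ (b.1.2 : ℕ) = a.1.2 + 1

/-- Vertical edges go from `(i, j)` to `(i-1, j)`, `i, j ≥ 1`. -/
def IsVEdge {m n : ℕ} (a b : GridVertex m n) : Prop :=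
  a.1.2 = b.1.2 ∧ a.1.2 ≠ 0 ∧ (a.1.1 : ℕ) = b.1.1 + 1

open Classical in
/-- The directed paths from `a` to `b`, as lists of (distinct) vertices. -/
def gridPaths {m n : ℕ} (a b : GridVertex m n) :
    Finset {l : List (GridVertex m n) // l.Nodup} :=
  Finset.univ.filter fun P =>
    P.1.IsChain (fun x y => IsHEdge x y ∨ IsVEdge x y) ∧ P.1.head? = some a ∧ P.1.getLast? = some b

section Weights

variable {A : Type v} [Ring A] {m n : ℕ}

/-- The weight of a vertex, given those of the inner vertices; `1` on the boundary, where it is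
not used. -/
def vertexWeight (w : Fin m → Fin n → Aˣ) (a : GridVertex m n) : Aˣ :=
  if h : a.1.1 ≠ 0 ∧ a.1.2 ≠ 0 then w (a.1.1.pred h.1) (a.1.2.pred h.2) else 1

open Classical in
/-- The weight of the edge from `a` to `b`: that of `b` for a horizontal edge leaving a source,
`a⁻¹ b` for the other horizontal edges, and `1` for vertical edges. -/
def edgeWeight (w : Fin m → Fin n → Aˣ) (a b : GridVertex m n) : Aˣ :=
  if IsHEdge a b then
    if a.1.2 = 0 then vertexWeight w b else (vertexWeight w a)⁻¹ * vertexWeight w b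
  else 1

/-- The ordered product of the weights of the edges of a path. -/
def pathWeight (w : Fin m → Fin n → Aˣ) (P : List (GridVertex m n)) : Aˣ :=
  (List.zipWith (edgeWeight w) P P.tail).prod

/-- The path matrix. -/
def pathMatrix (w : Fin m → Fin n → Aˣ) : Matrix (Fin m) (Fin n) A :=
  fun i j => ∑ P ∈ gridPaths (source n i) (sink m j), (pathWeight w P.1 : A)

end Weights

/-- The index `i - d`. -/
def lower {n : ℕ} (i : Fin n) (d : ℕ) : Fin n := ⟨i - d, by omega⟩

/-- The cortege `([i-k+1..i] | [j-k+1..j])` with `k = min i j` in one-based indices. -/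
def piCortege {m n : ℕ} (i : Fin m) (j : Fin n) : Cortege m n where
  rows := Finset.Icc (lower i (min (i : ℕ) j)) i
  cols := Finset.Icc (lower j (min (i : ℕ) j)) j
  card_eq := by
    simp only [Fin.card_Icc, lower]
    omega

theorem isInitial_Icc {n : ℕ} (a b : Fin n) (ha : (a : ℕ) = 0) : IsInitial (Finset.Icc a b) := by
  intro x
  simp only [Finset.mem_Icc, Fin.card_Icc, Fin.le_def]
  omega

theorem piCortege_isPressed {m n : ℕ} (i : Fin m) (j : Fin n) : (piCortege i j).IsPressed := by
  refine ⟨⟨_, _, ?_, rfl⟩, ⟨_, _, ?_, rfl⟩, ?_⟩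
  · simp only [lower, Fin.le_def]; omega
  · simp only [lower, Fin.le_def]; omega
  · rcases le_total (i : ℕ) j with h | h
    · left; apply isInitial_Icc; simp only [lower]; omega
    · right; apply isInitial_Icc; simp only [lower]; omega

/-- The pressed double interval `π(i, j)`. -/
def piPInt {m n : ℕ} (i : Fin m) (j : Fin n) : PInt m n := ⟨piCortege i j, piCortege_isPressed i j⟩

/-- The weight of the inner vertex `(i, j)`: `f₀(π(i,j))` in the first row and the first column,
and `f₀(π(i-1,j-1))⁻¹ f₀(π(i,j))` elsewhere. -/
def innerWeight {A : Type v} [Ring A] {m n : ℕ} (f₀ : PInt m n → Aˣ) (i : Fin m) (j : Fin n) : Aˣ :=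
  if (i : ℕ) = 0 ∨ (j : ℕ) = 0 then f₀ (piPInt i j)
  else (f₀ (piPInt (lower i 1) (lower j 1)))⁻¹ * f₀ (piPInt i j)

/-- The extension of `f₀` to all corteges by the quantum minors of its path matrix. -/
def pathExtension {K : Type u} [Field K] (q : Kˣ) {A : Type v} [Ring A] [Algebra K A]
    {m n : ℕ} (f₀ : PInt m n → Aˣ) : Cortege m n → A :=
  qMinor q (pathMatrix (innerWeight f₀))

/-! ### Quantized Laurent polynomials and algebraic independence -/

/-- The defining relations of the quantized Laurent polynomials: `Sum.inl c` stands for the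
indeterminate `y_c` and `Sum.inr c` for its inverse. -/
inductive LaurentRel {K : Type u} [Field K] (q : Kˣ) (m n : ℕ) :
    FreeAlgebra K (PInt m n ⊕ PInt m n) → FreeAlgebra K (PInt m n ⊕ PInt m n) → Prop
  | mul_inv (c : PInt m n) :
      LaurentRel q m n (FreeAlgebra.ι K (Sum.inl c) * FreeAlgebra.ι K (Sum.inr c)) 1
  | inv_mul (c : PInt m n) :
      LaurentRel q m n (FreeAlgebra.ι K (Sum.inr c) * FreeAlgebra.ι K (Sum.inl c)) 1
  | comm (c c' : PInt m n) (h : c'.1.rows.card ≤ c.1.rows.card) :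
      LaurentRel q m n (FreeAlgebra.ι K (Sum.inl c) * FreeAlgebra.ι K (Sum.inl c'))
        (qpow q (qcExp c.1 c'.1) • (FreeAlgebra.ι K (Sum.inl c') * FreeAlgebra.ι K (Sum.inl c)))

/-- The `K`-algebra of quantized Laurent polynomials in the `y_c`, `c ∈ PInt m n`. -/
abbrev QLaurent {K : Type u} [Field K] (q : Kˣ) (m n : ℕ) : Type u := RingQuot (LaurentRel q m n)

/-- The indeterminate `y_c`. -/
def QLaurent.y {K : Type u} [Field K] (q : Kˣ) {m n : ℕ} (c : PInt m n) : QLaurent q m n :=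
  RingQuot.mkAlgHom K (LaurentRel q m n) (FreeAlgebra.ι K (Sum.inl c))

/-- The subalgebra generated by the values of `f₀` and their inverses. -/
def valueAlgebra (K : Type u) [Field K] {A : Type v} [Ring A] [Algebra K A] {m n : ℕ}
    (f₀ : PInt m n → Aˣ) : Subalgebra K A :=
  Algebra.adjoin K (Set.range (fun c => (f₀ c : A)) ∪ Set.range (fun c => ((f₀ c)⁻¹ : Aˣ).val))

/-- `y_c ↦ f₀(c)` gives an isomorphism of the quantized Laurent polynomials onto the subalgebra
generated by the values of `f₀` and their inverses. -/
def AlgIndependentValues {K : Type u} [Field K] (q : Kˣ) {A : Type v} [Ring A] [Algebra K A]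
    {m n : ℕ} (f₀ : PInt m n → Aˣ) : Prop :=
  ∃ φ : QLaurent q m n ≃ₐ[K] valueAlgebra K f₀,
    ∀ c : PInt m n, (φ (QLaurent.y q c) : A) = (f₀ c : A)

/-- A zerodivisor: some nonzero element annihilates it on the left or on the right. -/
def IsZeroDivisor {R : Type v} [Ring R] (a : R) : Prop :=
  ∃ b : R, b ≠ 0 ∧ (a * b = 0 ∨ b * a = 0)

end

end QuantumMinors

open QuantumMinors

/-! The proof identifies `g` with the function `f` given by the minors of the path matrix. A
universal identity holds by definition for the minors of every fine matrix, so once `Path` is known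
to be fine and `g = f`, the QI property is immediate. Three facts give `g = f`.

Existence: `f` is an RQI-function extending `f₀`. The relations on `f₀` say exactly enough for the
vertex weights `w(i,j)` to commute unless they share a row or a column (`DiagQComm.weight_comm`),
and Manin's relations survive the addition of a row to the grid (`FineOn.addRow`), so `Path` is
fine. Minors of a fine matrix are coefficients of products of row forms in a quantum exterior
algebra; evaluating suitable double sums of products in two orders yields the Plücker and Dodgson
relations (`minor_pluecker`, `minor_dodgson`). The Dodgson relation, compared with the recursion of
path sums by their last or first step, also computes the pressed minors and returns `f₀`
(`DiagQComm.minor_first_rows`, `DiagQComm.minor_first_cols`).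

Uniqueness: two RQI-functions with the same pressed values agree if the values of one of them can be
cancelled (`IsRQIFunction.eq_of_eq_on_pressed`). Plücker relations reduce the number of gaps in the
row and column sets, and Dodgson relations push double intervals towards the boundary.

Regularity: no value of `f` is a zerodivisor. By (i) and (ii) it suffices to treat the generic case,
where `f₀` consists of the indeterminates of the quantized Laurent algebra `R`. The substitution
`y_c ↦ y_c T ^ deg c` embeds `R` into `R[T, T⁻¹]`. With `deg π(i,j) = i² j`, a single path dominates
each matrix entry and the identity permutation dominates each minor, so every minor acquires a
leading coefficient that is a unit (`leadsWith_qMinor`). -/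

namespace QuantumMinors

/-! ### Quantum minors as coefficients in a quantum exterior algebra -/

section Minors

variable {K : Type u} [Field K] (q : Kˣ) {A : Type v} [Ring A] [Algebra K A] {m n : ℕ}

/-- The coefficient of `e_J` in the product of the forms `∑_j x_{rj} e_j`, where `r` runs over a
list of rows and `e_k e_j = -q e_j e_k` for `j < k`. -/
def wedgeCoeff (X : Matrix (Fin m) (Fin n) A) : List (Fin m) → Finset (Fin n) → A
  | [], J => if J = ∅ then 1 else 0
  | r :: rs, J => ∑ b ∈ J, (-(q : K)) ^ (J.filter (· < b)).card •
      (X r b * wedgeCoeff X rs (J.erase b))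

/-- The quantum minor with the rows `I` and the columns `J`; it is `0` if `|I| ≠ |J|`. -/
def minor (X : Matrix (Fin m) (Fin n) A) (I : Finset (Fin m)) (J : Finset (Fin n)) : A :=
  wedgeCoeff q X (I.sort (· ≤ ·)) J

variable {q}

/-- Position `0` is inverted with exactly the later positions of the values below `p`, and all `p`
of these values occur later. The remaining inversions are those of the pattern `τ`. -/
theorem invCount_succ {k : ℕ} (σ : Equiv.Perm (Fin (k + 1))) (p : Fin (k + 1))
    (τ : Equiv.Perm (Fin k)) (h0 : σ 0 = p) (hs : ∀ d, σ (Fin.succ d) = p.succAbove (τ d)) :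
    invCount σ = p + invCount τ := by
  have e : ∀ {l : ℕ} (ρ : Equiv.Perm (Fin l)),
      invCount ρ = ∑ i, ∑ j, if i < j ∧ ρ j < ρ i then 1 else 0 := by
    intro l ρ
    rw [invCount, Finset.card_filter, ← Finset.univ_product_univ, Finset.sum_product]
  rw [e, e, Fin.sum_univ_succ]
  congr 1
  · rw [Fin.sum_univ_succ]
    simp only [h0, hs, lt_self_iff_false, false_and, if_false, zero_add, Fin.succ_pos, true_and]
    rw [Equiv.sum_comp τ (fun e => if p.succAbove e < p then 1 else 0), ← Finset.card_filter]
    simp only [Fin.succAbove_lt_iff_castSucc_lt]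
    have : (Finset.univ.filter fun x : Fin k => x.castSucc < p)
        = Finset.univ.filter fun x : Fin k => (x : ℕ) < p := by
      ext x; simp [Fin.lt_def]
    rw [this, Fin.card_filter_val_lt]
    omega
  · refine Finset.sum_congr rfl fun i _ => ?_
    rw [Fin.sum_univ_succ]
    simp [hs, Fin.succ_lt_succ_iff]

theorem sum_perm_succ {k : ℕ} {M : Type*} [AddCommMonoid M] (F : Equiv.Perm (Fin (k + 1)) → M)
    (G : Fin (k + 1) → Equiv.Perm (Fin k) → M)
    (h : ∀ σ p τ, σ 0 = p → (∀ d, σ (Fin.succ d) = p.succAbove (τ d)) → F σ = G p τ) :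
    ∑ σ, F σ = ∑ p, ∑ τ, G p τ := by
  rw [← Finset.sum_product' Finset.univ Finset.univ G, Finset.univ_product_univ]
  -- A permutation is encoded by its first value and the pattern of the others. Injectivity and the
  -- count `(k + 1)!` make the encoding bijective.
  let c : Fin (k + 1) × Equiv.Perm (Fin k) → Equiv.Perm (Fin (k + 1)) :=
    fun x => x.1.cycleRange.symm * Equiv.Perm.decomposeFin.symm (0, x.2)
  have c0 : ∀ x, c x 0 = x.1 := by
    intro x; simp [c]
  have cs : ∀ x d, c x (Fin.succ d) = x.1.succAbove (x.2 d) := by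
    intro x d; simp [c]
  have hc : Function.Bijective c := by
    rw [Fintype.bijective_iff_injective_and_card]
    refine ⟨fun x y hxy => ?_, by simp [Fintype.card_perm, Nat.factorial_succ]⟩
    have h1 : x.1 = y.1 := by rw [← c0, hxy, c0]
    refine Prod.ext h1 (Equiv.ext fun d => ?_)
    have h2 := cs x d
    rw [hxy, cs, h1] at h2
    exact (Fin.succAbove_right_injective h2).symm
  exact (Fintype.sum_bijective c hc _ _ fun x => (h _ _ _ (c0 x) (cs x)).symm).symm

theorem card_filter_lt_orderEmbOfFin {k : ℕ} (J : Finset (Fin n)) (h : J.card = k) (p : Fin k) :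
    (J.filter (· < J.orderEmbOfFin h p)).card = p := by
  have e : J.filter (· < J.orderEmbOfFin h p) = (Finset.univ.map
      (J.orderEmbOfFin h).toEmbedding).filter (· < J.orderEmbOfFin h p) := by
    rw [Finset.map_orderEmbOfFin_univ]
  rw [e, Finset.filter_map, Finset.card_map]
  have : (Finset.univ.filter ((fun x => x < J.orderEmbOfFin h p) ∘
      (J.orderEmbOfFin h).toEmbedding)) = Finset.univ.filter fun x : Fin k => (x : ℕ) < p := by
    ext x; simp
  rw [this, Fin.card_filter_val_lt]
  omega

/-- Sorting permutations by their first value is the expansion along the first row: `p` is both the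
number of inversions lost and the number of columns of `J` before the chosen one. -/
theorem sum_perm_eq_wedgeCoeff (X : Matrix (Fin m) (Fin n) A) {k : ℕ} (rs : Fin k → Fin m)
    (J : Finset (Fin n)) (h : J.card = k) :
    ∑ σ : Equiv.Perm (Fin k), (-(q : K)) ^ invCount σ •
      (List.ofFn fun d => X (rs d) (J.orderEmbOfFin h (σ d))).prod
      = wedgeCoeff q X (List.ofFn rs) J := by
  induction k generalizing J with
  | zero =>
    have hJ : J = ∅ := Finset.card_eq_zero.mp h
    simp [wedgeCoeff, hJ, invCount]
  | succ k ih =>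
    rw [List.ofFn_succ, wedgeCoeff]
    have hsum : ∀ F : Fin n → A, ∑ b ∈ J, F b = ∑ p, F (J.orderEmbOfFin h p) := by
      intro F
      conv_lhs => rw [← Finset.map_orderEmbOfFin_univ J h]
      rw [Finset.sum_map]; rfl
    rw [hsum]
    have hcard : ∀ p, (J.erase (J.orderEmbOfFin h p)).card = k := by
      intro p
      rw [Finset.card_erase_of_mem (Finset.orderEmbOfFin_mem _ _ _), h]; rfl
    have hemb : ∀ p d, (J.erase (J.orderEmbOfFin h p)).orderEmbOfFin (hcard p) d
        = J.orderEmbOfFin h (p.succAbove d) := by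
      intro p d
      refine (congrFun (Finset.orderEmbOfFin_unique (hcard p)
        (f := fun d => J.orderEmbOfFin h (p.succAbove d)) (fun x => ?_) ?_) d).symm
      · simp [Fin.succAbove_ne]
      · exact (J.orderEmbOfFin h).strictMono.comp (Fin.strictMono_succAbove p)
    rw [sum_perm_succ _ fun p τ => (-(q : K)) ^ ((p : ℕ) + invCount τ) •
      (X (rs 0) (J.orderEmbOfFin h p) *
        (List.ofFn fun d => X (rs (Fin.succ d)) (J.orderEmbOfFin h (p.succAbove (τ d)))).prod)]
    · refine Finset.sum_congr rfl fun p _ => ?_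
      rw [card_filter_lt_orderEmbOfFin, ← ih _ _ (hcard p), Finset.mul_sum, Finset.smul_sum]
      refine Finset.sum_congr rfl fun τ _ => ?_
      simp only [hemb]
      rw [pow_add, mul_smul, mul_smul_comm]
    · intro σ p τ h0 hs
      rw [invCount_succ σ p τ h0 hs, List.ofFn_succ, List.prod_cons]
      simp only [h0, hs]

theorem qMinor_eq_minor (X : Matrix (Fin m) (Fin n) A) (c : Cortege m n) :
    qMinor q X c = minor q X c.rows c.cols := by
  rw [qMinor, sum_perm_eq_wedgeCoeff, minor]
  congr 1
  apply List.ext_getElem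
  · simp
  · intro i h1 h2
    simp [Finset.orderEmbOfFin_apply]

theorem wedgeCoeff_eq_zero_of_card_ne (X : Matrix (Fin m) (Fin n) A) (l : List (Fin m))
    (J : Finset (Fin n)) (h : l.length ≠ J.card) : wedgeCoeff q X l J = 0 := by
  induction l generalizing J with
  | nil =>
    rw [wedgeCoeff, if_neg]
    rintro rfl; simp at h
  | cons r rs ih =>
    rw [wedgeCoeff]
    refine Finset.sum_eq_zero fun b hb => ?_
    rw [ih, mul_zero, smul_zero]
    rw [Finset.card_erase_of_mem hb]
    have := Finset.card_pos.mpr ⟨b, hb⟩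
    simp only [List.length_cons] at h
    omega

theorem minor_eq_zero_of_card_ne (X : Matrix (Fin m) (Fin n) A) {I : Finset (Fin m)}
    {J : Finset (Fin n)} (h : I.card ≠ J.card) : minor q X I J = 0 :=
  wedgeCoeff_eq_zero_of_card_ne X _ _ (by simpa using h)

theorem val_qMinor (X : Matrix (Fin m) (Fin n) A) (I : Finset (Fin m)) (J : Finset (Fin n)) :
    val (qMinor q X) I J = minor q X I J := by
  rw [val]
  split_ifs with h
  · exact qMinor_eq_minor X _
  · exact (minor_eq_zero_of_card_ne X h).symm

theorem minor_empty (X : Matrix (Fin m) (Fin n) A) : minor q X ∅ ∅ = 1 := by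
  simp [minor, wedgeCoeff]

theorem minor_singleton (X : Matrix (Fin m) (Fin n) A) (i : Fin m) (j : Fin n) :
    minor q X {i} {j} = X i j := by
  simp [minor, wedgeCoeff, Finset.filter_singleton]

/-! ### Reordering the rows -/

/-- Gathers the two orders of each pair of columns, so that 2×2 minors appear in expansions along
two rows. -/
theorem sum_sum_erase {M : Type*} [AddCommMonoid M] (J : Finset (Fin n)) (h : Fin n → Fin n → M) :
    ∑ b ∈ J, ∑ c ∈ J.erase b, h b c
      = ∑ b ∈ J, ∑ c ∈ J.filter (b < ·), (h b c + h c b) := by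
  have e : ∀ b, J.erase b = J.filter (b < ·) ∪ J.filter (· < b) := by
    intro b; ext c
    simp only [Finset.mem_erase, Finset.mem_union, Finset.mem_filter]
    constructor
    · rintro ⟨h1, h2⟩
      rcases lt_or_gt_of_ne h1 with h | h
      · exact Or.inr ⟨h2, h⟩
      · exact Or.inl ⟨h2, h⟩
    · rintro (⟨h1, h2⟩ | ⟨h1, h2⟩)
      · exact ⟨h2.ne', h1⟩
      · exact ⟨h2.ne, h1⟩
  have hd : ∀ b, Disjoint (J.filter (b < ·)) (J.filter (· < b)) := by
    intro b
    rw [Finset.disjoint_left]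
    intro c hc hc'
    exact lt_asymm (Finset.mem_filter.mp hc).2 (Finset.mem_filter.mp hc').2
  simp only [e, Finset.sum_union (hd _), Finset.sum_add_distrib]
  congr 1
  exact Finset.sum_comm' fun b c => by simp only [Finset.mem_filter]; tauto

theorem card_filter_lt_erase (J : Finset (Fin n)) {b c : Fin n} (hb : b ∈ J) :
    ((J.erase b).filter (· < c)).card + (if b < c then 1 else 0) = (J.filter (· < c)).card := by
  rw [Finset.filter_erase]
  split_ifs with h
  · exact Finset.card_erase_add_one (Finset.mem_filter.mpr ⟨hb, h⟩)
  · rw [Finset.erase_eq_of_notMem (by simp [h])]; rfl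

theorem card_filter_gt_erase (J : Finset (Fin n)) {b c : Fin n} (hb : b ∈ J) :
    ((J.erase b).filter (c < ·)).card + (if c < b then 1 else 0) = (J.filter (c < ·)).card := by
  rw [Finset.filter_erase]
  split_ifs with h
  · exact Finset.card_erase_add_one (Finset.mem_filter.mpr ⟨hb, h⟩)
  · rw [Finset.erase_eq_of_notMem (by simp [h])]; rfl

theorem card_filter_lt_insert (J : Finset (Fin n)) {b c : Fin n} (hb : b ∉ J) :
    ((insert b J).filter (· < c)).card = (J.filter (· < c)).card + (if b < c then 1 else 0) := by
  rw [← card_filter_lt_erase (insert b J) (Finset.mem_insert_self b J), Finset.erase_insert hb]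

theorem card_filter_gt_insert (J : Finset (Fin n)) {b c : Fin n} (hb : b ∉ J) :
    ((insert b J).filter (c < ·)).card = (J.filter (c < ·)).card + (if c < b then 1 else 0) := by
  rw [← card_filter_gt_erase (insert b J) (Finset.mem_insert_self b J), Finset.erase_insert hb]

theorem card_filter_lt_add_gt (J : Finset (Fin n)) {b : Fin n} (hb : b ∉ J) :
    (J.filter (· < b)).card + (J.filter (b < ·)).card = J.card := by
  rw [← Finset.card_union_of_disjoint]
  · congr 1; ext c
    simp only [Finset.mem_union, Finset.mem_filter]
    constructor
    · tauto
    · intro hc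
      rcases lt_trichotomy c b with h | h | h
      · tauto
      · exact absurd (h ▸ hc) hb
      · tauto
  · rw [Finset.disjoint_left]
    intro c hc hc'
    exact lt_asymm (Finset.mem_filter.mp hc).2 (Finset.mem_filter.mp hc').2

/-- Laplace expansion along the first two rows: taking the larger column first costs one more factor
`-q`. Fineness is not needed, and all later row exchanges reduce to the bracketed 2×2 minor. -/
theorem wedgeCoeff_cons_cons (X : Matrix (Fin m) (Fin n) A) (r r' : Fin m) (l : List (Fin m))
    (J : Finset (Fin n)) :
    wedgeCoeff q X (r :: r' :: l) J = ∑ b ∈ J, ∑ c ∈ J.filter (b < ·),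
      (-(q : K)) ^ ((J.filter (· < b)).card + ((J.erase b).filter (· < c)).card) •
        ((X r b * X r' c - (q : K) • (X r c * X r' b)) *
          wedgeCoeff q X l ((J.erase b).erase c)) := by
  simp only [wedgeCoeff]
  simp only [Finset.mul_sum, Finset.smul_sum]
  rw [sum_sum_erase]
  refine Finset.sum_congr rfl fun b hb => Finset.sum_congr rfl fun c hc => ?_
  obtain ⟨hc, hbc⟩ := Finset.mem_filter.mp hc
  have h1 := card_filter_lt_erase J (b := b) (c := c) hb
  have h2 := card_filter_lt_erase J (b := c) (c := b) hc
  rw [if_pos hbc] at h1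
  rw [if_neg hbc.not_gt, add_zero] at h2
  rw [← h1, h2, Finset.erase_right_comm (a := c) (b := b)]
  simp only [mul_smul_comm, smul_smul, sub_mul, smul_sub, smul_mul_assoc, mul_assoc]
  rw [sub_eq_add_neg, ← neg_smul]
  congr 2 <;> ring

theorem IsFine.swap_sub {X : Matrix (Fin m) (Fin n) A} (hX : IsFine q X) {i j : Fin m} (hij : i < j)
    {b c : Fin n} (hbc : b < c) :
    X j b * X i c - (q : K) • (X j c * X i b)
      = (-(q : K)) • (X i b * X j c - (q : K) • (X i c * X j b)) := by
  have h1 := hX.cross i j b c hij hbc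
  have h2 := hX.anti i j b c hij hbc
  have h3 : X j c * X i b = X i b * X j c - ((q : K) - (q : K)⁻¹) • (X i c * X j b) := by
    rw [← h1]; abel
  rw [h3, ← h2]
  have hq : (q : K) ≠ 0 := q.ne_zero
  simp only [smul_sub, smul_smul]
  have : (q : K) * ((q : K) - (q : K)⁻¹) = q * q - 1 := by field_simp
  rw [this, sub_smul, neg_mul, neg_smul, neg_smul, one_smul]
  abel

/-- The row forms obey the same law as the `e_j`: by `IsFine.swap_sub` a wrongly ordered pair of
rows contributes `-q`, and by the row relation the square of a form vanishes (`wedgeCoeff_self`). -/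
theorem wedgeCoeff_swap {X : Matrix (Fin m) (Fin n) A} (hX : IsFine q X) {i j : Fin m} (hij : i < j)
    (l : List (Fin m)) (J : Finset (Fin n)) :
    wedgeCoeff q X (j :: i :: l) J = (-(q : K)) • wedgeCoeff q X (i :: j :: l) J := by
  rw [wedgeCoeff_cons_cons, wedgeCoeff_cons_cons, Finset.smul_sum]
  refine Finset.sum_congr rfl fun b hb => ?_
  rw [Finset.smul_sum]
  refine Finset.sum_congr rfl fun c hc => ?_
  rw [hX.swap_sub hij (Finset.mem_filter.mp hc).2, smul_mul_assoc, smul_comm]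

theorem wedgeCoeff_self {X : Matrix (Fin m) (Fin n) A} (hX : IsFine q X) (i : Fin m)
    (l : List (Fin m)) (J : Finset (Fin n)) : wedgeCoeff q X (i :: i :: l) J = 0 := by
  rw [wedgeCoeff_cons_cons]
  refine Finset.sum_eq_zero fun b hb => Finset.sum_eq_zero fun c hc => ?_
  rw [hX.row i b c (Finset.mem_filter.mp hc).2, sub_self, zero_mul, smul_zero]

theorem wedgeCoeff_cons_congr {X : Matrix (Fin m) (Fin n) A} {l l' : List (Fin m)} {t : K}
    (h : ∀ J, wedgeCoeff q X l J = t • wedgeCoeff q X l' J) (r : Fin m) (J : Finset (Fin n)) :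
    wedgeCoeff q X (r :: l) J = t • wedgeCoeff q X (r :: l') J := by
  simp only [wedgeCoeff, h, Finset.smul_sum, mul_smul_comm]
  exact Finset.sum_congr rfl fun b _ => smul_comm _ _ _

/-- The row `r` moves right past each smaller row, gaining `-q` each time, until it is in place or
meets its own copy and gives `0`. -/
theorem wedgeCoeff_cons_sorted {X : Matrix (Fin m) (Fin n) A} (hX : IsFine q X) (r : Fin m)
    (l : List (Fin m)) (hl : l.Pairwise (· < ·)) (J : Finset (Fin n)) :
    wedgeCoeff q X (r :: l) J = if r ∈ l then 0 else
      (-(q : K)) ^ (l.countP (· < r)) • wedgeCoeff q X (l.orderedInsert (· ≤ ·) r) J := by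
  induction l generalizing J with
  | nil => simp
  | cons a l ih =>
    obtain ⟨hal, hl'⟩ := List.pairwise_cons.mp hl
    rcases lt_trichotomy r a with h | h | h
    · have hr : r ∉ a :: l := by
        intro hr
        rcases List.mem_cons.mp hr with rfl | hr
        · exact lt_irrefl _ h
        · exact lt_asymm h (hal r hr)
      have hc : (a :: l).countP (· < r) = 0 := by
        rw [List.countP_eq_zero]
        intro x hx
        rcases List.mem_cons.mp hx with rfl | hx
        · simpa using h.le
        · simpa using (h.trans (hal x hx)).le
      rw [if_neg hr, hc, pow_zero, one_smul, List.orderedInsert_cons, if_pos h.le]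
    · subst h
      rw [wedgeCoeff_self hX, if_pos List.mem_cons_self]
    · rw [wedgeCoeff_swap hX h]
      by_cases hr : r ∈ l
      · rw [if_pos (List.mem_cons_of_mem a hr),
          wedgeCoeff_cons_congr (l' := l) (t := 0) (fun J => by rw [ih hl', if_pos hr, zero_smul]),
          zero_smul, smul_zero]
      · have hr' : r ∉ a :: l := by simp [hr, h.ne']
        rw [if_neg hr', wedgeCoeff_cons_congr (fun J => (ih hl' J).trans (if_neg hr)), smul_smul,
          List.orderedInsert_cons, if_neg h.not_ge, List.countP_cons_of_pos (by simpa using h),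
          pow_succ']

theorem wedgeCoeff_append_sorted {X : Matrix (Fin m) (Fin n) A} (hX : IsFine q X) (r : Fin m)
    (l : List (Fin m)) (hl : l.Pairwise (· < ·)) (J : Finset (Fin n)) :
    wedgeCoeff q X (l ++ [r]) J = if r ∈ l then 0 else
      (-(q : K)) ^ (l.countP (r < ·)) • wedgeCoeff q X (l.orderedInsert (· ≤ ·) r) J := by
  induction l generalizing J with
  | nil => simp
  | cons a l ih =>
    obtain ⟨hal, hl'⟩ := List.pairwise_cons.mp hl
    rw [List.cons_append]
    by_cases hr : r ∈ l
    · rw [if_pos (List.mem_cons_of_mem a hr),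
        wedgeCoeff_cons_congr (l' := l) (t := 0) (fun J => by rw [ih hl', if_pos hr, zero_smul]),
        zero_smul]
    rw [wedgeCoeff_cons_congr (fun J => (ih hl' J).trans (if_neg hr))]
    have hmin : r ≤ a → l.orderedInsert (· ≤ ·) r = r :: l := by
      intro h
      cases l with
      | nil => rfl
      | cons x l => rw [List.orderedInsert_cons, if_pos (h.trans (hal x List.mem_cons_self).le)]
    rcases lt_trichotomy r a with h | h | h
    · have hr' : r ∉ a :: l := by simp [hr, h.ne]
      rw [if_neg hr', hmin h.le, wedgeCoeff_swap hX h, List.orderedInsert_cons, if_pos h.le,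
        List.countP_cons_of_pos (by simpa using h), pow_succ, smul_smul]
    · subst h
      rw [hmin le_rfl, wedgeCoeff_self hX, if_pos List.mem_cons_self, smul_zero]
    · have hr' : r ∉ a :: l := by simp [hr, h.ne']
      rw [if_neg hr', List.orderedInsert_cons, if_neg h.not_ge,
        List.countP_cons_of_neg (by simpa using h.le)]

/-- The definition expands along the first row; associativity of the product gives the expansion
along the last one, where `e_b` moves left past the larger `e_c`. -/
theorem wedgeCoeff_append (X : Matrix (Fin m) (Fin n) A) (l : List (Fin m)) (r : Fin m)
    (J : Finset (Fin n)) :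
    wedgeCoeff q X (l ++ [r]) J = ∑ b ∈ J, (-(q : K)) ^ (J.filter (b < ·)).card •
      (wedgeCoeff q X l (J.erase b) * X r b) := by
  induction l generalizing J with
  | nil =>
    simp only [List.nil_append, wedgeCoeff]
    refine Finset.sum_congr rfl fun b hb => ?_
    by_cases h : J.erase b = ∅
    · have hJ : J = {b} := by
        rw [← Finset.insert_erase hb, h]; rfl
      subst hJ
      simp [Finset.filter_singleton]
    · simp [h]
  | cons a l ih =>
    rw [List.cons_append, wedgeCoeff]
    simp only [ih, wedgeCoeff, Finset.mul_sum, Finset.sum_mul, Finset.smul_sum]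
    have hcomm : ∀ h : Fin n → Fin n → A, ∑ b ∈ J, ∑ c ∈ J.erase b, h b c
        = ∑ b ∈ J, ∑ c ∈ J.erase b, h c b := by
      intro h
      rw [sum_sum_erase, sum_sum_erase]
      simp only [add_comm]
    rw [hcomm]
    refine Finset.sum_congr rfl fun b hb => Finset.sum_congr rfl fun c hc => ?_
    obtain ⟨hcb, hc⟩ := Finset.mem_erase.mp hc
    have h1 := card_filter_lt_erase J (b := b) (c := c) hb
    have h2 := card_filter_gt_erase J (b := c) (c := b) hc
    rw [Finset.erase_right_comm]
    simp only [mul_smul_comm, smul_smul, smul_mul_assoc, mul_assoc, ← pow_add]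
    congr 2
    omega

/-! ### Expansions of a minor along an extra row, first or last. -/

theorem countP_sort (I : Finset (Fin m)) (p : Fin m → Prop) [DecidablePred p] :
    (I.sort (· ≤ ·)).countP (fun x => decide (p x)) = (I.filter p).card := by
  rw [← Multiset.coe_countP, Finset.sort_eq, Multiset.countP_eq_card_filter]
  rfl

theorem orderedInsert_sort (I : Finset (Fin m)) {r : Fin m} (hr : r ∉ I) :
    (I.sort (· ≤ ·)).orderedInsert (· ≤ ·) r = (insert r I).sort (· ≤ ·) := by
  refine List.Perm.eq_of_pairwise (le := (· ≤ ·)) (fun a b _ _ => le_antisymm) ?_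
    (Finset.pairwise_sort _ _) ?_
  · exact List.Pairwise.orderedInsert r _ (Finset.pairwise_sort _ _)
  · refine (List.perm_orderedInsert _ _ _).trans ?_
    rw [← Multiset.coe_eq_coe, ← Multiset.cons_coe, Finset.sort_eq, Finset.sort_eq,
      Finset.insert_val_of_notMem hr]

theorem pairwise_lt_sort (I : Finset (Fin m)) : (I.sort (· ≤ ·)).Pairwise (· < ·) :=
  List.sortedLT_iff_pairwise.mp (Finset.sortedLT_sort I)

/-- Expansion along a row placed first. -/
theorem sum_row_mul_minor {X : Matrix (Fin m) (Fin n) A} (hX : IsFine q X) (r : Fin m)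
    (I : Finset (Fin m)) (J : Finset (Fin n)) :
    ∑ b ∈ J, (-(q : K)) ^ (J.filter (· < b)).card • (X r b * minor q X I (J.erase b))
      = if r ∈ I then 0 else (-(q : K)) ^ (I.filter (· < r)).card • minor q X (insert r I) J := by
  have h := wedgeCoeff_cons_sorted hX r _ (pairwise_lt_sort I) J
  rw [wedgeCoeff] at h
  simp only [minor]
  rw [h]
  simp only [Finset.mem_sort]
  split_ifs with hr
  · rfl
  · rw [orderedInsert_sort I hr, countP_sort]

/-- Expansion along a row placed last. -/
theorem sum_minor_mul_row {X : Matrix (Fin m) (Fin n) A} (hX : IsFine q X) (r : Fin m)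
    (I : Finset (Fin m)) (J : Finset (Fin n)) :
    ∑ b ∈ J, (-(q : K)) ^ (J.filter (b < ·)).card • (minor q X I (J.erase b) * X r b)
      = if r ∈ I then 0 else (-(q : K)) ^ (I.filter (r < ·)).card • minor q X (insert r I) J := by
  have h := wedgeCoeff_append_sorted hX r _ (pairwise_lt_sort I) J
  rw [wedgeCoeff_append] at h
  simp only [minor]
  rw [h]
  simp only [Finset.mem_sort]
  split_ifs with hr
  · rfl
  · rw [orderedInsert_sort I hr, countP_sort]

end Minors

section MinorIdentities

variable {K : Type u} [Field K] {q : Kˣ} {A : Type v} [Ring A] [Algebra K A] {m n : ℕ}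

/-! ### Transposition -/

theorem IsFine.transpose {X : Matrix (Fin m) (Fin n) A} (hX : IsFine q X) :
    IsFine q X.transpose where
  row i j k h := hX.col j k i h
  col i l j h := hX.row j i l h
  anti i l j k h h' := (hX.anti j k i l h' h).symm
  cross i l j k h h' := by
    simp only [Matrix.transpose_apply]
    rw [hX.cross j k i l h' h, hX.anti j k i l h' h]

/-- Expansion along the lowest row and then, through the inductive hypotheses on smaller minors,
along the lowest column. The result is symmetric in rows and columns up to the order of `X i b` and
`X r j`. -/
theorem minor_insert_insert {X : Matrix (Fin m) (Fin n) A} (hX : IsFine q X) {i : Fin m}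
    {j : Fin n} {I : Finset (Fin m)} {J : Finset (Fin n)} (hi : ∀ a ∈ I, i < a)
    (hj : ∀ b ∈ J, j < b)
    (ih : ∀ L : Finset (Fin n), minor q X I L = minor q X.transpose L I)
    (ih' : ∀ r ∈ I, ∀ L : Finset (Fin n),
      minor q X (I.erase r) L = minor q X.transpose L (I.erase r)) :
    minor q X (insert i I) (insert j J) = X i j * minor q X I J +
      ∑ b ∈ J, ∑ r ∈ I, (-(q : K)) ^ (1 + (J.filter (· < b)).card + (I.filter (· < r)).card) •
        (X i b * (X r j * minor q X (I.erase r) (J.erase b))) := by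
  have hi' : i ∉ I := fun h => lt_irrefl _ (hi i h)
  have hj' : j ∉ J := fun h => lt_irrefl _ (hj j h)
  have h0 : (I.filter (· < i)) = ∅ := Finset.filter_eq_empty_iff.mpr fun a ha => (hi a ha).not_gt
  have h := sum_row_mul_minor hX i I (insert j J)
  rw [if_neg hi', h0, Finset.card_empty, pow_zero, one_smul, Finset.sum_insert hj',
    card_filter_lt_insert J hj', if_neg (lt_irrefl j), Finset.erase_insert hj',
    Finset.filter_eq_empty_iff.mpr fun b hb => (hj b hb).not_gt, Finset.card_empty, add_zero,
    pow_zero, one_smul] at h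
  rw [← h]
  congr 1
  refine Finset.sum_congr rfl fun b hb => ?_
  have hjb : j ∉ J.erase b := fun h => hj' (Finset.mem_of_mem_erase h)
  have h1 := sum_row_mul_minor hX.transpose j (J.erase b) I
  rw [if_neg hjb, Finset.filter_eq_empty_iff.mpr fun c hc =>
    (hj c (Finset.mem_of_mem_erase hc)).not_gt, Finset.card_empty, pow_zero, one_smul] at h1
  rw [Finset.erase_insert_of_ne (hj b hb).ne, ih, ← h1, card_filter_lt_insert J hj',
    if_pos (hj b hb), Finset.mul_sum, Finset.smul_sum]
  refine Finset.sum_congr rfl fun r hr => ?_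
  rw [ih' r hr, mul_smul_comm, smul_smul, ← pow_add, add_comm 1]
  rfl

theorem minor_transpose {X : Matrix (Fin m) (Fin n) A} (hX : IsFine q X) (I : Finset (Fin m))
    (J : Finset (Fin n)) : minor q X I J = minor q X.transpose J I := by
  induction hk : I.card using Nat.strong_induction_on generalizing I J with
  | _ k ih =>
    by_cases hc : I.card = J.card
    swap
    · rw [minor_eq_zero_of_card_ne _ hc, minor_eq_zero_of_card_ne _ (Ne.symm hc)]
    rcases I.eq_empty_or_nonempty with rfl | hI
    · have : J = ∅ := Finset.card_eq_zero.mp (by simpa using hc.symm)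
      subst this
      rw [minor_empty, minor_empty]
    have hJ : J.Nonempty := Finset.card_pos.mp (hc ▸ Finset.card_pos.mpr hI)
    obtain ⟨i, I', hi, rfl⟩ : ∃ i I', (∀ a ∈ I', i < a) ∧ insert i I' = I :=
      ⟨I.min' hI, I.erase (I.min' hI), fun a ha => Finset.min'_lt_of_mem_erase_min' _ _ ha,
        Finset.insert_erase (Finset.min'_mem _ _)⟩
    obtain ⟨j, J', hj, rfl⟩ : ∃ j J', (∀ b ∈ J', j < b) ∧ insert j J' = J :=
      ⟨J.min' hJ, J.erase (J.min' hJ), fun a ha => Finset.min'_lt_of_mem_erase_min' _ _ ha,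
        Finset.insert_erase (Finset.min'_mem _ _)⟩
    have hi' : i ∉ I' := fun h => lt_irrefl _ (hi i h)
    have hj' : j ∉ J' := fun h => lt_irrefl _ (hj j h)
    rw [Finset.card_insert_of_notMem hi'] at hk hc
    rw [Finset.card_insert_of_notMem hj'] at hc
    have hlt : ∀ r ∈ I', (I'.erase r).card < k := fun r hr => by
      have := Finset.card_erase_lt_of_mem hr; omega
    have hlt' : ∀ r ∈ J', (J'.erase r).card < k := fun r hr => by
      have := Finset.card_erase_lt_of_mem hr; omega
    have key : ∀ L : Finset (Fin m), ∀ J : Finset (Fin n), J.card < k →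
        minor q X L J = minor q X.transpose J L := by
      intro L J h
      by_cases hc : L.card = J.card
      · exact ih _ (hc ▸ h) _ _ rfl
      · rw [minor_eq_zero_of_card_ne _ hc, minor_eq_zero_of_card_ne _ (Ne.symm hc)]
    rw [minor_insert_insert hX hi hj (fun L => ih _ (by omega) _ _ rfl)
        (fun r hr L => ih _ (hlt r hr) _ _ rfl),
      minor_insert_insert hX.transpose hj hi
        (fun L => (key L J' (by omega)).symm)
        (fun r hr L => (key L _ (hlt' r hr)).symm),
      ih I'.card (by omega) I' J' rfl, Finset.sum_comm]
    congr 1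
    refine Finset.sum_congr rfl fun r hr => Finset.sum_congr rfl fun b hb => ?_
    simp only [Matrix.transpose_apply]
    -- The two double expansions differ only in the order of the antidiagonal pair `X i b`, `X r j`,
    -- which commutes.
    rw [ih _ (hlt r hr) _ _ rfl, ← mul_assoc, ← mul_assoc, hX.anti i r j b (hi r hr) (hj b hb),
      add_right_comm]

/-- Expansion along a column placed last. -/
theorem sum_minor_mul_col {X : Matrix (Fin m) (Fin n) A} (hX : IsFine q X) (b : Fin n)
    (R : Finset (Fin m)) (C : Finset (Fin n)) :
    ∑ r ∈ R, (-(q : K)) ^ (R.filter (r < ·)).card • (minor q X (R.erase r) C * X r b)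
      = if b ∈ C then 0 else (-(q : K)) ^ (C.filter (b < ·)).card • minor q X R (insert b C) := by
  simp only [minor_transpose hX]
  exact sum_minor_mul_row hX.transpose b C R

/-! ### Centrality of the quantum determinant, and the quadratic relations -/

theorem neg_q_ne_zero : (-(q : K)) ≠ 0 := neg_ne_zero.mpr q.ne_zero

/-- Computes the double sum of `X i c * minor(R∖r | C∖c) * X r b` over `r ∈ R`, `c ∈ C` in two ways.
Summing over `r` first kills every `c ≠ b`, because the column `b` is repeated. The exponent `|C| -
1` counts the columns on both sides of `b`. -/
theorem smul_entry_mul_minor {X : Matrix (Fin m) (Fin n) A} (hX : IsFine q X) (i : Fin m) {b : Fin n}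
    (R : Finset (Fin m)) {C : Finset (Fin n)} (hb : b ∈ C) :
    (-(q : K)) ^ (C.card - 1) • (X i b * minor q X R C)
      = ∑ r ∈ R, (-(q : K)) ^ (R.filter (r < ·)).card • ((if i ∈ R.erase r then 0 else
        (-(q : K)) ^ ((R.erase r).filter (· < i)).card • minor q X (insert i (R.erase r)) C)
          * X r b) := by
  simp only [← sum_row_mul_minor hX, Finset.sum_mul, Finset.smul_sum]
  rw [Finset.sum_comm, Finset.sum_eq_single_of_mem b hb]
  · have h := sum_minor_mul_col hX b R (C.erase b)
    rw [if_neg (Finset.notMem_erase b C), Finset.insert_erase hb] at h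
    have e : ∀ r ∈ R, (-(q : K)) ^ (R.filter (r < ·)).card • ((-(q : K)) ^ (C.filter (· < b)).card •
        (X i b * minor q X (R.erase r) (C.erase b)) * X r b)
        = (-(q : K)) ^ (C.filter (· < b)).card • (X i b * ((-(q : K)) ^ (R.filter (r < ·)).card •
          (minor q X (R.erase r) (C.erase b) * X r b))) := by
      intro r _
      rw [smul_mul_assoc, smul_comm, mul_smul_comm, mul_assoc]
    rw [Finset.sum_congr rfl e, ← Finset.smul_sum, ← Finset.mul_sum, h, mul_smul_comm, smul_smul,
      ← pow_add]
    congr 2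
    have h1 := card_filter_lt_add_gt (C.erase b) (Finset.notMem_erase b C)
    have h2 := card_filter_lt_erase C (b := b) (c := b) hb
    rw [if_neg (lt_irrefl b)] at h2
    rw [Finset.card_erase_of_mem hb] at h1
    omega
  · intro c hc hcb
    have h := sum_minor_mul_col hX b R (C.erase c)
    rw [if_pos (Finset.mem_erase.mpr ⟨hcb.symm, hb⟩)] at h
    have e : ∀ r ∈ R, (-(q : K)) ^ (R.filter (r < ·)).card • ((-(q : K)) ^ (C.filter (· < c)).card •
        (X i c * minor q X (R.erase r) (C.erase c)) * X r b)
        = (-(q : K)) ^ (C.filter (· < c)).card • (X i c * ((-(q : K)) ^ (R.filter (r < ·)).card •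
          (minor q X (R.erase r) (C.erase c) * X r b))) := by
      intro r _
      rw [smul_mul_assoc, smul_comm, mul_smul_comm, mul_assoc]
    rw [Finset.sum_congr rfl e, ← Finset.smul_sum, ← Finset.mul_sum, h, mul_zero, smul_zero]

/-- A quantum minor commutes with the entries of its submatrix. -/
theorem commute_entry_minor {X : Matrix (Fin m) (Fin n) A} (hX : IsFine q X) {i : Fin m} {b : Fin n}
    {R : Finset (Fin m)} {C : Finset (Fin n)} (hi : i ∈ R) (hb : b ∈ C) :
    Commute (X i b) (minor q X R C) := by
  by_cases hc : R.card = C.card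
  swap
  · rw [minor_eq_zero_of_card_ne _ hc]; exact Commute.zero_right _
  have h := smul_entry_mul_minor hX i R hb
  -- For `i ∈ R`, every `r ≠ i` repeats the row `i`, so only the minor itself times `X i b` remains,
  -- with the same power of `-q` as on the left.
  rw [Finset.sum_eq_single_of_mem i hi] at h
  · rw [if_neg (Finset.notMem_erase i R), Finset.insert_erase hi, smul_mul_assoc, smul_smul,
      ← pow_add] at h
    have h1 := card_filter_lt_add_gt (R.erase i) (Finset.notMem_erase i R)
    have h2 := card_filter_gt_erase R (b := i) (c := i) hi
    rw [if_neg (lt_irrefl i)] at h2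
    rw [Finset.card_erase_of_mem hi] at h1
    have e : (R.filter (i < ·)).card + ((R.erase i).filter (· < i)).card = C.card - 1 := by omega
    rw [e] at h
    exact smul_right_injective A (pow_ne_zero _ neg_q_ne_zero) h
  · intro r hr hri
    rw [if_pos (Finset.mem_erase.mpr ⟨hri.symm, hi⟩), zero_mul, smul_zero]

theorem commute_minor_minor {X : Matrix (Fin m) (Fin n) A} (hX : IsFine q X)
    {I R : Finset (Fin m)} {J C : Finset (Fin n)} (hI : I ⊆ R) (hJ : J ⊆ C) :
    Commute (minor q X I J) (minor q X R C) := by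
  have : ∀ (l : List (Fin m)), (∀ r ∈ l, r ∈ R) → ∀ J : Finset (Fin n), J ⊆ C →
      Commute (wedgeCoeff q X l J) (minor q X R C) := by
    intro l
    induction l with
    | nil =>
      intro _ J _
      rw [wedgeCoeff]
      split_ifs
      · exact Commute.one_left _
      · exact Commute.zero_left _
    | cons r l ih =>
      intro hl J hJ
      rw [wedgeCoeff]
      refine Commute.sum_left _ _ _ fun b hb => Commute.smul_left (Commute.mul_left ?_ ?_) _
      · exact commute_entry_minor hX (hl r List.mem_cons_self) (hJ hb)
      · exact ih (fun r hr => hl r (List.mem_cons_of_mem _ hr)) _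
          ((Finset.erase_subset _ _).trans hJ)
  exact this _ (fun r hr => hI ((Finset.mem_sort _).mp hr)) J hJ

/-- The Plücker-type relation with triples. -/
theorem minor_pluecker {X : Matrix (Fin m) (Fin n) A} (hX : IsFine q X) {S : Finset (Fin m)}
    {T : Finset (Fin n)} {i j k : Fin m} {l : Fin n} (hc : S.card + 1 = T.card) (hij : i < j)
    (hjk : j < k) (hi : i ∉ S) (hj : j ∉ S) (hk : k ∉ S) (hl : l ∉ T) :
    minor q X (insert j S) T * minor q X (insert i (insert k S)) (insert l T)
      = minor q X (insert i (insert j S)) (insert l T) * minor q X (insert k S) T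
        + minor q X (insert j (insert k S)) (insert l T) * minor q X (insert i S) T := by
  set R := insert i (insert k S) with hR
  set C := insert l T with hC
  have hik := hij.trans hjk
  have hi' : i ∉ insert k S := by simp [hi, hik.ne]
  have hRC : ∀ b ∈ T, Commute (minor q X S (T.erase b)) (minor q X R C) := fun b _ =>
    commute_minor_minor hX ((Finset.subset_insert k S).trans (Finset.subset_insert i _))
      ((Finset.erase_subset b T).trans (Finset.subset_insert l T))
  have hCc : C.card - 1 = T.card := by rw [hC, Finset.card_insert_of_notMem hl]; rfl
  have h1 := sum_row_mul_minor hX j S T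
  rw [if_neg hj] at h1
  -- The minor on `jS` is expanded along `j`, the large minor is moved next to `X j b` by
  -- centrality, and `smul_entry_mul_minor` then replaces the row `j` by a row `r` of `R`.
  have h2 : ∀ b ∈ T, (-(q : K)) ^ T.card • (((-(q : K)) ^ (T.filter (· < b)).card •
      (X j b * minor q X S (T.erase b))) * minor q X R C) =
      ∑ r ∈ R, (-(q : K)) ^ (R.filter (r < ·)).card • ((if j ∈ R.erase r then 0 else
        (-(q : K)) ^ ((R.erase r).filter (· < j)).card • minor q X (insert j (R.erase r)) C) *
        ((-(q : K)) ^ (T.filter (· < b)).card • (X r b * minor q X S (T.erase b)))) := by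
    intro b hb
    have h := smul_entry_mul_minor hX j R (C := C) (Finset.mem_insert_of_mem hb)
    rw [hCc] at h
    rw [smul_mul_assoc, mul_assoc, (hRC b hb).eq, ← mul_assoc, smul_comm, ← smul_mul_assoc, h,
      Finset.sum_mul, Finset.smul_sum]
    refine Finset.sum_congr rfl fun r _ => ?_
    rw [smul_mul_assoc, smul_comm, mul_smul_comm, mul_assoc]
  have h3 := Finset.sum_congr rfl h2
  rw [← Finset.smul_sum, ← Finset.sum_mul, h1, Finset.sum_comm] at h3
  -- The sum over `b` now reassembles a minor on `rS`, which vanishes for `r ∈ S`; only `r = i` and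
  -- `r = k` survive.
  simp only [← Finset.smul_sum, ← Finset.mul_sum, sum_row_mul_minor hX] at h3
  rw [hR, Finset.sum_insert hi', Finset.sum_insert hk, Finset.sum_eq_zero (s := S), add_zero,
    if_neg hi, if_neg hk] at h3
  swap
  · intro r hr
    rw [if_pos hr, mul_zero, smul_zero]
  rw [← hR] at h3
  have e1 : R.erase i = insert k S := by rw [hR, Finset.erase_insert hi']
  have e2 : R.erase k = insert i S := by
    rw [hR, Finset.erase_insert_of_ne hik.ne, Finset.erase_insert hk]
  have n1 : j ∉ insert k S := by simp [hj, hjk.ne]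
  have n2 : j ∉ insert i S := by simp [hj, hij.ne']
  rw [e1, e2, if_neg n1, if_neg n2] at h3
  simp only [smul_mul_assoc, mul_smul_comm, smul_smul, ← pow_add] at h3
  rw [card_filter_lt_insert S hk, if_neg hjk.not_gt, card_filter_lt_insert S hi, if_pos hij,
    hR, card_filter_gt_insert _ hi', if_neg (lt_irrefl i), card_filter_gt_insert S hk, if_pos hik,
    card_filter_gt_insert _ hi', if_neg hik.not_gt, card_filter_gt_insert S hk,
    if_neg (lt_irrefl k)] at h3
  have c1 := card_filter_lt_add_gt S hi
  have c2 := card_filter_lt_add_gt S hk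
  have p1 : (S.filter (i < ·)).card + 1 + 0 + ((S.filter (· < i)).card
      + ((S.filter (· < j)).card + 0)) = T.card + (S.filter (· < j)).card := by omega
  have p2 : (S.filter (k < ·)).card + 0 + 0 + ((S.filter (· < k)).card
      + ((S.filter (· < j)).card + 1)) = T.card + (S.filter (· < j)).card := by omega
  rw [p1, p2, ← smul_add] at h3
  rw [smul_right_injective A (pow_ne_zero _ neg_q_ne_zero) h3, Finset.insert_comm j i, add_comm]

/-- The Dodgson-type relation, with arbitrary rows and columns. -/
theorem minor_dodgson_swap {X : Matrix (Fin m) (Fin n) A} (hX : IsFine q X) {S : Finset (Fin m)}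
    {T : Finset (Fin n)} {i k : Fin m} {j l : Fin n} (hc : S.card = T.card) (hik : i < k)
    (hjl : j < l) (hi : i ∉ S) (hk : k ∉ S) (hj : j ∉ T) (hl : l ∉ T) :
    minor q X (insert i S) (insert j T) * minor q X (insert k S) (insert l T)
      = minor q X (insert i (insert k S)) (insert j (insert l T)) * minor q X S T
        + (q : K) • (minor q X (insert k S) (insert j T) * minor q X (insert i S) (insert l T)) := by
  set R := insert i (insert k S) with hR
  have hi' : i ∉ insert k S := by simp [hi, hik.ne]
  have hl' : l ∉ insert j T := by simp [hl, hjl.ne']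
  -- The double sum of `minor(R∖r | jT) * X r b * minor(S | lT∖b)` is evaluated in both orders.
  -- Summing over `r` first leaves only `b = l`; summing over `b` first leaves only `r = i, k`,
  -- whose signs differ by one factor `-q`.
  have h1 : ∀ b ∈ insert l T, ∑ r ∈ R, (-(q : K)) ^ (R.filter (r < ·)).card •
      (minor q X (R.erase r) (insert j T) * ((-(q : K)) ^ ((insert l T).filter (· < b)).card •
        (X r b * minor q X S ((insert l T).erase b))))
      = (-(q : K)) ^ ((insert l T).filter (· < b)).card • ((if b ∈ insert j T then 0 else
        (-(q : K)) ^ ((insert j T).filter (b < ·)).card • minor q X R (insert b (insert j T)))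
        * minor q X S ((insert l T).erase b)) := by
    intro b _
    rw [← sum_minor_mul_col hX, Finset.sum_mul, Finset.smul_sum]
    refine Finset.sum_congr rfl fun r _ => ?_
    simp only [smul_mul_assoc, mul_smul_comm, mul_assoc]
    rw [smul_comm]
  have h2 := Finset.sum_congr rfl h1
  rw [Finset.sum_comm] at h2
  simp only [← Finset.smul_sum, ← Finset.mul_sum, sum_row_mul_minor hX] at h2
  rw [Finset.sum_insert hl, Finset.sum_eq_zero (s := T), add_zero, if_neg hl', hR,
    Finset.sum_insert hi', Finset.sum_insert hk, Finset.sum_eq_zero (s := S), add_zero,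
    if_neg hi, if_neg hk] at h2
  rotate_left
  · intro r hr
    rw [if_pos hr, mul_zero, smul_zero]
  · intro b hb
    rw [if_pos (Finset.mem_insert_of_mem hb), zero_mul, smul_zero]
  rw [← hR] at h2
  have e1 : R.erase i = insert k S := by rw [hR, Finset.erase_insert hi']
  have e2 : R.erase k = insert i S := by
    rw [hR, Finset.erase_insert_of_ne hik.ne, Finset.erase_insert hk]
  rw [e1, e2, Finset.erase_insert hl] at h2
  simp only [smul_mul_assoc, mul_smul_comm, smul_smul, ← pow_add] at h2
  rw [hR, card_filter_gt_insert _ hi', if_neg (lt_irrefl i), card_filter_gt_insert S hk, if_pos hik,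
    card_filter_gt_insert _ hi', if_neg hik.not_gt, card_filter_gt_insert S hk,
    if_neg (lt_irrefl k), card_filter_lt_insert T hl, if_neg (lt_irrefl l),
    card_filter_gt_insert T hj, if_neg hjl.not_gt] at h2
  have c1 := card_filter_lt_add_gt S hi
  have c2 := card_filter_lt_add_gt S hk
  have c3 := card_filter_lt_add_gt T hl
  have p1 : (S.filter (i < ·)).card + 1 + 0 + (S.filter (· < i)).card = T.card + 1 := by omega
  have p2 : (S.filter (k < ·)).card + 0 + 0 + (S.filter (· < k)).card = T.card := by omega
  have p3 : (T.filter (· < l)).card + 0 + ((T.filter (l < ·)).card + 0) = T.card := by omega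
  rw [p1, p2, p3, pow_succ, mul_smul, ← smul_add] at h2
  have h3 := smul_right_injective A (pow_ne_zero _ neg_q_ne_zero) h2
  rw [Finset.insert_comm j l, ← h3, neg_smul]
  abel

/-- Applying `minor_dodgson_swap` to the transpose exchanges the two factors of the last product,
which is the order required of an RQI-function. -/
theorem minor_dodgson {X : Matrix (Fin m) (Fin n) A} (hX : IsFine q X) {S : Finset (Fin m)}
    {T : Finset (Fin n)} {i k : Fin m} {j l : Fin n} (hc : S.card = T.card) (hik : i < k)
    (hjl : j < l) (hi : i ∉ S) (hk : k ∉ S) (hj : j ∉ T) (hl : l ∉ T) :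
    minor q X (insert i S) (insert j T) * minor q X (insert k S) (insert l T)
      = minor q X (insert i (insert k S)) (insert j (insert l T)) * minor q X S T
        + (q : K) • (minor q X (insert i S) (insert l T) * minor q X (insert k S) (insert j T)) := by
  simp only [minor_transpose hX]
  exact minor_dodgson_swap hX.transpose hc.symm hjl hik hj hl hi hk

/-- The quantum minors of a fine matrix form an RQI-function. -/
theorem IsFine.isRQIFunction {X : Matrix (Fin m) (Fin n) A} (hX : IsFine q X) :
    IsRQIFunction q (qMinor q X) where
  pluecker S T i j k l hc hij hjk hi hj hk hl := by
    simp only [val_qMinor]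
    exact minor_pluecker hX hc hij hjk hi hj hk hl
  copluecker S T l i j k hc hij hjk hi hj hk hl := by
    simp only [val_qMinor, minor_transpose hX]
    exact minor_pluecker hX.transpose hc.symm hij hjk hi hj hk hl
  dodgson i k j l hik hkl := by
    simp only [val_qMinor]
    have hjl : j < l := by rw [Fin.lt_def] at hik ⊢; omega
    refine minor_dodgson hX ?_ hik hjl ?_ ?_ ?_ ?_
    · simp only [Fin.card_Ioo]; omega
    all_goals simp

end MinorIdentities

/-! ### Intervals and gaps -/

section Intervals

variable {n : ℕ}

/-- The interval of the `s` indices starting from `a`. -/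
def seg (n a s : ℕ) : Finset (Fin n) := Finset.univ.filter fun x => a ≤ (x : ℕ) ∧ (x : ℕ) < a + s

theorem mem_seg {a s : ℕ} {x : Fin n} : x ∈ seg n a s ↔ a ≤ (x : ℕ) ∧ (x : ℕ) < a + s := by
  simp [seg]

theorem seg_zero (a : ℕ) : seg n a 0 = ∅ := by
  ext x; simp only [mem_seg, Finset.notMem_empty, iff_false]; omega

theorem seg_succ_eq_Icc {a s : ℕ} (h : a + (s + 1) ≤ n) :
    seg n a (s + 1) = Finset.Icc ⟨a, by omega⟩ ⟨a + s, by omega⟩ := by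
  ext x; simp only [mem_seg, Finset.mem_Icc, Fin.le_def]; omega

theorem card_seg {a s : ℕ} (h : a + s ≤ n) : (seg n a s).card = s := by
  cases s with
  | zero => rw [seg_zero]; rfl
  | succ s => rw [seg_succ_eq_Icc h, Fin.card_Icc]; simp only; omega

theorem isInitial_seg_zero (s : ℕ) (h : s ≤ n) : IsInitial (seg n 0 s) := by
  intro x
  rw [card_seg (by omega), mem_seg]; omega

/-- The indices outside `I` that lie between elements of `I`. -/
def gaps (I : Finset (Fin n)) : Finset (Fin n) :=
  Finset.univ.filter fun x => x ∉ I ∧ (∃ a ∈ I, a < x) ∧ ∃ b ∈ I, x < b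

theorem mem_gaps {I : Finset (Fin n)} {x : Fin n} :
    x ∈ gaps I ↔ x ∉ I ∧ (∃ a ∈ I, a < x) ∧ ∃ b ∈ I, x < b := by
  simp [gaps]

theorem exists_eq_seg_of_gaps_eq_empty {I : Finset (Fin n)} (hI : I.Nonempty) (h : gaps I = ∅) :
    ∃ a, a + I.card ≤ n ∧ I = seg n a I.card := by
  have key : I = seg n (I.min' hI) (I.max' hI - I.min' hI + 1) := by
    ext x
    rw [mem_seg]
    constructor
    · intro hx
      have h1 := Fin.le_def.mp (I.min'_le x hx)
      have h2 := Fin.le_def.mp (I.le_max' x hx)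
      omega
    · rintro ⟨h1, h2⟩
      by_contra hx
      have hmM := Fin.le_def.mp (I.min'_le _ (I.max'_mem hI))
      have : x ∈ gaps I := by
        refine mem_gaps.mpr ⟨hx, ⟨_, I.min'_mem hI, lt_of_le_of_ne h1 ?_⟩,
          ⟨_, I.max'_mem hI, lt_of_le_of_ne (by rw [Fin.le_def]; omega) ?_⟩⟩
        · intro h; exact hx (h ▸ I.min'_mem hI)
        · intro h; exact hx (h ▸ I.max'_mem hI)
      rw [h] at this
      exact Finset.notMem_empty _ this
  have hmM := Fin.le_def.mp (I.min'_le _ (I.max'_mem hI))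
  have hlt := (I.max' hI).isLt
  have hc : I.card = I.max' hI - I.min' hI + 1 := by
    conv_lhs => rw [key]
    exact card_seg (by omega)
  exact ⟨I.min' hI, by omega, by rw [hc]; exact key⟩

/-- Take `i` and `k` to be the extreme elements and `j` a gap. Replacing an extreme element by `j`
fills that gap and creates none, since nothing outside the old hull is added. These are the sets on
the right of a Plücker relation. -/
theorem exists_insert_insert_of_gaps_nonempty {I : Finset (Fin n)} (h : (gaps I).Nonempty) :
    ∃ S i j k, I = insert i (insert k S) ∧ i < j ∧ j < k ∧ i ∉ S ∧ j ∉ S ∧ k ∉ S ∧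
      (gaps (insert i (insert j S))).card < (gaps I).card ∧
      (gaps (insert j (insert k S))).card < (gaps I).card := by
  obtain ⟨j, hj⟩ := h
  obtain ⟨hjI, ⟨a, ha, haj⟩, ⟨b, hb, hjb⟩⟩ := mem_gaps.mp hj
  have hI : I.Nonempty := ⟨a, ha⟩
  set i := I.min' hI with hi
  set k := I.max' hI with hk
  have hij : i < j := (I.min'_le a ha).trans_lt haj
  have hjk : j < k := hjb.trans_le (I.le_max' b hb)
  have hki : k ∈ I.erase i := Finset.mem_erase.mpr ⟨(hij.trans hjk).ne', I.max'_mem hI⟩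
  have hS : ∀ x ∈ (I.erase i).erase k, i < x ∧ x < k ∧ x ∈ I := by
    intro x hx
    obtain ⟨hxk, hx⟩ := Finset.mem_erase.mp hx
    obtain ⟨hxi, hx⟩ := Finset.mem_erase.mp hx
    exact ⟨lt_of_le_of_ne (I.min'_le x hx) hxi.symm, lt_of_le_of_ne (I.le_max' x hx) hxk, hx⟩
  have hIx : ∀ x ∈ I, x = i ∨ x = k ∨ x ∈ (I.erase i).erase k := by
    intro x hx
    simp only [Finset.mem_erase]
    tauto
  refine ⟨(I.erase i).erase k, i, j, k, ?_, hij, hjk, ?_, ?_, ?_, ?_, ?_⟩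
  · rw [Finset.insert_erase hki, Finset.insert_erase (I.min'_mem hI)]
  · intro h; exact lt_irrefl _ (hS _ h).1
  · intro h; exact hjI (hS _ h).2.2
  · intro h; exact lt_irrefl _ (hS _ h).2.1
  · refine Finset.card_lt_card ((Finset.ssubset_iff_of_subset fun x hx => ?_).mpr ⟨j, hj, ?_⟩)
    · obtain ⟨hx, ⟨c, hc, hcx⟩, ⟨d, hd, hxd⟩⟩ := mem_gaps.mp hx
      simp only [Finset.mem_insert] at hx hc hd
      have hic : i ≤ c := by
        rcases hc with rfl | rfl | hc
        exacts [le_rfl, hij.le, (hS _ hc).1.le]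
      have hdk : d < k := by
        rcases hd with rfl | rfl | hd
        exacts [hij.trans hjk, hjk, (hS _ hd).2.1]
      refine mem_gaps.mpr ⟨fun hxI => ?_, ⟨i, I.min'_mem hI, hic.trans_lt hcx⟩,
        ⟨k, I.max'_mem hI, hxd.trans hdk⟩⟩
      rcases hIx x hxI with h | h | h
      · exact hx (Or.inl h)
      · exact (hxd.trans hdk).ne h
      · exact hx (Or.inr (Or.inr h))
    · intro h
      exact (mem_gaps.mp h).1 (by simp)
  · refine Finset.card_lt_card ((Finset.ssubset_iff_of_subset fun x hx => ?_).mpr ⟨j, hj, ?_⟩)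
    · obtain ⟨hx, ⟨c, hc, hcx⟩, ⟨d, hd, hxd⟩⟩ := mem_gaps.mp hx
      simp only [Finset.mem_insert] at hx hc hd
      have hic : i < c := by
        rcases hc with rfl | rfl | hc
        exacts [hij, hij.trans hjk, (hS _ hc).1]
      have hdk : d ≤ k := by
        rcases hd with rfl | rfl | hd
        exacts [hjk.le, le_rfl, (hS _ hd).2.1.le]
      refine mem_gaps.mpr ⟨fun hxI => ?_, ⟨i, I.min'_mem hI, hic.trans hcx⟩,
        ⟨k, I.max'_mem hI, hxd.trans_le hdk⟩⟩
      rcases hIx x hxI with h | h | h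
      · exact (hic.trans hcx).ne' h
      · exact hx (Or.inr (Or.inl h))
      · exact hx (Or.inr (Or.inr h))
    · intro h
      exact (mem_gaps.mp h).1 (by simp)

end Intervals

/-! ### An RQI-function with regular values is determined by its pressed values -/

section Uniqueness

variable {K : Type u} [Field K] {q : Kˣ} {A : Type v} [Ring A] [Algebra K A] {m n : ℕ}
  {f g : Cortege m n → A}

theorem val_eq_of_card_eq (f : Cortege m n → A) {I : Finset (Fin m)} {J : Finset (Fin n)}
    (h : I.card = J.card) : val f I J = f ⟨I, J, h⟩ := dif_pos h

/-- Induction on the corner `a + b`, then on the size. The Dodgson relation based at `(a-1, b-1)`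
has the desired value as its second factor. All its other terms have a smaller corner, except the
inner interval, which has the same corner and is shorter. If `a = 0` or `b = 0`, the double interval
is pressed. -/
theorem IsRQIFunction.val_seg_eq (hf : IsRQIFunction q f) (hg : IsRQIFunction q g)
    (h0 : f (Cortege.empty m n) = g (Cortege.empty m n)) (hp : ∀ c : PInt m n, f c.1 = g c.1)
    (hreg : ∀ c a, f c * a = 0 → a = 0) (a b s : ℕ) (ha : a + s ≤ m) (hb : b + s ≤ n) :
    val f (seg m a s) (seg n b s) = val g (seg m a s) (seg n b s) := by
  induction ht : a + b using Nat.strong_induction_on generalizing a b s with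
  | _ t ih =>
    induction s with
    | zero => simpa [seg_zero, val, Cortege.empty] using h0
    | succ s ihs =>
      have hcard : (seg m a (s + 1)).card = (seg n b (s + 1)).card := by
        rw [card_seg ha, card_seg hb]
      by_cases hab : a = 0 ∨ b = 0
      · rw [val_eq_of_card_eq f hcard, val_eq_of_card_eq g hcard]
        refine hp ⟨⟨_, _, hcard⟩, ⟨_, _, ?_, seg_succ_eq_Icc ha⟩, ⟨_, _, ?_, seg_succ_eq_Icc hb⟩, ?_⟩
        · simp [Fin.le_def]
        · simp [Fin.le_def]
        · rcases hab with rfl | rfl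
          · exact Or.inl (isInitial_seg_zero _ (by omega))
          · exact Or.inr (isInitial_seg_zero _ (by omega))
      · obtain ⟨a, rfl⟩ := Nat.exists_eq_add_of_lt (Nat.pos_of_ne_zero fun h => hab (Or.inl h))
        obtain ⟨b, rfl⟩ := Nat.exists_eq_add_of_lt (Nat.pos_of_ne_zero fun h => hab (Or.inr h))
        rw [zero_add] at *
        rw [zero_add] at *
        have e : ∀ {l : ℕ} (x : ℕ) (h : x + 1 + (s + 1) ≤ l),
            Finset.Ioo (⟨x, by omega⟩ : Fin l) ⟨x + 1 + s, by omega⟩ = seg l (x + 1) s ∧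
            insert (⟨x, by omega⟩ : Fin l) (seg l (x + 1) s) = seg l x (s + 1) ∧
            insert (⟨x + 1 + s, by omega⟩ : Fin l) (seg l (x + 1) s) = seg l (x + 1) (s + 1) ∧
            insert (⟨x, by omega⟩ : Fin l) (seg l (x + 1) (s + 1)) = seg l x (s + 2) := by
          intro l x h
          refine ⟨?_, ?_, ?_, ?_⟩ <;> ext y <;>
            simp only [Finset.mem_Ioo, Finset.mem_insert, mem_seg, Fin.lt_def, Fin.ext_iff] <;> omega
        obtain ⟨e1, e2, e3, e4⟩ := e a ha
        obtain ⟨e1', e2', e3', e4'⟩ := e b hb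
        have h1 := hf.dodgson ⟨a, by omega⟩ ⟨a + 1 + s, by omega⟩ ⟨b, by omega⟩ ⟨b + 1 + s, by omega⟩
          (by simp only [Fin.lt_def]; omega) (by simp only; omega)
        have h2 := hg.dodgson ⟨a, by omega⟩ ⟨a + 1 + s, by omega⟩ ⟨b, by omega⟩ ⟨b + 1 + s, by omega⟩
          (by simp only [Fin.lt_def]; omega) (by simp only; omega)
        rw [e1, e1', e2, e2', e3, e3', e4, e4'] at h1 h2
        rw [ih (a + b) (by omega) a b (s + 2) (by omega) (by omega) rfl,
          ih (a + (b + 1)) (by omega) a (b + 1) (s + 1) (by omega) (by omega) rfl,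
          ih (a + 1 + b) (by omega) (a + 1) b (s + 1) (by omega) (by omega) rfl,
          ihs (by omega) (by omega), ← h2,
          ← ih (a + b) (by omega) a b (s + 1) (by omega) (by omega) rfl, ← sub_eq_zero,
          ← mul_sub, val_eq_of_card_eq f (I := seg m a (s + 1)) (J := seg n b (s + 1))
            (by rw [card_seg, card_seg] <;> omega)] at h1
        exact sub_eq_zero.mp (hreg _ _ h1)

/-- Induction on the size, then on the total number of gaps. In a Plücker relation the wanted value
is multiplied on the left by a value of smaller size, the other large values have fewer gaps, and
the smaller ones are known. Without gaps both sides are intervals. Only values of `f` are cancelled.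
-/
theorem IsRQIFunction.eq_of_eq_on_pressed (hf : IsRQIFunction q f) (hg : IsRQIFunction q g)
    (h0 : f (Cortege.empty m n) = g (Cortege.empty m n)) (hp : ∀ c : PInt m n, f c.1 = g c.1)
    (hreg : ∀ c a, f c * a = 0 → a = 0) : f = g := by
  have main : ∀ s t : ℕ, ∀ (I : Finset (Fin m)) (J : Finset (Fin n)), I.card = s → J.card = s →
      (gaps I).card + (gaps J).card = t → val f I J = val g I J := by
    intro s
    induction s using Nat.strong_induction_on with
    | _ s ihs =>
      intro t
      induction t using Nat.strong_induction_on with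
      | _ t iht =>
        intro I J hI hJ ht
        rcases (gaps I).eq_empty_or_nonempty with hgI | hgI
        · rcases (gaps J).eq_empty_or_nonempty with hgJ | hgJ
          · rcases I.eq_empty_or_nonempty with rfl | hI0
            · have : J = ∅ := Finset.card_eq_zero.mp (by rw [hJ, ← hI]; rfl)
              subst this
              simpa [val, Cortege.empty] using h0
            · have hJ0 : J.Nonempty :=
                Finset.card_pos.mp (by rw [hJ, ← hI]; exact Finset.card_pos.mpr hI0)
              obtain ⟨a, ha, ha'⟩ := exists_eq_seg_of_gaps_eq_empty hI0 hgI
              obtain ⟨b, hb, hb'⟩ := exists_eq_seg_of_gaps_eq_empty hJ0 hgJ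
              rw [ha', hb', hI, hJ]
              exact hf.val_seg_eq hg h0 hp hreg a b s (by omega) (by omega)
          · obtain ⟨T, i, j, k, rfl, hij, hjk, hi, hj, hk, hlt, hlt'⟩ :=
              exists_insert_insert_of_gaps_nonempty hgJ
            have hi' : i ∉ insert k T := by simp [hi, (hij.trans hjk).ne]
            have hj' : j ∉ insert k T := by simp [hj, hjk.ne]
            have hj'' : i ∉ insert j T := by simp [hi, hij.ne]
            rw [Finset.card_insert_of_notMem hi', Finset.card_insert_of_notMem hk] at hJ
            obtain ⟨l, hl⟩ := Finset.card_pos.mp (show 0 < I.card by omega)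
            have hS : (I.erase l).card = T.card + 1 := by
              rw [Finset.card_erase_of_mem hl]; omega
            have h1 := hf.copluecker (I.erase l) T l i j k hS hij hjk hi hj hk
              (Finset.notMem_erase l I)
            have h2 := hg.copluecker (I.erase l) T l i j k hS hij hjk hi hj hk
              (Finset.notMem_erase l I)
            rw [Finset.insert_erase hl] at h1 h2
            have small : ∀ x ∉ T, val f (I.erase l) (insert x T) = val g (I.erase l) (insert x T) := by
              intro x hx
              exact ihs (T.card + 1) (by omega) _ _ _ hS (Finset.card_insert_of_notMem hx) rfl
            rw [iht _ (by omega) I (insert i (insert j T)) hI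
                (by rw [Finset.card_insert_of_notMem hj'', Finset.card_insert_of_notMem hj]; omega) rfl,
              iht _ (by omega) I (insert j (insert k T)) hI
                (by rw [Finset.card_insert_of_notMem hj', Finset.card_insert_of_notMem hk]; omega) rfl,
              small k hk, small i hi, ← h2, ← small j hj, ← sub_eq_zero, ← mul_sub,
              val_eq_of_card_eq f (I := I.erase l) (J := insert j T)
                (by rw [hS, Finset.card_insert_of_notMem hj])] at h1
            exact sub_eq_zero.mp (hreg _ _ h1)
        · obtain ⟨S, i, j, k, rfl, hij, hjk, hi, hj, hk, hlt, hlt'⟩ :=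
            exists_insert_insert_of_gaps_nonempty hgI
          have hi' : i ∉ insert k S := by simp [hi, (hij.trans hjk).ne]
          have hj' : j ∉ insert k S := by simp [hj, hjk.ne]
          have hj'' : i ∉ insert j S := by simp [hi, hij.ne]
          rw [Finset.card_insert_of_notMem hi', Finset.card_insert_of_notMem hk] at hI
          obtain ⟨l, hl⟩ := Finset.card_pos.mp (show 0 < J.card by omega)
          have hT : S.card + 1 = (J.erase l).card := by
            rw [Finset.card_erase_of_mem hl]; omega
          have h1 := hf.pluecker S (J.erase l) i j k l hT hij hjk hi hj hk
            (Finset.notMem_erase l J)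
          have h2 := hg.pluecker S (J.erase l) i j k l hT hij hjk hi hj hk
            (Finset.notMem_erase l J)
          rw [Finset.insert_erase hl] at h1 h2
          have small : ∀ x ∉ S, val f (insert x S) (J.erase l) = val g (insert x S) (J.erase l) := by
            intro x hx
            exact ihs (S.card + 1) (by omega) _ _ _ (Finset.card_insert_of_notMem hx) hT.symm rfl
          rw [iht _ (by omega) (insert i (insert j S)) J
              (by rw [Finset.card_insert_of_notMem hj'', Finset.card_insert_of_notMem hj]; omega)
              hJ rfl,
            iht _ (by omega) (insert j (insert k S)) J
              (by rw [Finset.card_insert_of_notMem hj', Finset.card_insert_of_notMem hk]; omega)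
              hJ rfl,
            small k hk, small i hi, ← h2, ← small j hj, ← sub_eq_zero, ← mul_sub,
            val_eq_of_card_eq f (I := insert j S) (J := J.erase l)
              (by rw [← hT, Finset.card_insert_of_notMem hj])] at h1
          exact sub_eq_zero.mp (hreg _ _ h1)
  funext c
  have h := main c.rows.card _ c.rows c.cols rfl c.card_eq.symm rfl
  rwa [val_eq_of_card_eq f c.card_eq, val_eq_of_card_eq g c.card_eq] at h

end Uniqueness

/-! ### Quasi-commuting elements -/

section QuasiCommuting

variable {K : Type u} [Field K] (q : Kˣ) {A : Type v} [Ring A] [Algebra K A]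

/-- `x y = q^c y x`. -/
def QComm (c : ℤ) (x y : A) : Prop := x * y = qpow q c • (y * x)

variable {q}

theorem qpow_zero : qpow q 0 = 1 := by simp [qpow]

theorem qpow_one : qpow q 1 = (q : K) := by simp [qpow]

theorem qpow_neg_one : qpow q (-1) = (q : K)⁻¹ := by simp [qpow]

theorem qpow_add (c d : ℤ) : qpow q (c + d) = qpow q c * qpow q d := by simp [qpow, zpow_add]

theorem QComm.congr {c d : ℤ} {x y : A} (h : QComm q c x y) (hcd : c = d) : QComm q d x y := hcd ▸ h

theorem QComm.mul_left {c d : ℤ} {x x' y : A} (h : QComm q c x y) (h' : QComm q d x' y) :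
    QComm q (c + d) (x * x') y := by
  rw [QComm] at *
  rw [mul_assoc, h', mul_smul_comm, ← mul_assoc, h, smul_mul_assoc, smul_smul, mul_assoc, qpow_add,
    mul_comm (qpow q d)]

theorem QComm.symm {c : ℤ} {x y : A} (h : QComm q c x y) : QComm q (-c) y x := by
  rw [QComm] at *
  rw [h, smul_smul, ← qpow_add, neg_add_cancel, qpow_zero, one_smul]

theorem QComm.mul_right {c d : ℤ} {x y y' : A} (h : QComm q c x y) (h' : QComm q d x y') :
    QComm q (c + d) x (y * y') :=
  (h.symm.mul_left h'.symm).symm.congr (by ring)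

theorem QComm.inv_left {c : ℤ} {u : Aˣ} {y : A} (h : QComm q c (u : A) y) :
    QComm q (-c) ((u⁻¹ : Aˣ) : A) y := by
  have h' := h.symm
  rw [QComm] at *
  calc ((u⁻¹ : Aˣ) : A) * y = (u⁻¹ : Aˣ) * (y * u) * (u⁻¹ : Aˣ) := by
        rw [mul_assoc, mul_assoc, Units.mul_inv, mul_one]
    _ = _ := by
        rw [h', mul_smul_comm, smul_mul_assoc, ← mul_assoc ((u⁻¹ : Aˣ) : A), Units.inv_mul, one_mul]

theorem QComm.inv_right {c : ℤ} {x : A} {u : Aˣ} (h : QComm q c x (u : A)) :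
    QComm q (-c) x ((u⁻¹ : Aˣ) : A) :=
  h.symm.inv_left.symm.congr (by ring)

theorem QComm.one_left (y : A) : QComm q 0 1 y := by simp [QComm, qpow_zero]

theorem QComm.one_right (x : A) : QComm q 0 x 1 := by simp [QComm, qpow_zero]

theorem QComm.sum_right {ι : Type*} {c : ℤ} {x : A} {s : Finset ι} {y : ι → A}
    (h : ∀ i ∈ s, QComm q c x (y i)) : QComm q c x (∑ i ∈ s, y i) := by
  rw [QComm, Finset.mul_sum, Finset.sum_mul, Finset.smul_sum]
  exact Finset.sum_congr rfl h

theorem QComm.sum_left {ι : Type*} {c : ℤ} {x : A} {s : Finset ι} {y : ι → A}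
    (h : ∀ i ∈ s, QComm q c (y i) x) : QComm q c (∑ i ∈ s, y i) x :=
  (QComm.sum_right fun i hi => (h i hi).symm).symm.congr (by ring)

theorem QComm.commute {x y : A} (h : QComm q 0 x y) : x * y = y * x := by
  rw [QComm, qpow_zero, one_smul] at h
  exact h

end QuasiCommuting

/-! ### Adding a row to a fine matrix -/

section AddRow

variable {K : Type u} [Field K] {q : Kˣ} {A : Type v} [Ring A] [Algebra K A] {m n : ℕ}

/-- Manin's relations for the upper left `m × n` corner of an infinite matrix. -/
structure FineOn (q : Kˣ) (m n : ℕ) (X : ℕ → ℕ → A) : Prop where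
  row : ∀ i j k, i < m → j < k → k < n → X i j * X i k = (q : K) • (X i k * X i j)
  col : ∀ i l j, i < l → l < m → j < n → X i j * X l j = (q : K) • (X l j * X i j)
  anti : ∀ i l j k, i < l → l < m → j < k → k < n → X i k * X l j = X l j * X i k
  cross : ∀ i l j k, i < l → l < m → j < k → k < n →
    X i j * X l k - X l k * X i j = ((q : K) - (q : K)⁻¹) • (X i k * X l j)

theorem FineOn.isFine {X : ℕ → ℕ → A} (hX : FineOn q m n X) :
    IsFine q (fun (i : Fin m) (j : Fin n) => X i j : Matrix (Fin m) (Fin n) A) where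
  row i j k h := hX.row i j k i.2 h k.2
  col i l j h := hX.col i l j h l.2 j.2
  anti i l j k h h' := hX.anti i l j k h l.2 h' k.2
  cross i l j k h h' := hX.cross i l j k h l.2 h' k.2

/-- The relations between the columns `b` of `Y` divided by the invertible elements `u b`. -/
structure TwistedFineOn (q : Kˣ) (m n : ℕ) (V : ℕ → ℕ → A) : Prop where
  row : ∀ i j k, i < m → j < k → k < n → QComm q 2 (V i j) (V i k)
  col : ∀ i l j, i < l → l < m → j < n → QComm q 1 (V i j) (V l j)
  anti : ∀ i l j k, i < l → l < m → j < k → k < n → QComm q (-1) (V i k) (V l j)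
  cross : ∀ i l j k, i < l → l < m → j < k → k < n →
    V i j * V l k = (q : K) • (V l k * V i j) + ((q : K) * q - 1) • (V i k * V l j)

/-- Moving `u_b⁻¹` past an entry of column `c` costs `q⁻¹` only when `b = c`, while `u_j⁻¹ u_k⁻¹ = q
u_k⁻¹ u_j⁻¹` for `j < k`. This extra `q` is the difference from Manin's relations. In this form the
entries of the enlarged matrix become partial row sums. -/
theorem FineOn.twisted {Y : ℕ → ℕ → A} (hY : FineOn q m n Y) (u : ℕ → Aˣ)
    (hu : ∀ j k, j < k → k < n → QComm q 1 (u j : A) (u k))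
    (huY : ∀ i j b, i < m → j < n → b < n → QComm q (if j = b then 1 else 0) (u j : A) (Y i b)) :
    TwistedFineOn q m n fun i b => Y i b * ((u b)⁻¹ : Aˣ) := by
  have huv : ∀ j k, j < k → k < n →
      ((u j)⁻¹ : Aˣ) * ((u k)⁻¹ : Aˣ) = (q : K) • ((u k)⁻¹ : Aˣ) * ((u j)⁻¹ : Aˣ).val := by
    intro j k h h'
    have := (hu j k h h').inv_left.inv_right
    rw [neg_neg, QComm, qpow_one] at this
    rw [this, smul_mul_assoc]
  have hmul : ∀ i l b c, l < m → b < n → c < n →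
      (Y i b * ((u b)⁻¹ : Aˣ)) * (Y l c * ((u c)⁻¹ : Aˣ)) = qpow q (-(if b = c then 1 else 0)) •
        ((Y i b * Y l c) * (((u b)⁻¹ : Aˣ) * ((u c)⁻¹ : Aˣ))) := by
    intro i l b c hl hb hc
    have := (huY l b c hl hb hc).inv_left
    rw [QComm] at this
    rw [mul_assoc, ← mul_assoc _ (Y l c), this, smul_mul_assoc, mul_smul_comm]
    simp only [mul_assoc]
  have hq : (q : K) ≠ 0 := q.ne_zero
  have q2 : qpow q 2 = (q : K) * q := by
    rw [show (2 : ℤ) = 1 + 1 from rfl, qpow_add, qpow_one]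
  constructor
  · intro i j k hi hjk hk
    rw [QComm, hmul i i j k hi (hjk.trans hk) hk, hmul i i k j hi hk (hjk.trans hk), if_neg hjk.ne,
      if_neg hjk.ne', neg_zero, qpow_zero, one_smul, one_smul, hY.row i j k hi hjk hk,
      huv j k hjk hk, q2]
    simp only [smul_mul_assoc, mul_smul_comm, smul_smul]
  · intro i l j hil hl hj
    rw [QComm, hmul i l j j hl hj hj, hmul l i j j (hil.trans hl) hj hj, hY.col i l j hil hl hj,
      qpow_one, smul_mul_assoc, smul_comm]
  · intro i l j k hil hl hjk hk
    rw [QComm, hmul i l k j hl hk (hjk.trans hk), hmul l i j k (hil.trans hl) (hjk.trans hk) hk,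
      if_neg hjk.ne, if_neg hjk.ne', neg_zero, qpow_zero, one_smul, one_smul,
      hY.anti i l j k hil hl hjk hk, huv j k hjk hk, qpow_neg_one]
    simp only [smul_mul_assoc, mul_smul_comm, smul_smul]
    rw [inv_mul_cancel₀ hq, one_smul]
  · intro i l j k hil hl hjk hk
    rw [hmul i l j k hl (hjk.trans hk) hk, hmul l i k j (hil.trans hl) hk (hjk.trans hk),
      hmul i l k j hl hk (hjk.trans hk),
      if_neg hjk.ne, if_neg hjk.ne', neg_zero, qpow_zero, one_smul, one_smul, one_smul,
      eq_add_of_sub_eq (hY.cross i l j k hil hl hjk hk), huv j k hjk hk]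
    simp only [smul_mul_assoc, mul_smul_comm, add_mul, smul_add, smul_smul]
    rw [add_comm]
    congr 2
    field_simp

theorem TwistedFineOn.sum_col {V : ℕ → ℕ → A} (hV : TwistedFineOn q m n V) {i l : ℕ} (hil : i < l)
    (hl : l < m) {j : ℕ} (hj : j ≤ n) :
    QComm q 1 (∑ b ∈ Finset.range j, V i b) (∑ b ∈ Finset.range j, V l b) := by
  induction j with
  | zero => simp [QComm]
  | succ j ih =>
    have ih := ih (by omega)
    have h1 : QComm q (-1) (V i j) (∑ b ∈ Finset.range j, V l b) :=
      QComm.sum_right fun b hb => hV.anti i l b j hil hl (Finset.mem_range.mp hb) (by omega)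
    have h2 : (∑ b ∈ Finset.range j, V i b) * V l j = (q : K) • (V l j * ∑ b ∈ Finset.range j, V i b)
        + ((q : K) * q - 1) • (V i j * ∑ b ∈ Finset.range j, V l b) := by
      simp only [Finset.mul_sum, Finset.sum_mul, Finset.smul_sum, ← Finset.sum_add_distrib]
      exact Finset.sum_congr rfl fun b hb =>
        hV.cross i l b j hil hl (Finset.mem_range.mp hb) (by omega)
    have h3 := hV.col i l j hil hl (by omega)
    rw [Finset.sum_range_succ, Finset.sum_range_succ]
    generalize (∑ b ∈ Finset.range j, V i b) = Z at *
    generalize (∑ b ∈ Finset.range j, V l b) = Z' at *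
    rw [QComm, qpow_one] at *
    rw [qpow_neg_one] at h1
    have hq : (q : K) ≠ 0 := q.ne_zero
    have h1' : Z' * V i j = (q : K) • (V i j * Z') := by
      rw [h1, smul_smul, mul_inv_cancel₀ hq, one_smul]
    simp only [add_mul, mul_add, ih, h2, h3, h1']
    -- With `V`, `V'` the new entries of rows `i`, `l`: `V Z' + (q² - 1) V Z' = q² V Z' = q Z' V`,
    -- so the correction term of the cross relation is absorbed.
    module

/-- Manin's relations are inherited when a row is added below the sources of a grid. -/
theorem FineOn.addRow {Y : ℕ → ℕ → A} (hY : FineOn q m n Y) (u : ℕ → Aˣ)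
    (hu : ∀ j k, j < k → k < n → QComm q 1 (u j : A) (u k))
    (huY : ∀ i j b, i < m → j < n → b < n → QComm q (if j = b then 1 else 0) (u j : A) (Y i b))
    {X : ℕ → ℕ → A} (hX0 : ∀ j, X 0 j = u j)
    (hX : ∀ i j, X (i + 1) j = ∑ b ∈ Finset.range (j + 1), Y i b * ((u b)⁻¹ * u j : Aˣ)) :
    FineOn q (m + 1) n X := by
  have hV := hY.twisted u hu huY
  -- `X (i+1) j = Z i j * u j`, where `Z i j` is a partial sum of the normalized row; `W i j k` is
  -- its increment from column `j` to column `k`.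
  set V : ℕ → ℕ → A := fun i b => Y i b * ((u b)⁻¹ : Aˣ) with hVdef
  set Z : ℕ → ℕ → A := fun i j => ∑ b ∈ Finset.range (j + 1), V i b with hZ
  set W : ℕ → ℕ → ℕ → A := fun i j k => ∑ b ∈ Finset.Ico (j + 1) (k + 1), V i b with hW
  have hq : (q : K) ≠ 0 := q.ne_zero
  have hXZ : ∀ i j, X (i + 1) j = Z i j * u j := by
    intro i j
    rw [hX, hZ, Finset.sum_mul]
    exact Finset.sum_congr rfl fun b _ => by rw [hVdef, Units.val_mul, mul_assoc]
  have hZW : ∀ i j k, j < k → Z i k = Z i j + W i j k := fun i j k h =>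
    (Finset.sum_range_add_sum_Ico _ (by omega)).symm
  -- The sign of the exponent separates the columns up to `j` from those beyond it, so `u j`
  -- quasi-commutes with `Z i j` and with `W i j k` separately, but not with `Z i k`.
  have huV : ∀ i j b, i < m → j < n → b < n →
      QComm q (if b ≤ j then 1 else -1) (u j : A) (V i b) := by
    intro i j b hi hj hb
    have h1 := huY i j b hi hj hb
    rcases lt_trichotomy b j with h | h | h
    · refine (h1.mul_right (hu b j h hj).symm.inv_right).congr ?_
      rw [if_neg h.ne', if_pos h.le]; rfl
    · subst h
      refine (h1.mul_right (QComm.inv_right (c := 0) ?_)).congr ?_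
      · simp [QComm, qpow_zero]
      · simp
    · refine (h1.mul_right (hu j b h hb).inv_right).congr ?_
      rw [if_neg h.ne, if_neg h.not_ge]; rfl
  have huZ : ∀ i j k, i < m → j ≤ k → k < n → u k * Z i j = (q : K) • (Z i j * u k) := by
    intro i j k hi hjk hk
    have : QComm q 1 (u k : A) (Z i j) := QComm.sum_right fun b hb => by
      have := Finset.mem_range.mp hb
      refine (huV i k b hi hk (by omega)).congr (if_pos (by omega))
    rwa [QComm, qpow_one] at this
  have huW : ∀ i j k, i < m → j < k → k < n → u j * W i j k = (q : K)⁻¹ • (W i j k * u j) := by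
    intro i j k hi hjk hk
    have : QComm q (-1) (u j : A) (W i j k) := QComm.sum_right fun b hb => by
      have := Finset.mem_Ico.mp hb
      refine (huV i j b hi (by omega) (by omega)).congr (if_neg (by omega))
    rwa [QComm, qpow_neg_one] at this
  have huu : ∀ j k, j < k → k < n → u k * (u j : A) = (q : K)⁻¹ • (u j * (u k : A)) := by
    intro j k hjk hk
    have := (hu j k hjk hk).symm
    rwa [QComm, qpow_neg_one] at this
  -- Both kinds of products of entries are put in the normal form (polynomial in `Z`, `W`) times `u
  -- j * u k`. Manin's relations then reduce to relations between the sums `Z` and `W`.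
  have prod1 : ∀ i l j k, l < m → j < k → k < n → (Z i j * u j) * (Z l k * u k)
      = ((q : K) • (Z i j * Z l j) + (q : K)⁻¹ • (Z i j * W l j k)) * (u j * u k) := by
    intro i l j k hl hjk hk
    have h1 := huZ l j j hl le_rfl (by omega)
    have h2 := huW l j k hl hjk hk
    calc (Z i j * u j) * (Z l k * u k) = Z i j * (u j * Z l j + u j * W l j k) * u k := by
          rw [hZW l j k hjk]; noncomm_ring
      _ = _ := by
          rw [h1, h2]
          simp only [mul_add, add_mul, mul_smul_comm, smul_mul_assoc, mul_assoc]
  have prod2 : ∀ i l j k, l < m → j < k → k < n → (Z i k * u k) * (Z l j * u j)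
      = ((Z i j + W i j k) * Z l j) * (u j * u k) := by
    intro i l j k hl hjk hk
    calc (Z i k * u k) * (Z l j * u j) = Z i k * (u k * Z l j) * u j := by noncomm_ring
      _ = (q : K) • ((Z i k * Z l j) * (u k * u j)) := by
          rw [huZ l j k hl hjk.le hk]
          simp only [mul_smul_comm, smul_mul_assoc, mul_assoc]
      _ = _ := by
          rw [huu j k hjk hk, mul_smul_comm, smul_smul, mul_inv_cancel₀ hq, one_smul,
            hZW i j k hjk]
  have hWZ : ∀ i l j k, i < l → l < m → j < k → k < n →
      W i j k * Z l j = (q : K)⁻¹ • (Z l j * W i j k) := by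
    intro i l j k hil hl hjk hk
    have : QComm q (-1) (W i j k) (Z l j) :=
      QComm.sum_left fun b hb => QComm.sum_right fun c hc => by
        have := Finset.mem_Ico.mp hb
        have := Finset.mem_range.mp hc
        exact hV.anti i l c b hil hl (by omega) (by omega)
    rwa [QComm, qpow_neg_one] at this
  have hZZ : ∀ i l j, i < l → l < m → j < n → Z i j * Z l j = (q : K) • (Z l j * Z i j) := by
    intro i l j hil hl hj
    have := hV.sum_col hil hl (j := j + 1) (by omega)
    rwa [QComm, qpow_one] at this
  have hZW' : ∀ i l j k, i < l → l < m → j < k → k < n → Z i j * W l j k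
      = (q : K) • (W l j k * Z i j) + ((q : K) * q - 1) • (W i j k * Z l j) := by
    intro i l j k hil hl hjk hk
    simp only [hZ, hW, Finset.sum_mul_sum, Finset.smul_sum]
    rw [Finset.sum_comm]
    simp only [← Finset.sum_add_distrib]
    refine Finset.sum_congr rfl fun b hb => Finset.sum_congr rfl fun c hc => ?_
    have := Finset.mem_Ico.mp hb
    have := Finset.mem_range.mp hc
    exact hV.cross i l c b hil hl (by omega) (by omega)
  have hZWr : ∀ i j k, i < m → j < k → k < n →
      Z i j * W i j k = ((q : K) * q) • (W i j k * Z i j) := by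
    intro i j k hi hjk hk
    have : QComm q 2 (Z i j) (W i j k) :=
      QComm.sum_left fun b hb => QComm.sum_right fun c hc => by
        have := Finset.mem_range.mp hb
        have := Finset.mem_Ico.mp hc
        exact hV.row i b c hi (by omega) (by omega)
    rwa [QComm, show (2 : ℤ) = 1 + 1 from rfl, qpow_add, qpow_one] at this
  constructor
  · rintro (_ | i) j k hi hjk hk
    · have := hu j k hjk hk
      rw [hX0, hX0]
      rwa [QComm, qpow_one] at this
    · have hi : i < m := by omega
      rw [hXZ, hXZ, prod1 i i j k hi hjk hk, prod2 i i j k hi hjk hk, hZWr i j k hi hjk hk]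
      simp only [add_mul, smul_mul_assoc, smul_add, smul_smul, inv_mul_cancel_left₀ hq]
  · rintro (_ | i) (_ | l) j hil hl hj
    · omega
    · rw [hX0, hXZ, ← mul_assoc, huZ l j j (by omega) le_rfl hj, smul_mul_assoc]
    · omega
    · rw [hXZ, hXZ, mul_assoc, ← mul_assoc (u j : A), huZ l j j (by omega) le_rfl hj,
        mul_assoc (Z l j), ← mul_assoc (u j : A), huZ i j j (by omega) le_rfl hj]
      have h := hZZ i l j (by omega) (by omega) hj
      simp only [smul_mul_assoc, mul_smul_comm, ← mul_assoc]
      rw [h]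
      simp only [smul_mul_assoc]
  · rintro (_ | i) (_ | l) j k hil hl hjk hk
    · omega
    · rw [hX0, hXZ, ← mul_assoc, huZ l j k (by omega) hjk.le hk, smul_mul_assoc, mul_assoc,
        huu j k hjk hk, mul_smul_comm, smul_smul, mul_inv_cancel₀ hq, one_smul, mul_assoc]
    · omega
    · have hl : l < m := by omega
      have hil : i < l := by omega
      rw [hXZ, hXZ, prod2 i l j k hl hjk hk, prod1 l i j k (by omega) hjk hk, add_mul,
        hZZ i l j hil hl (by omega), hWZ i l j k hil hl hjk hk]
  · rintro (_ | i) (_ | l) j k hil hl hjk hk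
    · omega
    · have hl : l < m := by omega
      have e1 : (u j : A) * (Z l k * u k)
          = ((q : K) • Z l j + (q : K)⁻¹ • W l j k) * (u j * u k) := by
        rw [hZW l j k hjk, ← mul_assoc, mul_add, huZ l j j hl le_rfl (by omega), huW l j k hl hjk hk]
        simp only [add_mul, smul_mul_assoc, mul_assoc]
      have e2 : (Z l k * u k) * u j = (q : K)⁻¹ • ((Z l j + W l j k) * (u j * u k)) := by
        rw [mul_assoc, huu j k hjk hk, mul_smul_comm, hZW l j k hjk]
      have e3 : (u k : A) * (Z l j * u j) = Z l j * (u j * u k) := by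
        rw [← mul_assoc, huZ l j k hl hjk.le hk, smul_mul_assoc, mul_assoc, huu j k hjk hk,
          mul_smul_comm, smul_smul, mul_inv_cancel₀ hq, one_smul]
      rw [hX0, hX0, hXZ, hXZ, e1, e2, e3]
      simp only [add_mul, smul_mul_assoc]
      module
    · omega
    · have hl : l < m := by omega
      have hil : i < l := by omega
      rw [hXZ, hXZ, hXZ, hXZ, prod1 i l j k hl hjk hk, prod2 l i j k (by omega) hjk hk,
        prod2 i l j k hl hjk hk, hZW' i l j k hil hl hjk hk]
      simp only [add_mul, smul_mul_assoc, smul_add, hZZ i l j hil hl (hjk.trans hk)]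
      match_scalars <;> field_simp
      ring

end AddRow

/-! ### Path sums in an infinite grid -/

section PathSums

variable {K : Type u} [Field K] {q : Kˣ} {A : Type v} [Ring A] [Algebra K A] {m n : ℕ}

/-- The sum of the weights of the paths that use the rows `p, …, p + d` and the columns
`c, …, c + e`, start at the left end of the row `p + d` and leave the column `c + e` downwards. -/
def pathSum (w : ℕ → ℕ → Aˣ) : ℕ → ℕ → ℕ → ℕ → A
  | 0, p, c, e => w p (e + c)
  | d + 1, p, c, e => ∑ b ∈ Finset.range (e + 1),
      pathSum w d (p + 1) c b * ((w p (b + c))⁻¹ * w p (e + c) : Aˣ)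

variable (w : ℕ → ℕ → Aˣ)

theorem pathSum_zero (p c e : ℕ) : pathSum w 0 p c e = w p (e + c) := rfl

theorem pathSum_succ (d p c e : ℕ) : pathSum w (d + 1) p c e = ∑ b ∈ Finset.range (e + 1),
    pathSum w d (p + 1) c b * ((w p (b + c))⁻¹ * w p (e + c) : Aˣ) := rfl

theorem pathSum_zero_right (d p c : ℕ) : pathSum w d p c 0 = w (p + d) c := by
  induction d generalizing p with
  | zero => simp [pathSum]
  | succ d ih =>
    rw [pathSum, Finset.sum_range_one, ih, inv_mul_cancel, Units.val_one, mul_one]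
    congr 2; omega

/-- The last vertex, in row `p` and column `c + e + 1`, is entered either horizontally or from row
`p + 1`. -/
theorem pathSum_last_step (d p c e : ℕ) :
    pathSum w (d + 1) p c (e + 1)
      = pathSum w (d + 1) p c e * ((w p (e + c))⁻¹ * w p (e + 1 + c) : Aˣ)
        + pathSum w d (p + 1) c (e + 1) := by
  rw [pathSum, Finset.sum_range_succ, inv_mul_cancel, Units.val_one, mul_one]
  congr 1
  rw [pathSum, Finset.sum_mul]
  refine Finset.sum_congr rfl fun b _ => ?_
  rw [mul_assoc, ← Units.val_mul]
  congr 2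
  group

/-- A path first steps down, where the factor in front replaces the initial weight of row `p + d` by
that of row `p + d + 1`, or right, where the weights `w(p+d+1, c)` cancel. -/
theorem pathSum_first_step (d p c e : ℕ) :
    pathSum w (d + 1) p c (e + 1)
      = (w (p + d + 1) c * (w (p + d) c)⁻¹ : Aˣ) * pathSum w d p c (e + 1)
        + pathSum w (d + 1) p (c + 1) e := by
  induction d generalizing p e with
  | zero =>
    rw [pathSum_succ w 0 p c (e + 1), Finset.sum_range_succ', add_comm]
    congr 1
    · simp [pathSum, mul_assoc]
    · rw [pathSum_succ w 0 p (c + 1) e]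
      refine Finset.sum_congr rfl fun b _ => ?_
      simp only [pathSum, Nat.add_right_comm _ 1 c, Nat.add_assoc]
  | succ d ih =>
    rw [pathSum_succ w (d + 1) p c (e + 1), Finset.sum_range_succ']
    simp only [ih (p + 1), add_mul, Finset.sum_add_distrib]
    rw [add_right_comm]
    congr 1
    · conv_rhs => rw [pathSum_succ w d p c (e + 1), Finset.sum_range_succ', mul_add, Finset.mul_sum]
      congr 1
      · refine Finset.sum_congr rfl fun b _ => ?_
        rw [mul_assoc, show p + 1 + d + 1 = p + (d + 1) + 1 by omega,
          show p + 1 + d = p + (d + 1) by omega]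
      · rw [pathSum_zero_right, pathSum_zero_right,
          show p + 1 + (d + 1) = p + (d + 1) + 1 by omega, show p + 1 + d = p + (d + 1) by omega]
        simp only [← Units.val_mul]
        congr 1
        group
    · rw [pathSum_succ w (d + 1) p (c + 1) e]
      refine Finset.sum_congr rfl fun b _ => ?_
      rw [Nat.add_right_comm b 1 c, Nat.add_right_comm e 1 c, Nat.add_assoc b, Nat.add_assoc e]

variable {w}

/-- Path weights alternate vertex weights and their inverses. If the exponent splits into a row part
and a column part, it telescopes to the starting row and the final column, the same for all paths.
-/
theorem QComm.pathSum {x : A} {e₁ e₂ : ℕ → ℤ} {d p c e : ℕ}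
    (h : ∀ i b, p ≤ i → i ≤ p + d → c ≤ b → b ≤ e + c → QComm q (e₁ i + e₂ b) x (w i b)) :
    QComm q (e₁ (p + d) + e₂ (e + c)) x (pathSum w d p c e) := by
  induction d generalizing p e with
  | zero => exact h _ _ le_rfl le_rfl (by omega) le_rfl
  | succ d ih =>
    rw [QuantumMinors.pathSum]
    refine QComm.sum_right fun b hb => ?_
    have hb := Finset.mem_range.mp hb
    have h1 := ih (p := p + 1) (e := b) fun i b' h1 h2 h3 h4 =>
      h i b' (by omega) (by omega) h3 (by omega)
    have h2 := h p (b + c) le_rfl (by omega) (by omega) (by omega)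
    have h3 := h p (e + c) le_rfl (by omega) (by omega) le_rfl
    rw [Units.val_mul]
    refine (h1.mul_right (h2.inv_right.mul_right h3)).congr ?_
    rw [show p + 1 + d = p + (d + 1) by omega]
    ring

/-- The exponent of the relation between the weights of the vertices `(i, j)` and `(k, l)`. -/
def gridExp (i j k l : ℕ) : ℤ :=
  (if i = k then (if j < l then 1 else if l < j then -1 else 0) else 0) +
    (if j = l then (if i < k then 1 else if k < i then -1 else 0) else 0)

/-- Induction on the number of rows, adding row `p` next to the sinks. By telescoping, `w p j` sees
a path sum over the higher rows only through its final column. -/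
theorem fineOn_pathSum {M : ℕ} (hw : ∀ i j k l, i < M → j < n → k < M → l < n →
      QComm q (gridExp i j k l) (w i j : A) (w k l)) (p : ℕ) (hp : p + m ≤ M) :
    FineOn q m n fun i j => pathSum w i p 0 j := by
  induction m generalizing p with
  | zero => constructor <;> intros <;> omega
  | succ m ih =>
    refine (ih (p + 1) (by omega)).addRow (w p) ?_ ?_ (fun j => rfl) (fun i j => rfl)
    · intro j k hjk hk
      refine (hw p j p k (by omega) (by omega) (by omega) hk).congr ?_
      rw [gridExp, if_pos rfl, if_pos hjk, if_neg hjk.ne, add_zero]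
    · intro i j b hi hj hb
      refine (QComm.pathSum (e₁ := 0) (e₂ := fun b => if j = b then 1 else 0)
        fun k l h1 h2 h3 h4 => ?_).congr (zero_add _)
      refine (hw p j k l (by omega) hj (by omega) (by omega)).congr ?_
      rw [gridExp, if_neg (by omega), if_pos (show p < k by omega)]
      rfl

/-! ### Weights defined by products along diagonals -/

/-- The exponent of the relation between the values at two pressed double intervals with the last
rows `i`, `k` and the last columns `j`, `l`. -/
def diagExp (i j k l : ℕ) : ℤ :=
  if (j : ℤ) - i < l - k then
    max 0 (min (i : ℤ) k - max 0 ((i : ℤ) - j)) - max 0 (min (j : ℤ) l - max 0 ((l : ℤ) - k))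
  else if (l : ℤ) - k < j - i then
    max 0 (min (j : ℤ) l - max 0 ((j : ℤ) - i)) - max 0 (min (i : ℤ) k - max 0 ((k : ℤ) - l))
  else 0

theorem diagExp_of_lt {i j k l : ℕ} (h : (j : ℤ) - i < l - k) : diagExp i j k l =
    max 0 (min (i : ℤ) k - max 0 ((i : ℤ) - j)) - max 0 (min (j : ℤ) l - max 0 ((l : ℤ) - k)) := if_pos h

theorem diagExp_of_gt {i j k l : ℕ} (h : (l : ℤ) - k < j - i) : diagExp i j k l =
    max 0 (min (j : ℤ) l - max 0 ((j : ℤ) - i)) - max 0 (min (i : ℤ) k - max 0 ((k : ℤ) - l)) := by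
  rw [diagExp, if_neg h.not_gt, if_pos h]

theorem diagExp_of_eq {i j k l : ℕ} (h : (j : ℤ) - i = l - k) : diagExp i j k l = 0 := by
  rw [diagExp, if_neg h.not_lt, if_neg h.not_gt]

/-- The mixed second difference of `min i k` is the Kronecker delta; the hypothesis keeps the
truncation at `0` from affecting it. -/
theorem mixed_difference {i k x : ℤ} (h : x ≤ i ∨ x ≤ k) :
    -(-max 0 (min i k - x) + max 0 (min i (k + 1) - x)) +
      (-max 0 (min (i + 1) k - x) + max 0 (min (i + 1) (k + 1) - x)) = if i = k then 1 else 0 := by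
  split_ifs <;> omega

/-- The weight of the vertex `(i, j)`, given the products along the diagonals. -/
def diagWeight (y : ℕ → ℕ → Aˣ) (i j : ℕ) : Aˣ := (y i j)⁻¹ * y (i + 1) (j + 1)

theorem mul_diagWeight (y : ℕ → ℕ → Aˣ) (i j : ℕ) :
    (y i j : A) * diagWeight y i j = y (i + 1) (j + 1) := by
  rw [diagWeight, Units.val_mul, Units.mul_inv_cancel_left]

/-- The quasi-commutation relations between products along diagonals. -/
structure DiagQComm (q : Kˣ) (m n : ℕ) (y : ℕ → ℕ → Aˣ) : Prop where
  zero_left : ∀ j, y 0 j = 1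
  zero_right : ∀ i, y i 0 = 1
  comm : ∀ i j k l, i ≤ m → j ≤ n → k ≤ m → l ≤ n → QComm q (diagExp i j k l) (y i j : A) (y k l)

variable {y : ℕ → ℕ → Aˣ}

theorem DiagQComm.comm_weight (hy : DiagQComm q m n y) {i j k l : ℕ} (hi : i ≤ m) (hj : j ≤ n)
    (hk : k < m) (hl : l < n) :
    QComm q (-diagExp i j k l + diagExp i j (k + 1) (l + 1)) (y i j : A) (diagWeight y k l) := by
  rw [diagWeight, Units.val_mul]
  exact (hy.comm i j k l hi hj hk.le hl.le).inv_right.mul_right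
    (hy.comm i j (k + 1) (l + 1) hi hj hk hl)

theorem DiagQComm.weight_comm (hy : DiagQComm q m n y) (i j k l : ℕ) (hi : i < m) (hj : j < n)
    (hk : k < m) (hl : l < n) :
    QComm q (gridExp i j k l) (diagWeight y i j : A) (diagWeight y k l) := by
  have h := (hy.comm_weight hi.le hj.le hk hl).inv_left.mul_left
    (hy.comm_weight (show i + 1 ≤ m from hi) (show j + 1 ≤ n from hj) hk hl)
  rw [← Units.val_mul] at h
  refine h.congr ?_
  have e : ∀ x y : ℕ, ((y + 1 : ℕ) : ℤ) - ((x + 1 : ℕ) : ℤ) = y - x := fun x y => by push_cast; ring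
  -- A diagonal step preserves `j - i`, so all four exponents fall into the same branch of
  -- `diagExp`, and `mixed_difference` turns their combination into Kronecker deltas in rows and in
  -- columns.
  rcases lt_trichotomy ((j : ℤ) - i) (l - k) with hd | hd | hd
  · have h1 := mixed_difference (i := i) (k := k) (x := max 0 ((i : ℤ) - j)) (by omega)
    have h2 := mixed_difference (i := j) (k := l) (x := max 0 ((l : ℤ) - k)) (by omega)
    rw [diagExp_of_lt hd, diagExp_of_lt (by rwa [e]), diagExp_of_lt (by rwa [e]),
      diagExp_of_lt (by rwa [e, e]), e, e]
    push_cast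
    have h3 : gridExp i j k l = (if (i : ℤ) = k then 1 else 0) - if (j : ℤ) = l then 1 else 0 := by
      rw [gridExp]; split_ifs <;> omega
    rw [h3, ← h1, ← h2]
    ring
  · rw [diagExp_of_eq hd, diagExp_of_eq (by rwa [e]), diagExp_of_eq (by rwa [e]),
      diagExp_of_eq (by rwa [e, e]), gridExp]
    split_ifs <;> omega
  · have h1 := mixed_difference (i := j) (k := l) (x := max 0 ((j : ℤ) - i)) (by omega)
    have h2 := mixed_difference (i := i) (k := k) (x := max 0 ((k : ℤ) - l)) (by omega)
    rw [diagExp_of_gt hd, diagExp_of_gt (by rwa [e]), diagExp_of_gt (by rwa [e]),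
      diagExp_of_gt (by rwa [e, e]), e, e]
    push_cast
    have h3 : gridExp i j k l = (if (j : ℤ) = l then 1 else 0) - if (i : ℤ) = k then 1 else 0 := by
      rw [gridExp]; split_ifs <;> omega
    rw [h3, ← h1, ← h2]
    ring

end PathSums

/-! ### Pressed minors of the path matrix -/

section PressedMinors

variable {K : Type u} [Field K] {q : Kˣ} {A : Type v} [Ring A] [Algebra K A] {m n : ℕ}
  {y : ℕ → ℕ → Aˣ}

/-- The matrix of path sums from all sources to all sinks. -/
def pathSumMatrix (m n : ℕ) (w : ℕ → ℕ → Aˣ) : Matrix (Fin m) (Fin n) A :=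
  fun i j => pathSum w i 0 0 j

theorem DiagQComm.isFine (hy : DiagQComm q m n y) :
    IsFine q (pathSumMatrix m n (diagWeight y)) :=
  (fineOn_pathSum hy.weight_comm 0 (by omega)).isFine

theorem insert_seg_right {a k : ℕ} (x : Fin n) (hx : (x : ℕ) = a + k) :
    insert x (seg n a k) = seg n a (k + 1) := by
  ext z; simp only [Finset.mem_insert, mem_seg, Fin.ext_iff]; omega

theorem insert_seg_left {a k : ℕ} (x : Fin n) (hx : (x : ℕ) = a) :
    insert x (seg n (a + 1) k) = seg n a (k + 1) := by
  ext z; simp only [Finset.mem_insert, mem_seg, Fin.ext_iff]; omega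

/-- The second assertion with `d = 0` gives the first one for `k + 1`, since weights telescope along
diagonals. Conversely, Dodgson's relation on the rows `k`, `i` and the columns `b`, `b + k + 1`
determines the next minor up to the invertible right factor `y k (b + k + 1)`. -/
theorem DiagQComm.minor_first_rows (hy : DiagQComm q m n y) (k : ℕ) :
    (∀ b, k ≤ m → b + k ≤ n →
      minor q (pathSumMatrix m n (diagWeight y)) (seg m 0 k) (seg n b k) = y k (b + k)) ∧
    ∀ (i : Fin m) (d b : ℕ), (i : ℕ) = k + d → b + k < n →
      minor q (pathSumMatrix m n (diagWeight y)) (insert i (seg m 0 k)) (seg n b (k + 1))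
        = y k (b + k) * pathSum (diagWeight y) d k 0 (b + k) := by
  have hX := hy.isFine
  set X := pathSumMatrix m n (diagWeight y) with hXdef
  induction k with
  | zero =>
    constructor
    · intro b _ _
      rw [seg_zero, seg_zero, minor_empty, hy.zero_left, Units.val_one]
    · intro i d b hi hb
      have e : seg n b 1 = {⟨b, hb⟩} := by
        ext z; simp only [mem_seg, Finset.mem_singleton, Fin.ext_iff]; omega
      rw [seg_zero, e, insert_empty_eq, minor_singleton, hy.zero_left, Units.val_one, one_mul,
        hXdef, pathSumMatrix, hi, zero_add]
      rfl
  | succ k ih =>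
    obtain ⟨ih1, ih2⟩ := ih
    have first : ∀ b, k + 1 ≤ m → b + (k + 1) ≤ n →
        minor q X (seg m 0 (k + 1)) (seg n b (k + 1)) = y (k + 1) (b + (k + 1)) := by
      intro b hk hb
      have h := ih2 ⟨k, hk⟩ 0 b rfl (by omega)
      rwa [insert_seg_right _ (by simp), pathSum_zero, add_zero, mul_diagWeight] at h
    refine ⟨first, fun i d b hi hb => ?_⟩
    set w := diagWeight y with hw
    set kk : Fin m := ⟨k, by omega⟩ with hkk
    set l : Fin n := ⟨b + 1 + k, by omega⟩ with hl
    set l' : Fin n := ⟨b, by omega⟩ with hl'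
    have hdod := minor_dodgson hX (S := seg m 0 k) (T := seg n (b + 1) k) (i := kk) (k := i)
      (j := l') (l := l) (by rw [card_seg, card_seg] <;> omega)
      (by rw [Fin.lt_def]; simp only [hkk]; omega) (by rw [Fin.lt_def]; simp only [hl, hl']; omega)
      (by rw [mem_seg]; simp only [hkk]; omega) (by rw [mem_seg]; omega)
      (by rw [mem_seg]; simp only [hl']; omega) (by rw [mem_seg]; simp only [hl]; omega)
    rw [Finset.insert_comm kk i, insert_seg_right kk (by simp [hkk]), insert_seg_right l rfl,
      insert_seg_left l' rfl, insert_seg_left l' rfl, first b (by omega) (by omega),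
      ih2 i (d + 1) (b + 1) (by omega) (by omega), ih1 (b + 1) (by omega) (by omega),
      first (b + 1) (by omega) (by omega), ih2 i (d + 1) b (by omega) (by omega),
      show b + 1 + k = b + k + 1 by omega, show b + 1 + (k + 1) = b + k + 1 + 1 by omega,
      pathSum_last_step, ← mul_diagWeight y k (b + k + 1), ← hw] at hdod
    rw [show b + (k + 1) = b + k + 1 by omega] at *
    have hF : FineOn q (m - k) n fun i j => pathSum w i k 0 j :=
      fineOn_pathSum hy.weight_comm k (by omega)
    have hαP : (w k (b + k) : A) * pathSum w (d + 1) k 0 (b + k)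
        = (q : K) • (pathSum w (d + 1) k 0 (b + k) * w k (b + k)) :=
      hF.col 0 (d + 1) (b + k) (by omega) (by omega) (by omega)
    have hβP : (w k (b + k + 1) : A) * pathSum w (d + 1) k 0 (b + k)
        = pathSum w (d + 1) k 0 (b + k) * w k (b + k + 1) :=
      hF.anti 0 (d + 1) (b + k) (b + k + 1) (by omega) (by omega) (by omega) (by omega)
    have hya : (y (k + 1) (b + k + 1) : A) * y k (b + k + 1)
        = y k (b + k + 1) * y (k + 1) (b + k + 1) := by
      refine ((hy.comm (k + 1) (b + k + 1) k (b + k + 1) (by omega) (by omega) (by omega)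
        (by omega)).congr ?_).commute
      rw [diagExp]; push_cast; split_ifs <;> omega
    have hbβ : (y k (b + k) : A) * w k (b + k + 1) = w k (b + k + 1) * y k (b + k) := by
      refine ((hy.comm_weight (i := k) (j := b + k) (k := k) (l := b + k + 1) (by omega) (by omega)
        (by omega) (by omega)).congr ?_).commute
      simp only [diagExp]; push_cast; split_ifs <;> omega
    have haQ : (y k (b + k + 1) : A) * pathSum w d (k + 1) 0 (b + k + 1)
        = pathSum w d (k + 1) 0 (b + k + 1) * y k (b + k + 1) := by
      -- Only the final column matters, and `b + k + 1` lies just beyond the window in which the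
      -- exponent is `1`.
      refine ((QComm.pathSum (q := q) (e₁ := 0)
        (e₂ := fun c => if b + 1 ≤ c ∧ c ≤ b + k then 1 else 0) ?_).congr ?_).commute
      · intro r c h1 h2 h3 h4
        refine (hy.comm_weight (i := k) (j := b + k + 1) (k := r) (l := c) (by omega) (by omega)
          (by omega) (by omega)).congr ?_
        simp only [diagExp, Pi.zero_apply]; push_cast; split_ifs <;> omega
      · rw [if_neg (by omega)]; rfl
    have hα : (y k (b + k) : A) * w k (b + k) = y (k + 1) (b + k + 1) := mul_diagWeight y k (b + k)
    generalize hP : pathSum w (d + 1) k 0 (b + k) = P at *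
    generalize hQ : pathSum w d (k + 1) 0 (b + k + 1) = Q at *
    simp only [add_zero] at hdod
    -- The horizontal part of the last-step recursion equals the `q`-term of Dodgson's relation.
    -- After cancellation the vertical part is the new minor times a unit.
    have hmain : (y (k + 1) (b + k + 1) : A) * (y k (b + k + 1) *
        (P * ((w k (b + k))⁻¹ * w k (b + k + 1) : Aˣ)))
        = (q : K) • (y k (b + k + 1) * w k (b + k + 1) * (y k (b + k) * P)) := by
      have e1 : (y (k + 1) (b + k + 1) : A) * P * ((w k (b + k))⁻¹ : Aˣ)
          = (q : K) • (y k (b + k) * P) := by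
        rw [← hα, mul_assoc (y k (b + k) : A), hαP, mul_smul_comm, smul_mul_assoc, ← mul_assoc,
          Units.mul_inv_cancel_right]
      rw [← mul_assoc, hya, Units.val_mul, mul_assoc, ← mul_assoc P, ← mul_assoc _ (P * _),
        ← mul_assoc _ P, e1, smul_mul_assoc, mul_smul_comm, mul_assoc (y k (b + k) : A), ← hβP,
        ← mul_assoc (y k (b + k) : A), hbβ]
      simp only [mul_assoc]
    rw [mul_add, mul_add, hmain, add_comm] at hdod
    have h2 := add_right_cancel hdod
    rw [haQ, ← mul_assoc] at h2
    exact (Units.mul_left_inj _).mp h2.symm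

/-- The analogue for initial columns uses the first step of a path. It is not a formal
transposition: only horizontal edges carry nontrivial weights. -/
theorem DiagQComm.minor_first_cols (hy : DiagQComm q m n y) (k : ℕ) :
    (∀ a, k ≤ n → a + k ≤ m →
      minor q (pathSumMatrix m n (diagWeight y)) (seg m a k) (seg n 0 k) = y (a + k) k) ∧
    ∀ (j : Fin n) (e a : ℕ), (j : ℕ) = k + e → a + k < m →
      minor q (pathSumMatrix m n (diagWeight y)) (seg m a (k + 1)) (insert j (seg n 0 k))
        = y (a + k) k * pathSum (diagWeight y) (a + k) 0 k e := by
  have hX := hy.isFine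
  set X := pathSumMatrix m n (diagWeight y) with hXdef
  induction k with
  | zero =>
    constructor
    · intro b _ _
      rw [seg_zero, seg_zero, minor_empty, hy.zero_right, Units.val_one]
    · intro j e a hj ha
      have e : seg m a 1 = {⟨a, ha⟩} := by
        ext z; simp only [mem_seg, Finset.mem_singleton, Fin.ext_iff]; omega
      rw [seg_zero, e, insert_empty_eq, minor_singleton, hy.zero_right, Units.val_one, one_mul,
        hXdef, pathSumMatrix, hj, zero_add]
      rfl
  | succ k ih =>
    obtain ⟨ih1, ih2⟩ := ih
    have first : ∀ a, k + 1 ≤ n → a + (k + 1) ≤ m →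
        minor q X (seg m a (k + 1)) (seg n 0 (k + 1)) = y (a + (k + 1)) (k + 1) := by
      intro a hk ha
      have h := ih2 ⟨k, hk⟩ 0 a rfl (by omega)
      rwa [insert_seg_right _ (by simp), pathSum_zero_right, zero_add, mul_diagWeight] at h
    refine ⟨first, fun j e a hj ha => ?_⟩
    set w := diagWeight y with hw
    set kk : Fin n := ⟨k, by omega⟩ with hkk
    set l : Fin m := ⟨a + 1 + k, by omega⟩ with hl
    set l' : Fin m := ⟨a, by omega⟩ with hl'
    have hdod := minor_dodgson hX (S := seg m (a + 1) k) (T := seg n 0 k) (i := l') (k := l)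
      (j := kk) (l := j) (by rw [card_seg, card_seg] <;> omega)
      (by rw [Fin.lt_def]; simp only [hl, hl']; omega) (by rw [Fin.lt_def]; simp only [hkk]; omega)
      (by rw [mem_seg]; simp only [hl']; omega) (by rw [mem_seg]; simp only [hl]; omega)
      (by rw [mem_seg]; simp only [hkk]; omega) (by rw [mem_seg]; omega)
    rw [Finset.insert_comm kk j, insert_seg_right kk (by simp [hkk]), insert_seg_right l rfl,
      insert_seg_left l' rfl, insert_seg_left l' rfl, first a (by omega) (by omega),
      ih2 j (e + 1) (a + 1) (by omega) (by omega), ih1 (a + 1) (by omega) (by omega),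
      first (a + 1) (by omega) (by omega), ih2 j (e + 1) a (by omega) (by omega),
      show a + 1 + k = a + k + 1 by omega, show a + 1 + (k + 1) = a + k + 1 + 1 by omega,
      pathSum_first_step, ← mul_diagWeight y (a + k + 1) k, ← hw] at hdod
    rw [show a + (k + 1) = a + k + 1 by omega] at *
    have hβα : (w (a + k) k : A) * w (a + k + 1) k = (q : K) • (w (a + k + 1) k * w (a + k) k : A) := by
      have h := hy.weight_comm (a + k) k (a + k + 1) k (by omega) (by omega) (by omega) (by omega)
      rw [gridExp, if_neg (by omega), if_pos rfl, if_pos (by omega), zero_add, QComm, qpow_one] at h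
      exact h
    have hβP : (w (a + k + 1) k : A) * pathSum w (a + k) 0 k (e + 1)
        = pathSum w (a + k) 0 k (e + 1) * w (a + k + 1) k := by
      refine ((QComm.pathSum (q := q) (e₁ := 0)
        (e₂ := fun c => if c = k then -1 else 0) ?_).congr ?_).commute
      · intro r c h1 h2 h3 h4
        refine (hy.weight_comm (a + k + 1) k r c (by omega) (by omega) (by omega)
          (by omega)).congr ?_
        simp only [gridExp, Pi.zero_apply]; split_ifs <;> omega
      · rw [if_neg (by omega)]; rfl
    have hya : (y (a + k + 1) (k + 1) : A) * y (a + k + 1) k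
        = y (a + k + 1) k * y (a + k + 1) (k + 1) := by
      refine ((hy.comm (a + k + 1) (k + 1) (a + k + 1) k (by omega) (by omega) (by omega)
        (by omega)).congr ?_).commute
      rw [diagExp]; push_cast; split_ifs <;> omega
    have hab : (y (a + k + 1) k : A) * (y (a + k) k * pathSum w (a + k) 0 k (e + 1))
        = (y (a + k) k * pathSum w (a + k) 0 k (e + 1)) * y (a + k + 1) k := by
      refine (((hy.comm (a + k + 1) k (a + k) k (by omega) (by omega) (by omega)
        (by omega)).mul_right (QComm.pathSum (q := q) (e₂ := 0)
        (e₁ := fun r => if a + 1 ≤ r ∧ r ≤ a + k then 1 else 0) ?_)).congr ?_).commute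
      · intro r c h1 h2 h3 h4
        refine (hy.comm_weight (i := a + k + 1) (j := k) (k := r) (l := c) (by omega) (by omega)
          (by omega) (by omega)).congr ?_
        simp only [diagExp, Pi.zero_apply]; push_cast; split_ifs <;> omega
      · simp only [diagExp, Pi.zero_apply]; push_cast; split_ifs <;> omega
    have haQ : (y (a + k + 1) k : A) * pathSum w (a + k + 1) 0 (k + 1) e
        = pathSum w (a + k + 1) 0 (k + 1) e * y (a + k + 1) k := by
      refine ((QComm.pathSum (q := q) (e₂ := 0)
        (e₁ := fun r => if a + 1 ≤ r ∧ r ≤ a + k then 1 else 0) ?_).congr ?_).commute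
      · intro r c h1 h2 h3 h4
        refine (hy.comm_weight (i := a + k + 1) (j := k) (k := r) (l := c) (by omega) (by omega)
          (by omega) (by omega)).congr ?_
        simp only [diagExp, Pi.zero_apply]; push_cast; split_ifs <;> omega
      · rw [if_neg (by omega)]; rfl
    have hα : (y (a + k) k : A) * w (a + k) k = y (a + k + 1) (k + 1) := mul_diagWeight y (a + k) k
    simp only [zero_add] at hdod
    generalize hP : pathSum w (a + k) 0 k (e + 1) = P at *
    generalize hQ : pathSum w (a + k + 1) 0 (k + 1) e = Q at *
    -- Here the paths that first step down account for the `q`-term, and those that first step right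
    -- remain.
    have hmain : (y (a + k + 1) (k + 1) : A) * (y (a + k + 1) k *
        ((w (a + k + 1) k * (w (a + k) k)⁻¹ : Aˣ) * P))
        = (q : K) • (y (a + k) k * P * (y (a + k + 1) k * w (a + k + 1) k)) := by
      have e1 : (y (a + k + 1) (k + 1) : A) * (w (a + k + 1) k * (w (a + k) k)⁻¹ : Aˣ)
          = (q : K) • (y (a + k) k * w (a + k + 1) k : A) := by
        rw [← hα, Units.val_mul, mul_assoc, ← mul_assoc (w (a + k) k : A), hβα, smul_mul_assoc,
          Units.mul_inv_cancel_right, mul_smul_comm]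
      rw [← mul_assoc, hya, mul_assoc, ← mul_assoc (y (a + k + 1) (k + 1) : A), e1, smul_mul_assoc,
        mul_smul_comm, mul_assoc (y (a + k) k : A), hβP, ← mul_assoc (y (a + k) k : A),
        ← mul_assoc (y (a + k + 1) k : A), hab, mul_assoc (y (a + k) k * P)]
    rw [mul_add, mul_add, hmain, add_comm] at hdod
    have h2 := add_right_cancel hdod
    rw [haQ, ← mul_assoc] at h2
    exact (Units.mul_left_inj _).mp h2.symm

end PressedMinors

/-! ### The path matrix as a matrix of path sums -/

section GridPaths

variable {A : Type v} [Ring A] {m n : ℕ}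

/-- A function that increases along the edges of the grid. -/
def gridRank (a : GridVertex m n) : ℕ := (a.1.2 : ℕ) + (m - a.1.1)

theorem gridRank_lt {a b : GridVertex m n} (h : IsHEdge a b ∨ IsVEdge a b) :
    gridRank a < gridRank b := by
  have ha := a.1.1.is_le
  rcases h with ⟨h1, _, h2⟩ | ⟨h1, _, h2⟩
  · rw [gridRank, gridRank, h1]; omega
  · rw [gridRank, gridRank, h1]; omega

/-- The sum of the weights of the directed paths from `a` to `b`. -/
noncomputable def gridSum (w : Fin m → Fin n → Aˣ) (a b : GridVertex m n) : A :=
  ∑ P ∈ gridPaths a b, (pathWeight w P.1 : A)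

theorem mem_gridPaths {a b : GridVertex m n} {P : {l : List (GridVertex m n) // l.Nodup}} :
    P ∈ gridPaths a b ↔ P.1.IsChain (fun x y => IsHEdge x y ∨ IsVEdge x y) ∧
      P.1.head? = some a ∧ P.1.getLast? = some b := by
  simp [gridPaths]

theorem gridSum_self (w : Fin m → Fin n → Aˣ) (a : GridVertex m n) : gridSum w a a = 1 := by
  have : gridPaths a a = {⟨[a], List.nodup_singleton a⟩} := by
    ext ⟨l, hl⟩
    rw [mem_gridPaths, Finset.mem_singleton, Subtype.mk.injEq]
    constructor
    · rintro ⟨_, h1, h2⟩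
      cases l with
      | nil => simp at h1
      | cons x l =>
        obtain rfl : x = a := by simpa using h1
        cases l with
        | nil => rfl
        | cons c l =>
          rw [List.getLast?_cons_cons] at h2
          exact absurd (List.mem_of_getLast? h2) (List.nodup_cons.mp hl).1
    · intro h
      subst h
      simp
  rw [gridSum, this, Finset.sum_singleton]
  simp [pathWeight]

theorem gridRank_le_of_isChain {c : GridVertex m n} {l : List (GridVertex m n)}
    (h : (c :: l).IsChain fun x y => IsHEdge x y ∨ IsVEdge x y) :
    ∀ x ∈ c :: l, gridRank c ≤ gridRank x := by
  have h1 : (c :: l).IsChain fun x y => gridRank x < gridRank y := h.imp fun _ _ => gridRank_lt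
  have : IsTrans (GridVertex m n) fun x y => gridRank x < gridRank y :=
    ⟨fun _ _ _ h h' => lt_trans h h'⟩
  have h2 := List.isChain_iff_pairwise.mp h1
  intro x hx
  rcases List.mem_cons.mp hx with rfl | hx
  · exact le_rfl
  · exact ((List.pairwise_cons.mp h2).1 x hx).le

open Classical in
theorem gridSum_step (w : Fin m → Fin n → Aˣ) {a b : GridVertex m n} (hab : a ≠ b) :
    gridSum w a b = ∑ c ∈ Finset.univ.filter (fun c => IsHEdge a c ∨ IsVEdge a c),
      (edgeWeight w a c : A) * gridSum w c b := by
  simp only [gridSum, Finset.mul_sum]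
  rw [Finset.sum_sigma']
  symm
  have hcons : ∀ x ∈ (Finset.univ.filter (fun c => IsHEdge a c ∨ IsVEdge a c)).sigma
      fun c => gridPaths c b, ∃ l, x.2.1 = x.1 :: l := by
    rintro ⟨c, ⟨l, hl⟩⟩ hx
    obtain ⟨_, h2⟩ := Finset.mem_sigma.mp hx
    obtain ⟨_, h3, _⟩ := mem_gridPaths.mp h2
    cases l with
    | nil => simp at h3
    | cons x l =>
      obtain rfl : x = c := by simpa using h3
      exact ⟨l, rfl⟩
  refine Finset.sum_bij (fun x hx => ⟨a :: x.2.1, ?_⟩) ?_ ?_ ?_ ?_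
  · obtain ⟨l, hl⟩ := hcons x hx
    obtain ⟨h1, h2⟩ := Finset.mem_sigma.mp hx
    -- The rank grows along edges, so `a` cannot recur on a path starting at one of its successors.
    refine List.nodup_cons.mpr ⟨fun ha => ?_, x.2.2⟩
    have h3 := (mem_gridPaths.mp h2).1
    rw [hl] at h3 ha
    have h4 := gridRank_le_of_isChain h3 a ha
    have h5 := gridRank_lt (Finset.mem_filter.mp h1).2
    omega
  · intro x hx
    obtain ⟨l, hl⟩ := hcons x hx
    obtain ⟨h1, h2⟩ := Finset.mem_sigma.mp hx
    obtain ⟨h3, _, h5⟩ := mem_gridPaths.mp h2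
    rw [mem_gridPaths]
    simp only
    rw [hl] at h3 h5 ⊢
    exact ⟨List.isChain_cons_cons.mpr ⟨(Finset.mem_filter.mp h1).2, h3⟩, rfl,
      by rw [List.getLast?_cons_cons]; exact h5⟩
  · intro x hx x' hx' h
    obtain ⟨l, hl⟩ := hcons x hx
    obtain ⟨l', hl'⟩ := hcons x' hx'
    obtain ⟨c, P⟩ := x
    obtain ⟨c', P'⟩ := x'
    simp only [Subtype.mk.injEq, List.cons.injEq, true_and] at h
    simp only at hl hl'
    have hc : c = c' := by
      rw [hl, hl'] at h
      exact (List.cons.inj h).1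
    subst hc
    rw [Subtype.ext h]
  · rintro ⟨l, hl⟩ hP
    obtain ⟨h1, h2, h3⟩ := mem_gridPaths.mp hP
    simp only at h1 h2 h3
    cases l with
    | nil => simp at h2
    | cons x l =>
      obtain rfl : x = a := by simpa using h2
      cases l with
      | nil => exact absurd (by simpa using h3) hab
      | cons c l =>
        rw [List.isChain_cons_cons] at h1
        rw [List.getLast?_cons_cons] at h3
        exact ⟨⟨c, ⟨c :: l, (List.nodup_cons.mp hl).2⟩⟩, Finset.mem_sigma.mpr
          ⟨Finset.mem_filter.mpr ⟨Finset.mem_univ _, h1.1⟩, mem_gridPaths.mpr ⟨h1.2, rfl, h3⟩⟩, rfl⟩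
  · intro x hx
    obtain ⟨l, hl⟩ := hcons x hx
    simp only [pathWeight, hl]
    simp

-- Edges never decrease the column; the induction is on the remaining rank.
open Classical in
theorem gridSum_eq_zero (w : Fin m → Fin n → Aˣ) {a b : GridVertex m n} (h : b.1.2 < a.1.2) :
    gridSum w a b = 0 := by
  induction hk : m + n - gridRank a using Nat.strong_induction_on generalizing a with
  | _ k ih =>
    rw [gridSum_step w (by rintro rfl; exact lt_irrefl _ h)]
    refine Finset.sum_eq_zero fun c hc => ?_
    have hc := (Finset.mem_filter.mp hc).2
    have h1 := gridRank_lt hc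
    have h2 : a.1.2 ≤ c.1.2 := by
      rcases hc with hc | hc
      · rw [Fin.le_def, hc.2.2]; omega
      · rw [hc.1]
    have h3 : gridRank c ≤ m + n := by
      rw [gridRank]; have := c.1.2.is_le; omega
    rw [ih _ (by omega) (h.trans_le h2) rfl, mul_zero]

/-- The weights of the inner vertices, extended by `1`. -/
def extendWeight (w : Fin m → Fin n → Aˣ) (i j : ℕ) : Aˣ :=
  if h : i < m ∧ j < n then w ⟨i, h.1⟩ ⟨j, h.2⟩ else 1

theorem extendWeight_of_lt (w : Fin m → Fin n → Aˣ) {i j : ℕ} (hi : i < m) (hj : j < n) :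
    extendWeight w i j = w ⟨i, hi⟩ ⟨j, hj⟩ := dif_pos ⟨hi, hj⟩

/-- The inner vertex `(i + 1, j + 1)`. -/
def innerVertex {i j : ℕ} (hi : i < m) (hj : j < n) : GridVertex m n :=
  ⟨(⟨i + 1, by omega⟩, ⟨j + 1, by omega⟩), fun h => by simp [Prod.ext_iff, Fin.ext_iff] at h⟩

theorem vertexWeight_innerVertex (w : Fin m → Fin n → Aˣ) {i j : ℕ} (hi : i < m) (hj : j < n) :
    vertexWeight w (innerVertex hi hj) = extendWeight w i j := by
  rw [extendWeight_of_lt w hi hj, vertexWeight, dif_pos]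
  · rfl
  · simp [innerVertex, Fin.ext_iff]

/-- The vertex `(i, j + 1)` below the inner vertex `(i + 1, j + 1)`. -/
def lowerVertex {i j : ℕ} (hi : i < m) (hj : j < n) : GridVertex m n :=
  ⟨(⟨i, by omega⟩, ⟨j + 1, by omega⟩), fun h => by simp [Prod.ext_iff, Fin.ext_iff] at h⟩

theorem isHEdge_innerVertex {i j : ℕ} (hi : i < m) (hj : j < n) (c : GridVertex m n) :
    IsHEdge (innerVertex hi hj) c ↔ (c.1.1 : ℕ) = i + 1 ∧ (c.1.2 : ℕ) = j + 2 := by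
  simp only [IsHEdge, innerVertex, Fin.ext_iff, ne_eq]
  simp
  intro _
  exact eq_comm

theorem isVEdge_innerVertex {i j : ℕ} (hi : i < m) (hj : j < n) (c : GridVertex m n) :
    IsVEdge (innerVertex hi hj) c ↔ c = lowerVertex hi hj := by
  simp only [IsVEdge, innerVertex, lowerVertex, Fin.ext_iff, ne_eq, Subtype.ext_iff, Prod.ext_iff]
  simp
  omega

open Classical in
theorem gridSum_innerVertex (w : Fin m → Fin n → Aˣ) {i j : ℕ} (hi : i < m) (hj : j < n)
    (b : Fin n) :
    gridSum w (innerVertex hi hj) (sink m b) = (if h : j + 1 < n then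
      ((extendWeight w i j)⁻¹ * extendWeight w i (j + 1) : Aˣ) *
        gridSum w (innerVertex hi h) (sink m b) else 0) + gridSum w (lowerVertex hi hj) (sink m b) := by
  have hab : innerVertex hi hj ≠ sink m b := by
    intro h
    simp [innerVertex, sink, Subtype.ext_iff, Prod.ext_iff, Fin.ext_iff] at h
  have hV : (edgeWeight w (innerVertex hi hj) (lowerVertex hi hj)) = 1 := by
    rw [edgeWeight, if_neg]
    rw [isHEdge_innerVertex]
    rintro ⟨h, _⟩
    simp [lowerVertex] at h
  rw [gridSum_step w hab]
  simp only [isHEdge_innerVertex, isVEdge_innerVertex]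
  split_ifs with h
  · have hr : ∀ c : GridVertex m n, ((c.1.1 : ℕ) = i + 1 ∧ (c.1.2 : ℕ) = j + 2) ↔
        c = innerVertex hi h := by
      intro c
      simp only [innerVertex, Subtype.ext_iff, Prod.ext_iff, Fin.ext_iff]
    have hne : innerVertex hi h ≠ lowerVertex hi hj := by
      intro h
      simp [innerVertex, lowerVertex, Subtype.ext_iff, Prod.ext_iff, Fin.ext_iff] at h
    have : (Finset.univ.filter fun c : GridVertex m n => ((c.1.1 : ℕ) = i + 1 ∧
        (c.1.2 : ℕ) = j + 2) ∨ c = lowerVertex hi hj) = {innerVertex hi h, lowerVertex hi hj} := by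
      ext c; simp [hr]
    rw [this, Finset.sum_pair hne, hV, Units.val_one, one_mul, edgeWeight,
      if_pos ((isHEdge_innerVertex hi hj _).mpr ((hr _).mpr rfl)), if_neg,
      vertexWeight_innerVertex, vertexWeight_innerVertex]
    simp [innerVertex, Fin.ext_iff]
  · have : (Finset.univ.filter fun c : GridVertex m n => ((c.1.1 : ℕ) = i + 1 ∧
        (c.1.2 : ℕ) = j + 2) ∨ c = lowerVertex hi hj) = {lowerVertex hi hj} := by
      ext c
      have := c.1.2.is_le
      simp
      omega
    rw [this, Finset.sum_singleton, hV, Units.val_one, one_mul, zero_add]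

open Classical in
theorem gridSum_top (w : Fin m → Fin n → Aˣ) {b : Fin n} (j : Fin n) :
    gridSum w (sink m b) (sink m j) = if b = j then 1 else 0 := by
  split_ifs with h
  · rw [h, gridSum_self]
  · rw [gridSum_step, Finset.sum_eq_zero]
    · intro c hc
      rcases (Finset.mem_filter.mp hc).2 with hc | hc
      · exact absurd rfl hc.2.1
      · exact absurd hc.2.2 (by simp [sink])
    · intro h'
      simp [sink, Fin.ext_iff] at h'
      omega

theorem gridSum_innerVertex_self (w : Fin m → Fin n → Aˣ) {i j : ℕ} (hi : i < m) (hj : j < n) :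
    gridSum w (innerVertex hi hj) (sink m ⟨j, hj⟩) = gridSum w (lowerVertex hi hj) (sink m ⟨j, hj⟩) := by
  rw [gridSum_innerVertex]
  split_ifs with h
  · rw [gridSum_eq_zero, mul_zero, zero_add]
    simp [sink, innerVertex, Fin.lt_def]
  · rw [zero_add]

theorem lowerVertex_zero {j : ℕ} (hm : 0 < m) (hj : j < n) :
    lowerVertex hm hj = sink m ⟨j, hj⟩ := rfl

theorem lowerVertex_succ {i j : ℕ} (hi : i + 1 < m) (hj : j < n) :
    lowerVertex hi hj = innerVertex (Nat.lt_of_succ_lt hi) hj := rfl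

theorem gridSum_innerVertex_same_col (w : Fin m → Fin n → Aˣ) {i j : ℕ} (hi : i < m) (hj : j < n) :
    gridSum w (innerVertex hi hj) (sink m ⟨j, hj⟩) = 1 := by
  induction i with
  | zero => rw [gridSum_innerVertex_self, lowerVertex_zero, gridSum_self]
  | succ i ih => rw [gridSum_innerVertex_self, lowerVertex_succ, ih]

/-- The factor in front is what the horizontal edges from the source up to column `c` telescope to.
With it, sums over paths satisfy the first-step recursion of `pathSum`. -/
theorem weight_mul_gridSum (w : Fin m → Fin n → Aˣ) {i c e : ℕ} (hi : i < m) (hj : e + c < n) :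
    extendWeight w i c * gridSum w (innerVertex hi (show c < n by omega)) (sink m ⟨e + c, hj⟩)
      = pathSum (extendWeight w) i 0 c e := by
  induction i generalizing c e with
  | zero =>
    induction e generalizing c with
    | zero =>
      simp only [zero_add]
      rw [gridSum_innerVertex_same_col, mul_one, pathSum_zero, zero_add]
    | succ e ih =>
      rw [gridSum_innerVertex, dif_pos (by omega), lowerVertex_zero, gridSum_top, if_neg, add_zero,
        Units.val_mul, mul_assoc, Units.mul_inv_cancel_left]
      · have h := ih (c := c + 1) (by omega)
        simp only [show e + 1 + c = e + (c + 1) by omega]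
        rw [h, pathSum_zero, pathSum_zero, show e + 1 + c = e + (c + 1) by omega]
      · simp [Fin.ext_iff]
  | succ i ih =>
    induction e generalizing c with
    | zero =>
      simp only [zero_add]
      rw [gridSum_innerVertex_same_col, mul_one, pathSum_zero_right, zero_add]
    | succ e ihe =>
      rw [gridSum_innerVertex, dif_pos (by omega), lowerVertex_succ, mul_add, Units.val_mul,
        mul_assoc, Units.mul_inv_cancel_left, pathSum_first_step, ← ih (by omega) hj, add_comm,
        Units.val_mul, zero_add]
      congr 1
      · rw [mul_assoc, Units.inv_mul_cancel_left]
      · have h := ihe (c := c + 1) (by omega)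
        simp only [show e + 1 + c = e + (c + 1) by omega]
        exact h

open Classical in
theorem pathMatrix_eq_pathSum (w : Fin m → Fin n → Aˣ) :
    pathMatrix w = pathSumMatrix m n (extendWeight w) := by
  ext i j
  have hn : 0 < n := (Nat.zero_le _).trans_lt j.2
  change gridSum w (source n i) (sink m j) = _
  rw [pathSumMatrix, ← weight_mul_gridSum w i.2 (show (j : ℕ) + 0 < n from j.2), gridSum_step]
  · have : (Finset.univ.filter fun c : GridVertex m n => IsHEdge (source n i) c ∨
        IsVEdge (source n i) c) = {innerVertex i.2 hn} := by
      ext c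
      simp only [Finset.mem_filter, Finset.mem_univ, true_and, Finset.mem_singleton, IsHEdge, IsVEdge,
        source, innerVertex, Subtype.ext_iff, Prod.ext_iff, Fin.ext_iff, ne_eq]
      simp
      omega
    rw [this, Finset.sum_singleton, edgeWeight, if_pos,
      if_pos (show (source n i).1.2 = 0 from rfl), vertexWeight_innerVertex]
    · rfl
    · simp [IsHEdge, source, innerVertex, Fin.ext_iff]
  · intro h
    simp [source, sink, Subtype.ext_iff, Prod.ext_iff, Fin.ext_iff] at h

end GridPaths

/-! ### Pressed double intervals and quasi-commutation exponents -/

section Pressed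

variable {m n : ℕ}

theorem IsInitial.eq_zero_of_Icc {a b : Fin n} (hab : a ≤ b) (h : IsInitial (Finset.Icc a b)) :
    (a : ℕ) = 0 := by
  have h0 : (⟨0, by have := a.2; omega⟩ : Fin n) ∈ Finset.Icc a b := by
    rw [h, Fin.card_Icc]
    have := Fin.le_def.mp hab
    simp only
    omega
  exact Nat.le_zero.mp (Fin.le_def.mp (Finset.mem_Icc.mp h0).1)

/-- One side starts at the first index and both have the same size, so the last row and the last
column determine everything. -/
theorem exists_eq_piPInt (c : PInt m n) : ∃ i j, c = piPInt i j := by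
  obtain ⟨⟨I, J, hc⟩, ⟨a, b, hab, hI⟩, ⟨a', b', hab', hJ⟩, h⟩ := c
  simp only at hI hJ h
  subst hI hJ
  have hc' := hc
  rw [Fin.card_Icc, Fin.card_Icc] at hc'
  have h1 := Fin.le_def.mp hab
  have h2 := Fin.le_def.mp hab'
  refine ⟨b, b', ?_⟩
  have key : lower b (min (b : ℕ) b') = a ∧ lower b' (min (b : ℕ) b') = a' := by
    rcases h with h | h
    · have := h.eq_zero_of_Icc hab
      simp only [lower, Fin.ext_iff]; omega
    · have := h.eq_zero_of_Icc hab'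
      simp only [lower, Fin.ext_iff]; omega
  simp only [piPInt, piCortege, key.1, key.2]

theorem numAbove_Icc {a b a' b' : Fin n} (hab : a ≤ b) :
    numAbove (Finset.Icc a b) (Finset.Icc a' b') = (b' : ℕ) + 1 - max (a' : ℕ) (b + 1) := by
  have h : (Finset.Icc a' b').filter (fun x => ∀ y ∈ Finset.Icc a b, y < x)
      = seg n (max (a' : ℕ) (b + 1)) ((b' : ℕ) + 1 - max (a' : ℕ) (b + 1)) := by
    ext x
    rw [Finset.mem_filter, mem_seg, Finset.mem_Icc]
    constructor
    · rintro ⟨⟨h1, h2⟩, h3⟩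
      have := h3 b (Finset.mem_Icc.mpr ⟨hab, le_rfl⟩)
      simp only [Fin.le_def, Fin.lt_def] at *
      omega
    · intro h
      refine ⟨⟨by rw [Fin.le_def]; omega, by rw [Fin.le_def]; omega⟩, fun y hy => ?_⟩
      have := (Finset.mem_Icc.mp hy).2
      simp only [Fin.le_def, Fin.lt_def] at *
      omega
  rw [numAbove, h, card_seg]
  have := b.2
  have := b'.2
  have := a'.2
  omega

theorem numBelow_Icc {a b a' b' : Fin n} (hab : a ≤ b) :
    numBelow (Finset.Icc a b) (Finset.Icc a' b') = min ((b' : ℕ) + 1) a - a' := by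
  have h : (Finset.Icc a' b').filter (fun x => ∀ y ∈ Finset.Icc a b, x < y)
      = seg n a' (min ((b' : ℕ) + 1) a - a') := by
    ext x
    rw [Finset.mem_filter, mem_seg, Finset.mem_Icc]
    constructor
    · rintro ⟨⟨h1, h2⟩, h3⟩
      have := h3 a (Finset.mem_Icc.mpr ⟨le_rfl, hab⟩)
      simp only [Fin.le_def, Fin.lt_def] at *
      omega
    · intro h
      refine ⟨⟨by rw [Fin.le_def]; omega, by rw [Fin.le_def]; omega⟩, fun y hy => ?_⟩
      have := (Finset.mem_Icc.mp hy).1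
      simp only [Fin.le_def, Fin.lt_def] at *
      omega
  rw [numBelow, h, card_seg]
  have := b'.2
  have := a'.2
  omega

theorem card_piCortege (i : Fin m) (j : Fin n) :
    (piCortege i j).rows.card = min (i : ℕ) j + 1 := by
  simp only [piCortege, Fin.card_Icc, lower]; omega

-- Both exponents are piecewise linear in the coordinates of the two ends; the order of the two
-- diagonals selects the branch, and the order of coordinates selects the pressed side. The shifts
-- pass to one-based indices.
set_option maxHeartbeats 1000000 in
theorem qcExp_piCortege {i k : Fin m} {j l : Fin n} (h : min (k : ℕ) l ≤ min (i : ℕ) j) :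
    qcExp (piCortege i j) (piCortege k l) = diagExp (i + 1) (j + 1) (k + 1) (l + 1) := by
  have h1 : lower i (min (i : ℕ) j) ≤ i := by simp only [lower, Fin.le_def]; omega
  have h2 : lower j (min (i : ℕ) j) ≤ j := by simp only [lower, Fin.le_def]; omega
  simp only [qcExp, piCortege]
  rw [numAbove_Icc h1, numAbove_Icc h2, numBelow_Icc h1, numBelow_Icc h2]
  simp only [lower]
  generalize (i : ℕ) = i at *
  generalize (j : ℕ) = j at *
  generalize (k : ℕ) = k at *
  generalize (l : ℕ) = l at *
  clear h1 h2
  rcases lt_trichotomy ((j : ℤ) - i) (l - k) with hd | hd | hd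
  · rw [diagExp_of_lt (by push_cast; omega)]
    rcases le_total i j with h1 | h1 <;> rcases le_total k l with h2 | h2 <;>
    simp only [h1, h2, min_eq_left, min_eq_right] at h ⊢ <;> push_cast <;> omega
  · rw [diagExp_of_eq (by push_cast; omega)]
    rcases le_total i j with h1 | h1 <;> rcases le_total k l with h2 | h2 <;>
    simp only [h1, h2, min_eq_left, min_eq_right] at h ⊢ <;> omega
  · rw [diagExp_of_gt (by push_cast; omega)]
    rcases le_total i j with h1 | h1 <;> rcases le_total k l with h2 | h2 <;>
    simp only [h1, h2, min_eq_left, min_eq_right] at h ⊢ <;> push_cast <;> omega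

theorem diagExp_swap (i j k l : ℕ) : diagExp k l i j = -diagExp i j k l := by
  simp only [diagExp, min_comm (k : ℤ), min_comm (l : ℤ)]
  split_ifs <;> omega

theorem diagExp_zero_left (j k l : ℕ) : diagExp 0 j k l = 0 := by
  simp only [diagExp]; push_cast; split_ifs <;> omega

theorem diagExp_zero_right (i k l : ℕ) : diagExp i 0 k l = 0 := by
  simp only [diagExp]; push_cast; split_ifs <;> omega

end Pressed

/-! ### The extension of a function on pressed double intervals -/

section Extension

variable {K : Type u} [Field K] {q : Kˣ} {A : Type v} [Ring A] [Algebra K A] {m n : ℕ}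

/-- The values at `π(i, j)`, extended by `1` to `i = 0` and `j = 0` (one-based indices). -/
def diagValue (f₀ : PInt m n → Aˣ) : ℕ → ℕ → Aˣ
  | i + 1, j + 1 => if h : i < m ∧ j < n then f₀ (piPInt ⟨i, h.1⟩ ⟨j, h.2⟩) else 1
  | _, _ => 1

theorem diagValue_zero_left (f₀ : PInt m n → Aˣ) (j : ℕ) : diagValue f₀ 0 j = 1 := rfl

theorem diagValue_zero_right (f₀ : PInt m n → Aˣ) (i : ℕ) : diagValue f₀ i 0 = 1 := by
  cases i <;> rfl

theorem diagValue_succ (f₀ : PInt m n → Aˣ) {i j : ℕ} (hi : i < m) (hj : j < n) :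
    diagValue f₀ (i + 1) (j + 1) = f₀ (piPInt ⟨i, hi⟩ ⟨j, hj⟩) := dif_pos ⟨hi, hj⟩

/-- `diagExp` is antisymmetric, which removes the restriction to `|I| ≥ |I'|`, and it vanishes on
the boundary, where the value is set to `1`. -/
theorem QuasiCommutes.diagQComm {f₀ : PInt m n → Aˣ} (hf₀ : QuasiCommutes q f₀) :
    DiagQComm q m n (diagValue f₀) where
  zero_left := diagValue_zero_left f₀
  zero_right := diagValue_zero_right f₀
  comm i j k l hi hj hk hl := by
    rcases i with _ | i
    · rw [diagValue_zero_left, diagExp_zero_left]; exact QComm.one_left _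
    rcases j with _ | j
    · rw [diagValue_zero_right, diagExp_zero_right]; exact QComm.one_left _
    rcases k with _ | k
    · rw [diagValue_zero_left, diagExp_swap, diagExp_zero_left]; exact QComm.one_right _
    rcases l with _ | l
    · rw [diagValue_zero_right, diagExp_swap, diagExp_zero_right]; exact QComm.one_right _
    rw [diagValue_succ f₀ hi hj, diagValue_succ f₀ hk hl]
    rcases le_total (min k l) (min i j) with h | h
    · rw [← qcExp_piCortege (i := ⟨i, hi⟩) (k := ⟨k, hk⟩) (j := ⟨j, hj⟩) (l := ⟨l, hl⟩) h]
      refine hf₀ (piPInt _ _) (piPInt _ _) ?_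
      change (piCortege _ _).rows.card ≤ (piCortege _ _).rows.card
      rw [card_piCortege, card_piCortege]
      exact Nat.succ_le_succ h
    · rw [diagExp_swap,
        ← qcExp_piCortege (i := ⟨k, hk⟩) (k := ⟨i, hi⟩) (j := ⟨l, hl⟩) (l := ⟨j, hj⟩) h]
      refine QComm.symm (hf₀ (piPInt _ _) (piPInt _ _) ?_)
      change (piCortege _ _).rows.card ≤ (piCortege _ _).rows.card
      rw [card_piCortege, card_piCortege]
      exact Nat.succ_le_succ h

theorem innerWeight_eq_diagWeight (f₀ : PInt m n → Aˣ) (i : Fin m) (j : Fin n) :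
    innerWeight f₀ i j = diagWeight (diagValue f₀) i j := by
  rw [innerWeight, diagWeight, diagValue_succ f₀ i.2 j.2]
  split_ifs with h
  · rcases h with h | h
    · have e : diagValue f₀ (i : ℕ) j = 1 := by rw [h]; exact diagValue_zero_left f₀ _
      rw [e, inv_one, one_mul]
    · have e : diagValue f₀ (i : ℕ) j = 1 := by rw [h]; exact diagValue_zero_right f₀ _
      rw [e, inv_one, one_mul]
  · obtain ⟨i, hi⟩ := i
    obtain ⟨j, hj⟩ := j
    rcases i with _ | i
    · exact absurd (Or.inl rfl) h
    rcases j with _ | j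
    · exact absurd (Or.inr rfl) h
    rw [diagValue_succ f₀ (Nat.lt_of_succ_lt hi) (Nat.lt_of_succ_lt hj)]
    rfl

theorem pathSum_congr {w w' : ℕ → ℕ → Aˣ} {d p c e : ℕ}
    (h : ∀ i j, i ≤ p + d → j ≤ e + c → w i j = w' i j) :
    pathSum w d p c e = pathSum w' d p c e := by
  induction d generalizing p e with
  | zero => rw [pathSum_zero, pathSum_zero, h p _ (by omega) le_rfl]
  | succ d ih =>
    rw [pathSum_succ, pathSum_succ]
    refine Finset.sum_congr rfl fun b hb => ?_
    have hb := Finset.mem_range.mp hb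
    rw [ih fun i j hi hj => h i j (by omega) (by omega), h p _ (by omega) (by omega),
      h p _ (by omega) (by omega)]

theorem pathMatrix_innerWeight (f₀ : PInt m n → Aˣ) :
    pathMatrix (innerWeight f₀) = pathSumMatrix m n (diagWeight (diagValue f₀)) := by
  rw [pathMatrix_eq_pathSum]
  ext i j
  refine pathSum_congr fun k l hk hl => ?_
  have h1 : k < m := by have := i.2; omega
  have h2 : l < n := by have := j.2; omega
  rw [extendWeight_of_lt _ h1 h2, innerWeight_eq_diagWeight]

theorem QuasiCommutes.isFine_pathMatrix {f₀ : PInt m n → Aˣ} (hf₀ : QuasiCommutes q f₀) :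
    IsFine q (pathMatrix (innerWeight f₀)) := by
  rw [pathMatrix_innerWeight]
  exact hf₀.diagQComm.isFine

theorem QuasiCommutes.pathExtension_pressed {f₀ : PInt m n → Aˣ} (hf₀ : QuasiCommutes q f₀)
    (c : PInt m n) : pathExtension q f₀ c.1 = f₀ c := by
  obtain ⟨i, j, rfl⟩ := exists_eq_piPInt c
  have hi := i.2
  have hj := j.2
  rw [pathExtension, qMinor_eq_minor, pathMatrix_innerWeight]
  rcases le_total (i : ℕ) j with h | h
  · have e1 : (piPInt i j).1.rows = seg m 0 (i + 1) := by
      ext x; simp only [piPInt, piCortege, Finset.mem_Icc, mem_seg, Fin.le_def, lower]; omega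
    have e2 : (piPInt i j).1.cols = seg n (j - i) (i + 1) := by
      ext x; simp only [piPInt, piCortege, Finset.mem_Icc, mem_seg, Fin.le_def, lower]; omega
    rw [e1, e2, (hf₀.diagQComm.minor_first_rows _).1 _ (by omega) (by omega),
      show (j - i + (i + 1) : ℕ) = j + 1 by omega, diagValue_succ f₀ hi hj]
  · have e1 : (piPInt i j).1.rows = seg m (i - j) (j + 1) := by
      ext x; simp only [piPInt, piCortege, Finset.mem_Icc, mem_seg, Fin.le_def, lower]; omega
    have e2 : (piPInt i j).1.cols = seg n 0 (j + 1) := by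
      ext x; simp only [piPInt, piCortege, Finset.mem_Icc, mem_seg, Fin.le_def, lower]; omega
    rw [e1, e2, (hf₀.diagQComm.minor_first_cols _).1 _ (by omega) (by omega),
      show (i - j + (j + 1) : ℕ) = i + 1 by omega, diagValue_succ f₀ hi hj]

theorem pathExtension_empty (f₀ : PInt m n → Aˣ) :
    pathExtension q f₀ (Cortege.empty m n) = 1 := by
  rw [pathExtension, qMinor_eq_minor]
  exact minor_empty _

end Extension

/-! ### Leading terms of Laurent polynomials over a noncommutative ring -/

section LeadingTerms

open AddMonoidAlgebra

variable {K : Type u} [Field K] {q : Kˣ} {R : Type v} [Ring R] [Algebra K R] {m n : ℕ}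

/-- The Laurent polynomial `p` is `u T ^ d` plus terms of degree less than `d`. -/
def LeadsWith (d : ℤ) (u : R) (p : AddMonoidAlgebra R ℤ) : Prop :=
  ∀ e, d ≤ e → p.coeff e = if e = d then u else 0

theorem leadsWith_single (d : ℤ) (u : R) : LeadsWith d u (single d u) := by
  intro e _
  rw [coeff_single, Finsupp.single_apply]
  simp only [eq_comm]

theorem LeadsWith.of_lt {d d' : ℤ} {u : R} {p : AddMonoidAlgebra R ℤ} (h : LeadsWith d u p)
    (hd : d < d') : LeadsWith d' 0 p := by
  intro e he
  rw [h e (hd.le.trans he), if_neg (by omega), ite_self]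

theorem LeadsWith.add {d : ℤ} {u u' : R} {p p' : AddMonoidAlgebra R ℤ} (h : LeadsWith d u p)
    (h' : LeadsWith d u' p') : LeadsWith d (u + u') (p + p') := by
  intro e he
  rw [coeff_add, Finsupp.add_apply, h e he, h' e he]
  split_ifs <;> simp

theorem leadsWith_zero (d : ℤ) : LeadsWith d (0 : R) 0 := by
  intro e _
  rw [ite_self, coeff_zero, Finsupp.zero_apply]

theorem LeadsWith.sum {ι : Type*} {d : ℤ} {s : Finset ι} {u : ι → R}
    {p : ι → AddMonoidAlgebra R ℤ} (h : ∀ i ∈ s, LeadsWith d (u i) (p i)) :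
    LeadsWith d (∑ i ∈ s, u i) (∑ i ∈ s, p i) := by
  classical
  induction s using Finset.induction_on with
  | empty => exact leadsWith_zero d
  | insert i s hi ih =>
    rw [Finset.sum_insert hi, Finset.sum_insert hi]
    exact (h i (Finset.mem_insert_self i s)).add
      (ih fun j hj => h j (Finset.mem_insert_of_mem hj))

theorem LeadsWith.smul {d : ℤ} {u : R} {p : AddMonoidAlgebra R ℤ} (a : K) (h : LeadsWith d u p) :
    LeadsWith d (a • u) (a • p) := by
  intro e he
  rw [coeff_smul_apply, h e he]
  split_ifs <;> simp

theorem LeadsWith.mul {d d' : ℤ} {u u' : R} {p p' : AddMonoidAlgebra R ℤ} (h : LeadsWith d u p)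
    (h' : LeadsWith d' u' p') : LeadsWith (d + d') (u * u') (p * p') := by
  intro e he
  rw [coeff_mul_apply_left, Finsupp.sum, Finset.sum_eq_single d]
  · rw [h d le_rfl, if_pos rfl, h' _ (by omega)]
    split_ifs <;> first | omega | simp
  · intro f _ hf
    rcases lt_or_gt_of_ne hf with hf | hf
    · rw [h' _ (by omega), if_neg (by omega), mul_zero]
    · rw [h _ hf.le, if_neg (by omega), zero_mul]
  · intro hd
    rw [Finsupp.notMem_support_iff.mp hd, zero_mul]

theorem LeadsWith.list_prod_ofFn {k : ℕ} {d : Fin k → ℤ} {u : Fin k → R}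
    {p : Fin k → AddMonoidAlgebra R ℤ} (h : ∀ t, LeadsWith (d t) (u t) (p t)) :
    LeadsWith (∑ t, d t) (List.ofFn u).prod (List.ofFn p).prod := by
  induction k with
  | zero =>
    simp only [List.ofFn_zero, List.prod_nil, Finset.univ_eq_empty, Finset.sum_empty, one_def]
    exact leadsWith_single 0 1
  | succ k ih =>
    rw [List.ofFn_succ, List.ofFn_succ, List.prod_cons, List.prod_cons, Fin.sum_univ_succ]
    exact (h 0).mul (ih fun t => h t.succ)

theorem exists_leadsWith {p : AddMonoidAlgebra R ℤ} (hp : p ≠ 0) :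
    ∃ (d : ℤ) (u : R), u ≠ 0 ∧ LeadsWith d u p := by
  have hs : p.coeff.support.Nonempty := by
    rw [Finsupp.support_nonempty_iff]
    exact fun h => hp (coeff_eq_zero.mp h)
  refine ⟨p.coeff.support.max' hs, _, Finsupp.mem_support_iff.mp (Finset.max'_mem _ hs),
    fun e he => ?_⟩
  split_ifs with h
  · rw [h]
  · by_contra h0
    exact h (le_antisymm (Finset.le_max' _ _ (Finsupp.mem_support_iff.mpr h0)) he)

/-- The leading coefficient of a product with `b` is a unit times that of `b`, which cannot vanish;
nothing is needed about zerodivisors in `R`. -/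
theorem LeadsWith.not_isZeroDivisor {d : ℤ} {u : Rˣ} {p : AddMonoidAlgebra R ℤ}
    (h : LeadsWith d (u : R) p) : ¬IsZeroDivisor p := by
  rintro ⟨b, hb, hpb⟩
  obtain ⟨e, v, hv, hb⟩ := exists_leadsWith hb
  rcases hpb with h0 | h0
  · have := h.mul hb _ le_rfl
    rw [h0, if_pos rfl] at this
    exact hv (u.isUnit.mul_right_eq_zero.mp this.symm)
  · have := hb.mul h _ le_rfl
    rw [h0, if_pos rfl] at this
    exact hv (u.isUnit.mul_left_eq_zero.mp this.symm)

/-- The unit `u T ^ d`. -/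
noncomputable def homUnit (d : ℤ) (u : Rˣ) : (AddMonoidAlgebra R ℤ)ˣ where
  val := single d (u : R)
  inv := single (-d) ((u⁻¹ : Rˣ) : R)
  val_inv := by rw [single_mul_single, add_neg_cancel, Units.mul_inv, one_def]
  inv_val := by rw [single_mul_single, neg_add_cancel, Units.inv_mul, one_def]

theorem val_homUnit (d : ℤ) (u : Rˣ) :
    (homUnit d u : AddMonoidAlgebra R ℤ) = single d (u : R) := rfl

theorem homUnit_mul (d d' : ℤ) (u u' : Rˣ) :
    homUnit d u * homUnit d' u' = homUnit (d + d') (u * u') :=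
  Units.ext (single_mul_single ..)

theorem homUnit_inv (d : ℤ) (u : Rˣ) : (homUnit d u)⁻¹ = homUnit (-d) u⁻¹ := by
  refine Units.ext ?_
  rfl

/-- The degree of the inner vertex `(i, j)` (in zero-based indices). -/
def vertexDegree (i j : ℕ) : ℤ := 2 * (i * j) + (i + 1) ^ 2 + j

/-- The dominant path runs along its starting row to the final column and then descends, with weight
`w (p + d) e`. -/
theorem leadsWith_pathSum {w : ℕ → ℕ → (AddMonoidAlgebra R ℤ)ˣ} {u : ℕ → ℕ → Rˣ} {d p e : ℕ}
    (h : ∀ i j, i ≤ p + d → j ≤ e → w i j = homUnit (vertexDegree i j) (u i j)) :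
    LeadsWith (vertexDegree (p + d) e) (u (p + d) e : R) (pathSum w d p 0 e) := by
  induction d generalizing p e with
  | zero =>
    rw [pathSum_zero, Nat.add_zero, Nat.add_zero, h p e le_rfl le_rfl]
    exact leadsWith_single _ _
  | succ d ih =>
    rw [pathSum_succ, Finset.sum_range_succ]
    have hlast : LeadsWith (vertexDegree (p + (d + 1)) e) (u (p + (d + 1)) e : R)
        (pathSum w d (p + 1) 0 e * ((w p (e + 0))⁻¹ * w p (e + 0) : (AddMonoidAlgebra R ℤ)ˣ)) := by
      rw [inv_mul_cancel, Units.val_one, mul_one, ← Nat.add_assoc, Nat.add_right_comm]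
      exact ih fun i j hi hj => h i j (by omega) hj
    have hrest : LeadsWith (vertexDegree (p + (d + 1)) e) (∑ b ∈ Finset.range e, (0 : R))
        (∑ b ∈ Finset.range e, pathSum w d (p + 1) 0 b *
          ((w p (b + 0))⁻¹ * w p (e + 0) : (AddMonoidAlgebra R ℤ)ˣ)) := by
      refine LeadsWith.sum fun b hb => ?_
      have hb := Finset.mem_range.mp hb
      rw [Nat.add_zero b, Nat.add_zero e, h p b (by omega) hb.le, h p e (by omega) le_rfl,
        homUnit_inv, homUnit_mul, val_homUnit]
      refine ((ih fun i j hi hj => h i j (by omega) (by omega)).mul (leadsWith_single _ _)).of_lt ?_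
      -- The degree gap is `2 (d + 1) (e - b)`, from the term `2ij`; the terms in `i` alone or `j`
      -- alone cancel.
      simp only [vertexDegree]
      push_cast
      have hb' : (b : ℤ) + 1 ≤ e := by exact_mod_cast hb
      have hd : (0 : ℤ) ≤ d := Int.natCast_nonneg d
      nlinarith [mul_nonneg hd (sub_nonneg.mpr hb')]
    rw [Finset.sum_const_zero] at hrest
    have := hrest.add hlast
    rwa [zero_add] at this

/-- Only the term `2ij` depends on the pairing of rows with columns, so this is the strict
rearrangement inequality. -/
theorem sum_vertexDegree_lt {k : ℕ} {r c : Fin k → ℕ} (hr : StrictMono r) (hc : StrictMono c)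
    {σ : Equiv.Perm (Fin k)} (hσ : σ ≠ 1) :
    ∑ t, vertexDegree (r t) (c (σ t)) < ∑ t, vertexDegree (r t) (c t) := by
  have hmono : Monovary (fun t => (r t : ℤ)) (fun t => (c t : ℤ)) := fun s t hst => by
    have := hc.lt_iff_lt.mp (Nat.cast_lt.mp hst)
    exact Nat.cast_le.mpr (hr this).le
  have key : ∑ t, (r t : ℤ) * c (σ t) < ∑ t, (r t : ℤ) * c t := by
    -- If the inequality were not strict, `σ⁻¹` would be increasing, hence the identity.
    refine (Monovary.sum_mul_comp_perm_lt_sum_mul_iff (σ := σ) hmono).mpr fun hv => hσ ?_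
    have hs : StrictMono (σ⁻¹ : Equiv.Perm (Fin k)) := by
      intro s t hst
      have h1 : r (σ⁻¹ s) ≤ r (σ⁻¹ t) := by
        have := @hv (σ⁻¹ s) (σ⁻¹ t) (by simpa using hc hst)
        exact Nat.cast_le.mp this
      exact lt_of_le_of_ne (hr.le_iff_le.mp h1) fun h => hst.ne (σ⁻¹.injective h)
    have h1 : (σ⁻¹ : Equiv.Perm (Fin k)) = 1 := by
      ext t
      have := (hs.range_inj strictMono_id).mp (by rw [Set.range_id, (σ⁻¹).surjective.range_eq])
      rw [this]; rfl
    exact inv_eq_one.mp h1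
  simp only [vertexDegree, Finset.sum_add_distrib, ← Finset.mul_sum]
  rw [Equiv.sum_comp σ fun t => (c t : ℤ)]
  linarith

theorem invCount_one (k : ℕ) : invCount (1 : Equiv.Perm (Fin k)) = 0 := by
  rw [invCount, Finset.card_eq_zero, Finset.filter_eq_empty_iff]
  rintro ⟨s, t⟩ _ ⟨h1, h2⟩
  exact lt_asymm h1 h2

theorem leadsWith_qMinor {X : Matrix (Fin m) (Fin n) (AddMonoidAlgebra R ℤ)}
    {u : Fin m → Fin n → Rˣ} (h : ∀ (i : Fin m) (j : Fin n), LeadsWith (vertexDegree i j) (u i j : R) (X i j))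
    (c : Cortege m n) : ∃ (d : ℤ) (v : Rˣ), LeadsWith d (v : R) (qMinor q X c) := by
  let r := c.rows.orderEmbOfFin rfl
  let s := c.cols.orderEmbOfFin c.card_eq.symm
  refine ⟨∑ t, vertexDegree (r t) (s t), (List.ofFn fun t => u (r t) (s t)).prod, ?_⟩
  have key : LeadsWith (∑ t, vertexDegree (r t) (s t))
      (∑ σ : Equiv.Perm (Fin c.rows.card),
        if σ = 1 then (List.ofFn fun t => (u (r t) (s t) : R)).prod else 0) (qMinor q X c) := by
    refine LeadsWith.sum fun σ _ => ?_
    have hσ := (LeadsWith.list_prod_ofFn fun t => h (r t) (s (σ t))).smul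
      ((-(q : K)) ^ invCount σ)
    split_ifs with h1
    · subst h1
      simpa only [invCount_one, pow_zero, one_smul, Equiv.Perm.one_apply] using hσ
    · exact hσ.of_lt (sum_vertexDegree_lt (r := fun t => (r t : ℕ)) (c := fun t => (s t : ℕ))
        (fun _ _ h => r.strictMono h) (fun _ _ h => s.strictMono h) h1)
  rw [Finset.sum_ite_eq' Finset.univ, if_pos (Finset.mem_univ _)] at key
  convert key using 1
  rw [← Units.coeHom_apply, map_list_prod, List.map_ofFn]
  rfl

/-- The degree of `y_c`; it is `i ^ 2 * j` for the pressed double interval `π(i, j)`. -/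
def pressedDegree (c : PInt m n) : ℤ :=
  ((c.1.rows.sup fun x => (x : ℕ) + 1 : ℕ) : ℤ) ^ 2 * (c.1.cols.sup fun x => (x : ℕ) + 1 : ℕ)

theorem sup_Icc {a b : Fin n} (h : a ≤ b) :
    (Finset.Icc a b).sup (fun x => (x : ℕ) + 1) = (b : ℕ) + 1 := by
  refine le_antisymm (Finset.sup_le fun x hx => ?_)
    (Finset.le_sup (f := fun x : Fin n => (x : ℕ) + 1) (Finset.right_mem_Icc.mpr h))
  have := Fin.le_def.mp (Finset.mem_Icc.mp hx).2
  omega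

theorem pressedDegree_piPInt (i : Fin m) (j : Fin n) :
    pressedDegree (piPInt i j) = ((i : ℤ) + 1) ^ 2 * (j + 1) := by
  simp only [pressedDegree, piPInt, piCortege]
  rw [sup_Icc, sup_Icc]
  · push_cast; rfl
  · simp only [lower, Fin.le_def]; omega
  · simp only [lower, Fin.le_def]; omega

/-- The function `c ↦ y_c T ^ (deg c)`. -/
noncomputable def homValue (y : PInt m n → Rˣ) (c : PInt m n) : (AddMonoidAlgebra R ℤ)ˣ :=
  homUnit (pressedDegree c) (y c)

/-- `T` is central, so any choice of degrees preserves the relations. -/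
theorem QuasiCommutes.homValue {y : PInt m n → Rˣ} (hy : QuasiCommutes q y) :
    QuasiCommutes q (homValue y) := by
  intro c c' h
  rw [QuantumMinors.homValue, QuantumMinors.homValue, val_homUnit, val_homUnit, single_mul_single,
    single_mul_single, hy c c' h, add_comm, smul_single]

theorem innerWeight_homValue (y : PInt m n → Rˣ) (i : Fin m) (j : Fin n) :
    innerWeight (homValue y) i j = homUnit (vertexDegree i j) (innerWeight y i j) := by
  rw [innerWeight, innerWeight]
  simp only [homValue]
  split_ifs with h
  · congr 1
    rw [pressedDegree_piPInt, vertexDegree]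
    rcases h with h | h <;> rw [h] <;> push_cast <;> ring
  · rw [homUnit_inv, homUnit_mul]
    congr 1
    obtain ⟨i, hi⟩ := i
    obtain ⟨j, hj⟩ := j
    simp only at h
    obtain ⟨i, rfl⟩ := Nat.exists_eq_succ_of_ne_zero fun h' => h (Or.inl h')
    obtain ⟨j, rfl⟩ := Nat.exists_eq_succ_of_ne_zero fun h' => h (Or.inr h')
    rw [pressedDegree_piPInt, pressedDegree_piPInt, vertexDegree]
    simp only [lower, Nat.succ_sub_one]
    push_cast
    -- The difference of `i² j` along a diagonal, which is how `vertexDegree` arises.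
    ring

theorem not_isZeroDivisor_pathExtension_homValue (y : PInt m n → Rˣ) (c : Cortege m n) :
    ¬IsZeroDivisor (pathExtension q (homValue y) c) := by
  have hX (i : Fin m) (j : Fin n) : LeadsWith (vertexDegree i j) (innerWeight y i j : R)
      (pathMatrix (innerWeight (homValue y)) i j) := by
    rw [pathMatrix_eq_pathSum]
    have := leadsWith_pathSum (w := extendWeight (innerWeight (homValue y)))
      (u := extendWeight (innerWeight y)) (d := i) (p := 0) (e := j) fun k l hk hl => by
        have h1 : k < m := by have := i.2; omega
        have h2 : l < n := by have := j.2; omega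
        rw [extendWeight_of_lt _ h1 h2, extendWeight_of_lt _ h1 h2, innerWeight_homValue]
    rw [Nat.zero_add, extendWeight_of_lt _ i.2 j.2] at this
    exact this
  obtain ⟨d, v, h⟩ := leadsWith_qMinor (q := q) hX c
  exact h.not_isZeroDivisor

end LeadingTerms

/-! ### Functoriality of the extension -/

section Functoriality

variable {K : Type*} [Field K] {q : Kˣ} {A : Type*} [Ring A] [Algebra K A] {B : Type*} [Ring B]
  [Algebra K B] {m n : ℕ} (ψ : A →ₐ[K] B)

theorem innerWeight_map (f₀ : PInt m n → Aˣ) (i : Fin m) (j : Fin n) :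
    innerWeight (fun c => Units.map (ψ : A →* B) (f₀ c)) i j
      = Units.map (ψ : A →* B) (innerWeight f₀ i j) := by
  simp only [innerWeight]
  split_ifs <;> simp only [map_mul, map_inv]

theorem edgeWeight_map (w : Fin m → Fin n → Aˣ) (a b : GridVertex m n) :
    edgeWeight (fun i j => Units.map (ψ : A →* B) (w i j)) a b
      = Units.map (ψ : A →* B) (edgeWeight w a b) := by
  have h (c : GridVertex m n) : vertexWeight (fun i j => Units.map (ψ : A →* B) (w i j)) c
      = Units.map (ψ : A →* B) (vertexWeight w c) := by
    simp only [vertexWeight]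
    split_ifs <;> simp only [map_one]
  simp only [edgeWeight, h]
  split_ifs <;> simp only [map_mul, map_inv, map_one]

theorem pathMatrix_map (w : Fin m → Fin n → Aˣ) (i : Fin m) (j : Fin n) :
    pathMatrix (fun i j => Units.map (ψ : A →* B) (w i j)) i j = ψ (pathMatrix w i j) := by
  rw [pathMatrix, pathMatrix, map_sum]
  refine Finset.sum_congr rfl fun P _ => ?_
  have h : edgeWeight (fun i j => Units.map (ψ : A →* B) (w i j))
      = fun a b : GridVertex m n => Units.map (ψ : A →* B) (edgeWeight w a b) := by
    ext a b; rw [edgeWeight_map]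
  rw [pathWeight, pathWeight, h, ← List.map_zipWith, ← map_list_prod]
  rfl

theorem pathExtension_map (f₀ : PInt m n → Aˣ) (c : Cortege m n) :
    pathExtension q (fun c => Units.map (ψ : A →* B) (f₀ c)) c = ψ (pathExtension q f₀ c) := by
  have h : pathMatrix (innerWeight fun c => Units.map (ψ : A →* B) (f₀ c))
      = fun i j => ψ (pathMatrix (innerWeight f₀) i j) := by
    ext i j
    rw [← pathMatrix_map]
    congr 1
    ext i j
    rw [innerWeight_map]
  rw [pathExtension, pathExtension, h]
  simp only [qMinor]
  rw [map_sum]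
  refine Finset.sum_congr rfl fun σ _ => ?_
  rw [map_smul, map_list_prod, List.map_ofFn]
  rfl

end Functoriality

/-! ### Quantized Laurent polynomials -/

section Laurent

variable {K : Type*} [Field K] {q : Kˣ} {B : Type*} [Ring B] [Algebra K B] {m n : ℕ}

/-- The indeterminate `y_c` as a unit. -/
def QLaurent.unit (q : Kˣ) (c : PInt m n) : (QLaurent q m n)ˣ where
  val := QLaurent.y q c
  inv := RingQuot.mkAlgHom K (LaurentRel q m n) (FreeAlgebra.ι K (Sum.inr c))
  val_inv := by
    rw [QLaurent.y, ← map_mul, RingQuot.mkAlgHom_rel K (LaurentRel.mul_inv c), map_one]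
  inv_val := by
    rw [QLaurent.y, ← map_mul, RingQuot.mkAlgHom_rel K (LaurentRel.inv_mul c), map_one]

theorem QLaurent.quasiCommutes_unit : QuasiCommutes q (QLaurent.unit (m := m) (n := n) q) := by
  intro c c' h
  change QLaurent.y q c * QLaurent.y q c' = _ • (QLaurent.y q c' * QLaurent.y q c)
  simp only [QLaurent.y]
  rw [← map_mul, RingQuot.mkAlgHom_rel K (LaurentRel.comm c c' h), map_smul, map_mul]

/-- The homomorphism from the quantized Laurent polynomials given by a quasi-commuting family. -/
noncomputable def QLaurent.lift (f₀ : PInt m n → Bˣ) (hf₀ : QuasiCommutes q f₀) :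
    QLaurent q m n →ₐ[K] B :=
  RingQuot.liftAlgHom K ⟨FreeAlgebra.lift K
      (Sum.elim (fun c => (f₀ c : B)) fun c => ((f₀ c)⁻¹ : Bˣ).val), by
    intro x y h
    cases h with
    | mul_inv c => simp
    | inv_mul c => simp
    | comm c c' h => simpa using hf₀ c c' h⟩

theorem QLaurent.lift_y (f₀ : PInt m n → Bˣ) (hf₀ : QuasiCommutes q f₀) (c : PInt m n) :
    QLaurent.lift f₀ hf₀ (QLaurent.y q c) = f₀ c := by
  rw [QLaurent.lift, QLaurent.y, RingQuot.liftAlgHom_mkAlgHom_apply, FreeAlgebra.lift_ι_apply]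
  rfl

/-- The images of the inverse generators are forced, being inverses of the images of the `y_c`. -/
theorem QLaurent.hom_ext {φ ψ : QLaurent q m n →ₐ[K] B}
    (h : ∀ c, φ (QLaurent.y q c) = ψ (QLaurent.y q c)) : φ = ψ := by
  refine RingQuot.ringQuot_ext' _ _ _ (FreeAlgebra.hom_ext (funext fun c => ?_))
  rcases c with c | c
  · exact h c
  · have hu : Units.map (φ : _ →* B) (QLaurent.unit q c) = Units.map (ψ : _ →* B) (QLaurent.unit q c) :=
      Units.ext (h c)
    exact congrArg (fun u : Bˣ => (u⁻¹ : Bˣ).val) hu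

/-- The homogenization `θ` is injective because setting `T = 1` undoes it, so an annihilator of
`f(c)` would give one of the homogenized minor. No basis of the quantized Laurent algebra is needed.
-/
theorem QLaurent.not_isZeroDivisor_pathExtension (c : Cortege m n) :
    ¬IsZeroDivisor (pathExtension q (QLaurent.unit q) c) := by
  let θ := QLaurent.lift _ (QLaurent.quasiCommutes_unit (q := q) (m := m) (n := n)).homValue
  let ev : AddMonoidAlgebra (QLaurent q m n) ℤ →ₐ[K] QLaurent q m n :=
    AddMonoidAlgebra.liftNCAlgHom (AlgHom.id K _) 1 fun _ _ => Commute.one_right _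
  have hev : ev.comp θ = AlgHom.id K _ := by
    refine QLaurent.hom_ext fun d => ?_
    rw [AlgHom.comp_apply, QLaurent.lift_y]
    refine (AddMonoidAlgebra.liftNC_single _ _ _ _).trans ?_
    exact mul_one _
  have hθ : Function.Injective θ :=
    Function.LeftInverse.injective (g := ev) fun x => DFunLike.congr_fun hev x
  have hF : θ (pathExtension q (QLaurent.unit q) c)
      = pathExtension q (homValue (QLaurent.unit q)) c := by
    rw [← pathExtension_map]
    congr 1
    funext d
    exact Units.ext (QLaurent.lift_y _ _ d)
  rintro ⟨b, hb, h⟩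
  refine not_isZeroDivisor_pathExtension_homValue (q := q) (QLaurent.unit q) c
    ⟨θ b, (map_ne_zero_iff θ hθ).mpr hb, ?_⟩
  rw [← hF, ← map_mul, ← map_mul]
  exact h.imp (fun h => by rw [h, map_zero]) fun h => by rw [h, map_zero]

/-- By functoriality `f(c)` is the image of its generic counterpart and so lies in the value
algebra, where (ii) allows zerodivisors to be tested. -/
theorem not_isZeroDivisor_pathExtension {A : Type*} [Ring A] [Algebra K A]
    {f₀ : PInt m n → Aˣ} (hindep : AlgIndependentValues q f₀)
    (hzd : ∀ a : valueAlgebra K f₀, IsZeroDivisor (a : A) → IsZeroDivisor a) (c : Cortege m n) :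
    ¬IsZeroDivisor (pathExtension q f₀ c) := by
  obtain ⟨φ, hφ⟩ := hindep
  have hF : pathExtension q f₀ c = (φ (pathExtension q (QLaurent.unit q) c) : A) := by
    have := pathExtension_map (q := q) ((valueAlgebra K f₀).val.comp (φ : _ →ₐ[K] _))
      (QLaurent.unit q) c
    refine Eq.trans ?_ this
    congr 1
    funext d
    exact Units.ext (hφ d).symm
  intro h
  rw [hF] at h
  obtain ⟨b, hb, h⟩ := hzd _ h
  refine QLaurent.not_isZeroDivisor_pathExtension (q := q) c
    ⟨φ.symm b, (map_ne_zero_iff φ.symm φ.symm.injective).mpr hb, ?_⟩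
  refine h.imp (fun h => φ.injective ?_) fun h => φ.injective ?_ <;>
    rw [map_mul, AlgEquiv.apply_symm_apply, h, map_zero]

end Laurent

end QuantumMinors

/-! ### The corollary. -/

theorem mainTheorem3 {K : Type*} [Field K] {A : Type*} [Ring A] [Algebra K A] (q : Kˣ) (m n : ℕ)
    (f₀ : PInt m n → Aˣ) (hf₀ : QuasiCommutes q f₀)
    (hindep : AlgIndependentValues q f₀)
    (hzd : ∀ a : valueAlgebra K f₀, IsZeroDivisor (a : A) → IsZeroDivisor a)
    (g : Cortege m n → A) (hg_norm : g (Cortege.empty m n) = 1)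
    (hg : IsRQIFunction q g)
    (hgf₀ : ∀ c : PInt m n, g c.1 = (f₀ c : A)) :
    IsQIFunction q g ∧ g = pathExtension q f₀ := by
  have h : pathExtension q f₀ = g := by
    -- The path extension takes the first place, since the uniqueness argument cancels values of the
    -- first function and regularity is established for this one.
    refine hf₀.isFine_pathMatrix.isRQIFunction.eq_of_eq_on_pressed hg ?_ (fun c => ?_)
      fun c a hca => ?_
    · rw [hg_norm]
      exact pathExtension_empty f₀
    · rw [hgf₀]
      exact hf₀.pathExtension_pressed c
    · by_contra ha
      exact not_isZeroDivisor_pathExtension hindep hzd c ⟨a, ha, Or.inl hca⟩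
  rw [← h]
  exact ⟨fun Q hQ => hQ.2 q A _ hf₀.isFine_pathMatrix, rfl⟩
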